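/- Theorem ($L^p$ regularity for $\lambda\kappa>0$). For real $\lambda,\kappa$ with $\lambda\kappa>0$ consider the spatially $1$-periodic generalized Hunter--Saxton system $$u_{xt}+uu_{xx}-\lambda u_x^2-\kappa\rho^2=I(t),\qquad \rho_t+u\rho_x=2\lambda\rho u_x,\qquad I(t)=-\kappa\int_0^1\rho^2\,dx-(1+\lambda)\int_0^1u_x^2\,dx,$$ with smooth $1$-periodic initial data $u(\cdot,0)=u_0$, $\rho(\cdot,0)=\rho_0$. Put $$\mathcal Q(x,\eta)=\lambda\bigl(\lambda u_0'(x)^2-\kappa\rho_0(x)^2\bigr)\eta^2-2\lambda u_0'(x)\eta+1,\qquad g_\pm=u_0'\pm\sqrt{\kappa/\lambda}\,|\rho_0|,$$ $$t(\eta)=\int_0^\eta\Bigl(\int_0^1\mathcal Q(x,\mu)^{-\frac1{2\lambda}}\,dx\Bigr)^{2\lambda}d\mu .$$ Call $(u_0,\rho_0)$ admissible for $(\lambda,\kappa)$ if there is a smallest positive $\eta_*$ for which $\mathcal Q(\cdot,\eta_*)$ has a zero in $[0,1]$ and, at every $x\in[0,1]$ with $\mathcal Q(x,\eta_*)=0$,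 the number $\eta_*$ is a simple root of $\mathcal Q(x,\cdot)$ and the function $g_-$ (if $\lambda<0$), respectively $g_+$ (if $\lambda>0$), has vanishing first and nonvanishing second derivative at $x$. There exist smooth $1$-periodic data that are admissible for all $(\lambda,\kappa)$ with $\lambda\kappa>0$. Moreover, whenever $\lambda\kappa>0$ and $(u_0,\rho_0)$ is admissible for $(\lambda,\kappa)$, the limit $t_*=\lim_{\eta\nearrow\eta_*}t(\eta)$ exists and $0<t_*<\infty$, a smooth $1$-periodic solution $(u,\rho)$ with these data exists on $[0,t_*)$, and every such solution satisfies, with $\|\cdot\|_p$ the norm of $L^p([0,1])$: 1. for $p\in(1,\infty)$ and $\lambda\in(-\infty,-1/p]\cup(0,\infty)$, $\lim_{t\nearrow t_*}\|u_x(\cdot,t)\|_p=+\infty$; 2. for $p\in[1,\infty)$ and $\lambda\in(-1/(2p-1),0)$, $\lim_{t\nearrow t_*}\|u_x(\cdot,t)\|_p$ exists and is finite; 3. for $p\in[1,\infty)$ and $\lambda\in(-\infty,-1/(2p-1)]\cup(0,\infty)$, $\lim_{t\nearrow t_*}\|\rho(\cdot,t)\|_p=+\infty$; 4. for $p\in[1,\infty)$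 and $\lambda\in(-1/(2p-1),0)$, $\lim_{t\nearrow t_*}\|\rho(\cdot,t)\|_p$ exists and is finite. -/

import Mathlib

open scoped ContDiff NNReal ENNReal Topology
open MeasureTheory Set Filter

noncomputable section

namespace GHS

/-- Smooth initial data on the circle of length one: smooth `1`-periodic functions on the line. -/
structure IsSmoothPeriodicData (u₀ ρ₀ : ℝ → ℝ) : Prop where
  smooth_u : ContDiff ℝ ∞ u₀
  smooth_ρ : ContDiff ℝ ∞ ρ₀
  periodic_u : Function.Periodic u₀ 1
  periodic_ρ : Function.Periodic ρ₀ 1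

/-- The spatial derivative `u_x (x, t)`. -/
def dx (u : ℝ → ℝ → ℝ) (x t : ℝ) : ℝ := deriv (fun y => u y t) x

/-- The time derivative `u_t (x, t)`. -/
def dt (u : ℝ → ℝ → ℝ) (x t : ℝ) : ℝ := deriv (fun s => u x s) t

/-- The nonlocal term `I(t) = -κ ∫₀¹ ρ² dx - (1 + λ) ∫₀¹ u_x² dx`. -/
def nonlocal (lam kap : ℝ) (u ρ : ℝ → ℝ → ℝ) (t : ℝ) : ℝ :=
  -kap * (∫ x in (0 : ℝ)..1, ρ x t ^ 2) - (1 + lam) * ∫ x in (0 : ℝ)..1, dx u x t ^ 2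

/-- `(u, ρ)` is a smooth, spatially `1`-periodic solution on the time interval `[0, T)` of
`u_xt + u u_xx - λ u_x² - κ ρ² = I(t)`, `ρ_t + u ρ_x = 2 λ ρ u_x`,
with initial data `(u₀, ρ₀)`. -/
structure IsSmoothSolution (lam kap : ℝ) (u₀ ρ₀ : ℝ → ℝ) (T : ℝ) (u ρ : ℝ → ℝ → ℝ) : Prop where
  smooth_u : ContDiffOn ℝ ∞ (fun q : ℝ × ℝ => u q.1 q.2) (univ ×ˢ Ico 0 T)
  smooth_ρ : ContDiffOn ℝ ∞ (fun q : ℝ × ℝ => ρ q.1 q.2) (univ ×ˢ Ico 0 T)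
  periodic_u : ∀ t ∈ Ico 0 T, Function.Periodic (fun x => u x t) 1
  periodic_ρ : ∀ t ∈ Ico 0 T, Function.Periodic (fun x => ρ x t) 1
  init_u : ∀ x, u x 0 = u₀ x
  init_ρ : ∀ x, ρ x 0 = ρ₀ x
  eq_u : ∀ t ∈ Ioo 0 T, ∀ x,
    dt (dx u) x t + u x t * dx (dx u) x t - lam * dx u x t ^ 2 - kap * ρ x t ^ 2
      = nonlocal lam kap u ρ t
  eq_ρ : ∀ t ∈ Ioo 0 T, ∀ x,
    dt ρ x t + u x t * dx ρ x t = 2 * lam * ρ x t * dx u x t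

/-- `c(x) = λ (λ u₀'(x)² - κ ρ₀(x)²)`. -/
def c (lam kap : ℝ) (u₀ ρ₀ : ℝ → ℝ) (x : ℝ) : ℝ :=
  lam * (lam * deriv u₀ x ^ 2 - kap * ρ₀ x ^ 2)

/-- `𝒬(x, η) = c(x) η² - 2 λ u₀'(x) η + 1`, in terms of the variable `η`. -/
def Q (lam kap : ℝ) (u₀ ρ₀ : ℝ → ℝ) (x η : ℝ) : ℝ :=
  c lam kap u₀ ρ₀ x * η ^ 2 - 2 * lam * deriv u₀ x * η + 1

/-- `g₊ = u₀' + √(κ/λ) |ρ₀|`. -/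
def gPlus (lam kap : ℝ) (u₀ ρ₀ : ℝ → ℝ) (x : ℝ) : ℝ :=
  deriv u₀ x + √(kap / lam) * |ρ₀ x|

/-- `g₋ = u₀' - √(κ/λ) |ρ₀|`. -/
def gMinus (lam kap : ℝ) (u₀ ρ₀ : ℝ → ℝ) (x : ℝ) : ℝ :=
  deriv u₀ x - √(kap / lam) * |ρ₀ x|

/-- `ηs` is the smallest positive `η` for which `𝒬(·, η)` has a zero; at every point `x` where
`𝒬(x, ηs) = 0`, `ηs` is a simple root of `𝒬(x, ·)` and `x` is a nondegenerate critical point of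
`g₋` (when `λ < 0`), respectively of `g₊` (when `λ > 0`).

For `λ κ > 0` one has `𝒬 = (1 - λ η g₊) (1 - λ η g₋)`, so these points are the ones where `g₋`
attains its minimum, respectively `g₊` its maximum; the root is simple if and only if
`ρ₀ x ≠ 0`, so `g₋` and `g₊` are smooth near `x`. -/
structure IsEarliestSimpleRoot (lam kap : ℝ) (u₀ ρ₀ : ℝ → ℝ) (ηs : ℝ) : Prop where
  earliest : IsLeast {η : ℝ | 0 < η ∧ ∃ x ∈ Icc (0 : ℝ) 1, Q lam kap u₀ ρ₀ x η = 0} ηs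
  simple : ∀ x ∈ Icc (0 : ℝ) 1, Q lam kap u₀ ρ₀ x ηs = 0 →
    deriv (fun η => Q lam kap u₀ ρ₀ x η) ηs ≠ 0
  nondeg_neg : lam < 0 → ∀ x ∈ Icc (0 : ℝ) 1, Q lam kap u₀ ρ₀ x ηs = 0 →
    deriv (gMinus lam kap u₀ ρ₀) x = 0 ∧ deriv (deriv (gMinus lam kap u₀ ρ₀)) x ≠ 0
  nondeg_pos : 0 < lam → ∀ x ∈ Icc (0 : ℝ) 1, Q lam kap u₀ ρ₀ x ηs = 0 →
    deriv (gPlus lam kap u₀ ρ₀) x = 0 ∧ deriv (deriv (gPlus lam kap u₀ ρ₀)) x ≠ 0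

/-- The time variable `t(η) = ∫₀^η (∫₀¹ 𝒬(x, μ)^(-1/(2λ)) dx)^(2λ) dμ`. -/
def timeOf (lam kap : ℝ) (u₀ ρ₀ : ℝ → ℝ) (η : ℝ) : ℝ :=
  ∫ μ in (0 : ℝ)..η,
    (∫ x in (0 : ℝ)..1, 1 / Q lam kap u₀ ρ₀ x μ ^ (1 / (2 * lam))) ^ (2 * lam)

/-- The `L^p([0,1])` norm, with values in `[0, ∞]`. -/
def normLp (p : ℝ) (f : ℝ → ℝ) : ℝ≥0∞ :=
  eLpNorm f (ENNReal.ofReal p) (volume.restrict (Icc (0 : ℝ) 1))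

end GHS

end

/-! Let `γ` be the flow of `u` and `J = γ_x`. Then `u_x ∘ γ = J_t / J`, and the second equation
gives `ρ ∘ γ = ρ₀ J^(2λ)`. The first becomes a Riccati equation for `J_t / J`, solved by `J = (E /
𝒬(·, η(t)))^(1/(2λ))` with `E = η'`: the discriminant `4λκρ₀²` of `𝒬(x, ·)` produces the term `κρ²`
(`hasDerivAt_logRate`). Requiring `∫ J = 1` forces `E = A(η)^(-2λ)` with `A = ∫ 𝒬^(-1/(2λ))`, that
is `dt/dη = A^(2λ)`, and also identifies the remaining function of time with `I(t)`
(`isSmoothSolution_of_lagrangian`, `exists_clock`).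

The solution is not unique: with `u(x, t)` also `u(x - s(t), t) + s'(t)` satisfies the equations
(with `ρ` shifted alike). This is the only freedom: an energy estimate in a moving frame shows that
`u_x` and `ρ` of any two solutions differ by a translation at each time (`eq_translate`), which the
norms over a period do not see. So all norms are those of the explicit solution, and pulled back by
the flow they are integrals in `η` alone: `∫ |ρ₀ A^(-2λ) / 𝒬|^p J` and `∫ |A^(-2λ) (D - 𝒬_η / 𝒬) /
(2λ)|^p J`, where `D` is the `J`-mean of `𝒬_η / 𝒬` (`norm_solution`).

It remains to let `η ↗ η_*`. Since `λκ > 0`, `𝒬` splits into two real linear factors in `η`;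
simplicity lets only one of them vanish at `η_*`, and nondegeneracy makes it vanish quadratically in
`x`. Hence near a zero `x₀` one has `𝒬 ≍ ε + (x - x₀)²` with `ε = η_* - η`. The time `t_*` is finite
by an interpolated bound on `A`. For `λ < 0` the mass `A` stays between positive constants and
everything hinges on `∫ 𝒬^(-(p + 1/(2λ)))`: the exponent is below `1/2` exactly when `λ >
-1/(2p-1)`, and then dominated convergence applies; from `1/2` on the integral diverges. For `λ > 0`
an interval of length `√ε` at the zero already carries a divergent contribution. For `u_x` the mean
`D` is not estimated in the divergent cases: it cannot be close to `𝒬_η / 𝒬` in two regions where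
this quotient has different sizes. -/

namespace GHS

/-! ### Smooth functions of `(x, t)` on a time set -/

/-- `f (x, t)` is smooth for `x ∈ ℝ`, `t ∈ I`. -/
def SmoothOn (I : Set ℝ) (f : ℝ → ℝ → ℝ) : Prop :=
  ContDiffOn ℝ ∞ (fun q : ℝ × ℝ => f q.1 q.2) (univ ×ˢ I)

section SmoothOn

variable {I : Set ℝ} {f g : ℝ → ℝ → ℝ} {x t : ℝ}

theorem SmoothOn.mono {I' : Set ℝ} (hf : SmoothOn I f) (h : I' ⊆ I) : SmoothOn I' f :=
  ContDiffOn.mono hf (prod_mono_right h)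

theorem SmoothOn.continuousOn (hf : SmoothOn I f) :
    ContinuousOn (fun q : ℝ × ℝ => f q.1 q.2) (univ ×ˢ I) :=
  ContDiffOn.continuousOn hf

theorem SmoothOn.contDiff_slice (hf : SmoothOn I f) (ht : t ∈ I) :
    ContDiff ℝ ∞ (fun x => f x t) := by
  rw [← contDiffOn_univ]
  exact ContDiffOn.comp hf (contDiffOn_id.prodMk contDiffOn_const) (fun x _ => ⟨mem_univ _, ht⟩)

theorem SmoothOn.continuous_slice (hf : SmoothOn I f) (ht : t ∈ I) :
    Continuous (fun x => f x t) :=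
  (hf.contDiff_slice ht).continuous

theorem SmoothOn.hasDerivAt_dx (hf : SmoothOn I f) (ht : t ∈ I) :
    HasDerivAt (fun y => f y t) (dx f x t) x :=
  ((hf.contDiff_slice ht).differentiable (by simp) x).hasDerivAt

theorem SmoothOn.dx (hI : UniqueDiffOn ℝ I) (hf : SmoothOn I f) : SmoothOn I (dx f) := by
  have hS : UniqueDiffOn ℝ ((univ : Set ℝ) ×ˢ I) := uniqueDiffOn_univ.prod hI
  have h1 : ContDiffOn ℝ ∞ (fun q : ℝ × ℝ =>
      fderivWithin ℝ (fun q : ℝ × ℝ => f q.1 q.2) (univ ×ˢ I) q (1, 0)) (univ ×ˢ I) :=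
    (ContDiffOn.fderivWithin hf hS (m := ∞) (by simp)).clm_apply contDiffOn_const
  refine h1.congr fun q hq => ?_
  have h2 := (ContDiffOn.differentiableOn hf (by simp) q hq).hasFDerivWithinAt
  have h3 : HasDerivWithinAt (fun y : ℝ => (y, q.2)) ((1 : ℝ), (0 : ℝ)) univ q.1 :=
    ((hasDerivAt_id q.1).prodMk (hasDerivAt_const q.1 q.2)).hasDerivWithinAt
  have h4 := HasFDerivWithinAt.comp_hasDerivWithinAt (f := fun y : ℝ => (y, q.2)) q.1 h2 h3
    (fun y _ => (⟨mem_univ _, hq.2⟩ : (y, q.2) ∈ (univ : Set ℝ) ×ˢ I))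
  exact (hasDerivWithinAt_univ.1 h4).deriv

theorem SmoothOn.contDiffAt (hf : SmoothOn I f) (ht : I ∈ 𝓝 t) :
    ContDiffAt ℝ ∞ (fun q : ℝ × ℝ => f q.1 q.2) (x, t) :=
  ContDiffOn.contDiffAt hf (prod_mem_nhds univ_mem ht)

theorem SmoothOn.hasDerivAt_dt (hf : SmoothOn I f) (ht : I ∈ 𝓝 t) :
    HasDerivAt (fun s => f x s) (dt f x t) t := by
  have h := ((hf.contDiffAt ht (x := x)).differentiableAt (by simp))
  have h2 : DifferentiableAt ℝ (fun s : ℝ => (x, s)) t := by fun_prop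
  exact (DifferentiableAt.comp t h h2).hasDerivAt

theorem SmoothOn.hasDerivAt_curve (hf : SmoothOn I f) (ht : I ∈ 𝓝 t) {s : ℝ → ℝ} {s' : ℝ}
    (hs : HasDerivAt s s' t) :
    HasDerivAt (fun τ => f (s τ) τ) (GHS.dx f (s t) t * s' + dt f (s t) t) t := by
  have h := ((hf.contDiffAt ht (x := s t)).differentiableAt (by simp)).hasFDerivAt
  have h1 := h.comp_hasDerivAt (f := fun τ => (s τ, τ)) t (hs.prodMk (hasDerivAt_id t))
  have hx := h.comp_hasDerivAt (f := fun y => (y, t)) (s t) ((hasDerivAt_id (s t)).prodMk (hasDerivAt_const (s t) t))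
  have ht' := h.comp_hasDerivAt (f := fun τ => (s t, τ)) t ((hasDerivAt_const t (s t)).prodMk (hasDerivAt_id t))
  have ex : GHS.dx f (s t) t = _ := hx.deriv
  have et : dt f (s t) t = _ := ht'.deriv
  rw [ex, et]
  refine h1.congr_deriv ?_
  rw [mul_comm]
  have : ((s', (1 : ℝ)) : ℝ × ℝ) = s' • ((1 : ℝ), (0 : ℝ)) + ((0 : ℝ), (1 : ℝ)) := by simp
  rw [this, map_add, map_smul, smul_eq_mul]

theorem SmoothOn.dt (hI : IsOpen I) (hf : SmoothOn I f) : SmoothOn I (dt f) := by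
  have hS : IsOpen ((univ : Set ℝ) ×ˢ I) := isOpen_univ.prod hI
  have h1 : ContDiffOn ℝ ∞ (fun q : ℝ × ℝ =>
      fderiv ℝ (fun q : ℝ × ℝ => f q.1 q.2) q (0, 1)) (univ ×ˢ I) :=
    (ContDiffOn.fderiv_of_isOpen hf hS (m := ∞) (by simp)).clm_apply contDiffOn_const
  refine h1.congr fun q hq => ?_
  have h := ((hf.contDiffAt (hI.mem_nhds hq.2) (x := q.1)).differentiableAt (by simp)).hasFDerivAt
  exact (h.comp_hasDerivAt q.2 ((hasDerivAt_const q.2 q.1).prodMk (hasDerivAt_id q.2))).deriv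

end SmoothOn

/-! ### Integrals depending smoothly on a parameter -/

theorem hasFDerivAt_parametric_integral {E F : Type} [NormedAddCommGroup E] [NormedSpace ℝ E]
    [LocallyCompactSpace E] [NormedAddCommGroup F] [NormedSpace ℝ F]
    {Ω : Set E} (hΩ : IsOpen Ω) {h : E × ℝ → F} (hh : ContDiffOn ℝ 1 h (Ω ×ˢ univ)) (a b : ℝ)
    {p : E} (hp : p ∈ Ω) :
    HasFDerivAt (fun p => ∫ s in a..b, h (p, s))
      (∫ s in a..b, (fderiv ℝ h (p, s)).comp (ContinuousLinearMap.inl ℝ E ℝ)) p := by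
  have hO : IsOpen (Ω ×ˢ (univ : Set ℝ)) := hΩ.prod isOpen_univ
  have hc : ContinuousOn h (Ω ×ˢ univ) := hh.continuousOn
  have hd : ContinuousOn (fun q : E × ℝ => (fderiv ℝ h q).comp (ContinuousLinearMap.inl ℝ E ℝ))
      (Ω ×ˢ univ) :=
    (hh.continuousOn_fderiv_of_isOpen hO le_rfl).clm_comp continuousOn_const
  have slice : ∀ {G : Type} [TopologicalSpace G] {k : E × ℝ → G} (_ : ContinuousOn k (Ω ×ˢ univ))
      {y : E} (_ : y ∈ Ω), Continuous fun s => k (y, s) := fun hk y hy =>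
    hk.comp_continuous (by fun_prop) (fun s => ⟨hy, mem_univ _⟩)
  obtain ⟨K, hK, hKΩ, hKc⟩ := local_compact_nhds (hΩ.mem_nhds hp)
  obtain ⟨C, hC⟩ := (hKc.prod (isCompact_uIcc (a := a) (b := b))).exists_bound_of_continuousOn
    (hd.mono (prod_mono hKΩ (subset_univ _)))
  refine intervalIntegral.hasFDerivAt_integral_of_dominated_of_fderiv_le (bound := fun _ => C)
    (F := fun p s => h (p, s))
    (F' := fun p s => (fderiv ℝ h (p, s)).comp (ContinuousLinearMap.inl ℝ E ℝ)) hK ?_ ?_ ?_ ?_ ?_ ?_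
  · filter_upwards [hΩ.mem_nhds hp] with y hy
    exact (slice hc hy).aestronglyMeasurable
  · exact (slice hc hp).intervalIntegrable _ _
  · exact (slice hd hp).aestronglyMeasurable
  · exact Eventually.of_forall fun s hs y hy => hC (y, s) ⟨hy, uIoc_subset_uIcc hs⟩
  · exact intervalIntegrable_const
  · refine Eventually.of_forall fun s _ y hy => ?_
    have h1 := ((hh.contDiffAt (hO.mem_nhds (x := (y, s)) ⟨hKΩ hy, mem_univ _⟩)).differentiableAt
      (by simp)).hasFDerivAt
    exact h1.comp y (hasFDerivAt_prodMk_left y s)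

/-- Induction on the order: the derivative is again a parametric integral, of a partial derivative
with values in `E →L[ℝ] F`. This is why the target space `F` varies inside the induction. -/
theorem contDiffOn_parametric_integral {E : Type} [NormedAddCommGroup E] [NormedSpace ℝ E]
    [LocallyCompactSpace E] {Ω : Set E} (hΩ : IsOpen Ω) (a b : ℝ) (n : ℕ) :
    ∀ {F : Type} [NormedAddCommGroup F] [NormedSpace ℝ F]
      {h : E × ℝ → F}, ContDiffOn ℝ ∞ h (Ω ×ˢ univ) →
      ContDiffOn ℝ n (fun p => ∫ s in a..b, h (p, s)) Ω := by
  have hO : IsOpen (Ω ×ˢ (univ : Set ℝ)) := hΩ.prod isOpen_univ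
  induction n with
  | zero =>
    intro F _ _ h hh
    exact contDiffOn_zero.2 fun p hp => (hasFDerivAt_parametric_integral hΩ
      (hh.of_le (by simp)) a b hp).continuousAt.continuousWithinAt
  | succ n ih =>
    intro F _ _ h hh
    have hder : ∀ p ∈ Ω, HasFDerivAt _ _ p := fun p hp =>
      hasFDerivAt_parametric_integral hΩ (hh.of_le (by simp)) a b hp
    push_cast
    rw [contDiffOn_succ_iff_fderiv_of_isOpen hΩ]
    refine ⟨fun p hp => (hder p hp).differentiableAt.differentiableWithinAt, by simp, ?_⟩
    refine ContDiffOn.congr ?_ (fun p hp => (hder p hp).fderiv)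
    exact ih ((hh.fderiv_of_isOpen hO (m := ∞) (by simp)).clm_comp contDiffOn_const)

section SmoothOn

variable {I : Set ℝ} {f g : ℝ → ℝ → ℝ} {x t : ℝ}

theorem SmoothOn.contDiffOn_integral (hI : IsOpen I) (hf : SmoothOn I f) (a b : ℝ) :
    ContDiffOn ℝ ∞ (fun t => ∫ x in a..b, f x t) I := by
  refine contDiffOn_infty.2 fun n => contDiffOn_parametric_integral hI a b n
    (h := fun q : ℝ × ℝ => f q.2 q.1) ?_
  exact ContDiffOn.comp (t := univ ×ˢ I) hf (contDiff_snd.prodMk contDiff_fst).contDiffOn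
    (fun q hq => ⟨mem_univ _, hq.1⟩)

theorem hasDerivAt_integral_of_contDiffOn (hI : IsOpen I)
    (hf : ContDiffOn ℝ 1 (fun q : ℝ × ℝ => f q.1 q.2) (univ ×ˢ I)) (a b : ℝ) (ht : t ∈ I) :
    HasDerivAt (fun t => ∫ x in a..b, f x t) (∫ x in a..b, GHS.dt f x t) t := by
  have hh : ContDiffOn ℝ 1 (fun q : ℝ × ℝ => f q.2 q.1) (I ×ˢ univ) :=
    ContDiffOn.comp (t := univ ×ˢ I) hf (contDiff_snd.prodMk contDiff_fst).contDiffOn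
      (fun q hq => ⟨mem_univ _, hq.1⟩)
  have hc : ContinuousOn (fun q : ℝ × ℝ => (fderiv ℝ (fun q : ℝ × ℝ => f q.2 q.1) q).comp
      (ContinuousLinearMap.inl ℝ ℝ ℝ)) (I ×ˢ univ) :=
    (hh.continuousOn_fderiv_of_isOpen (hI.prod isOpen_univ) (by simp)).clm_comp continuousOn_const
  have h1 := (hasFDerivAt_parametric_integral hI hh a b ht).hasDerivAt
  refine h1.congr_deriv ?_
  symm
  rw [ContinuousLinearMap.intervalIntegral_apply]
  · refine intervalIntegral.integral_congr fun x _ => ?_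
    have h2 := ((hh.contDiffAt ((hI.prod isOpen_univ).mem_nhds
      (x := (t, x)) ⟨ht, mem_univ _⟩)).differentiableAt (by simp)).hasFDerivAt
    exact (h2.comp_hasDerivAt t ((hasDerivAt_id t).prodMk (hasDerivAt_const t x))).deriv
  · exact (hc.comp_continuous (f := fun s : ℝ => (t, s)) (by fun_prop)
      (fun s => ⟨ht, mem_univ _⟩)).intervalIntegrable _ _

theorem SmoothOn.hasDerivAt_integral (hI : IsOpen I) (hf : SmoothOn I f) (a b : ℝ) (ht : t ∈ I) :
    HasDerivAt (fun t => ∫ x in a..b, f x t) (∫ x in a..b, GHS.dt f x t) t :=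
  hasDerivAt_integral_of_contDiffOn hI (ContDiffOn.of_le hf (by simp)) a b ht

theorem SmoothOn.primitive (hI : IsOpen I) (hf : SmoothOn I f) :
    SmoothOn I (fun x t => ∫ y in (0 : ℝ)..x, f y t) := by
  -- The substitution `y = x s` moves the variable endpoint into the integrand, so that the result
  -- for fixed endpoints applies.
  have h1 : ContDiffOn ℝ ∞ (fun q : ℝ × ℝ => ∫ s in (0 : ℝ)..1, f (q.1 * s) q.2) (univ ×ˢ I) := by
    refine contDiffOn_infty.2 fun n => contDiffOn_parametric_integral (isOpen_univ.prod hI) 0 1 n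
      (h := fun q : (ℝ × ℝ) × ℝ => f (q.1.1 * q.2) q.1.2) ?_
    exact ContDiffOn.comp (t := univ ×ˢ I) hf
      (f := fun q : (ℝ × ℝ) × ℝ => (q.1.1 * q.2, q.1.2)) (by fun_prop)
      (fun q hq => ⟨mem_univ _, hq.1.2⟩)
  refine (contDiff_fst.contDiffOn.mul h1).congr fun q _ => ?_
  have := intervalIntegral.mul_integral_comp_mul_left (f := fun y => f y q.2) (a := 0) (b := 1) q.1
  simpa using this.symm

end SmoothOn

/-! ### Smooth inverses -/

/-- Near each image point the local inverse of the inverse function theorem takes values in `Ω`, so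
injectivity forces the chosen global inverse to coincide with it. -/
theorem contDiffOn_invFunOn {E F : Type*} [NormedAddCommGroup E] [NormedSpace ℝ E]
    [CompleteSpace E] [NormedAddCommGroup F] [NormedSpace ℝ F]
    {Ω : Set E} (hΩ : IsOpen Ω) {h : E → F} (hh : ContDiffOn ℝ ∞ h Ω) (hinj : InjOn h Ω)
    (hd : ∀ p ∈ Ω, ∃ h' : E ≃L[ℝ] F, HasFDerivAt h (h' : E →L[ℝ] F) p) :
    IsOpen (h '' Ω) ∧ ContDiffOn ℝ ∞ (Function.invFunOn h Ω) (h '' Ω) := by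
  have key : ∀ p ∈ Ω, h '' Ω ∈ 𝓝 (h p) ∧ ContDiffAt ℝ ∞ (Function.invFunOn h Ω) (h p) := by
    intro p hp
    obtain ⟨h', hh'⟩ := hd p hp
    have hc : ContDiffAt ℝ ∞ h p := hh.contDiffAt (hΩ.mem_nhds hp)
    have hs := hc.hasStrictFDerivAt' hh' (by simp)
    have him : h '' Ω ∈ 𝓝 (h p) := by
      rw [← hs.map_nhds_eq_of_equiv]
      exact image_mem_map (hΩ.mem_nhds hp)
    refine ⟨him, ?_⟩
    have hl := hc.to_localInverse hh' (by simp)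
    refine hl.congr_of_eventuallyEq ?_
    have e1 : ∀ᶠ y in 𝓝 (h p), h (hc.localInverse hh' (by simp) y) = y :=
      hs.eventually_right_inverse
    have e2 : ∀ᶠ y in 𝓝 (h p), hc.localInverse hh' (by simp) y ∈ Ω := by
      refine hl.continuousAt.eventually_mem ?_
      rw [hc.localInverse_apply_image hh' (by simp)]
      exact hΩ.mem_nhds hp
    filter_upwards [e1, e2, him] with y hy1 hy2 hy3
    exact hinj (Function.invFunOn_mem hy3) hy2 ((Function.invFunOn_eq hy3).trans hy1.symm)
  constructor
  · rw [isOpen_iff_mem_nhds]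
    rintro _ ⟨p, hp, rfl⟩
    exact (key p hp).1
  · rintro _ ⟨p, hp, rfl⟩
    exact (key p hp).2.contDiffWithinAt


/-! ### Uniqueness up to a translation -/

theorem periodic_deriv {f : ℝ → ℝ} {T : ℝ} (hf : Function.Periodic f T) :
    Function.Periodic (deriv f) T := by
  intro x
  rw [← deriv_comp_add_const]
  congr 1
  exact funext hf

theorem sq_integral_abs_le {w : ℝ → ℝ} (hw : Continuous w) :
    (∫ x in (0 : ℝ)..1, |w x|) ^ 2 ≤ ∫ x in (0 : ℝ)..1, w x ^ 2 := by
  set n := ∫ x in (0 : ℝ)..1, |w x| with hn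
  have h0 : 0 ≤ ∫ x in (0 : ℝ)..1, (|w x| - n) ^ 2 :=
    intervalIntegral.integral_nonneg zero_le_one fun x _ => sq_nonneg _
  have h1 : ∫ x in (0 : ℝ)..1, (|w x| - n) ^ 2 =
      (∫ x in (0 : ℝ)..1, w x ^ 2) - (2 * n * ∫ x in (0 : ℝ)..1, |w x|) + n ^ 2 := by
    have e : ∀ x, (|w x| - n) ^ 2 = w x ^ 2 - 2 * n * |w x| + n ^ 2 := fun x => by
      rw [← sq_abs (w x)]; ring
    simp_rw [e]
    rw [intervalIntegral.integral_add, intervalIntegral.integral_sub,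
      intervalIntegral.integral_const_mul]
    · simp
    all_goals exact Continuous.intervalIntegrable (by fun_prop) _ _
  rw [h1, ← hn] at h0
  nlinarith

/-- The differential inequality behind uniqueness, at one fixed time; `w'` and `z'` stand for the
time derivatives of `w = v_x - u_x` and `z = σ - ρ`. Three facts close it: the transport terms by
`v` integrate by parts over a period; the unknown constant `Iv - Iu` is multiplied by `∫ w = 0`; and
`v - u`, which vanishes at the origin, is controlled by `∫ |w|`. -/
theorem energy_inequality {lam kap M Iu Iv : ℝ} {u v ρ σ w' z' : ℝ → ℝ}
    (hu : ContDiff ℝ ∞ u) (hv : ContDiff ℝ ∞ v) (hρ : ContDiff ℝ ∞ ρ) (hσ : ContDiff ℝ ∞ σ)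
    (pu : Function.Periodic u 1) (pv : Function.Periodic v 1) (pρ : Function.Periodic ρ 1)
    (pσ : Function.Periodic σ 1) (h0 : v 0 = u 0)
    (bu : ∀ x, |deriv u x| ≤ M) (bv : ∀ x, |deriv v x| ≤ M) (buu : ∀ x, |deriv (deriv u) x| ≤ M)
    (bρ : ∀ x, |ρ x| ≤ M) (bσ : ∀ x, |σ x| ≤ M) (bρx : ∀ x, |deriv ρ x| ≤ M)
    (hw' : ∀ x, w' x = (-v x * deriv (deriv v) x + lam * deriv v x ^ 2 + kap * σ x ^ 2 + Iv)
      - (-u x * deriv (deriv u) x + lam * deriv u x ^ 2 + kap * ρ x ^ 2 + Iu))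
    (hz' : ∀ x, z' x = (-v x * deriv σ x + 2 * lam * σ x * deriv v x)
      - (-u x * deriv ρ x + 2 * lam * ρ x * deriv u x)) :
    ∫ x in (0 : ℝ)..1, (2 * (deriv v x - deriv u x) * w' x + 2 * (σ x - ρ x) * z' x)
      ≤ M * (4 + 2 * |kap| + 6 * |lam|) *
        ∫ x in (0 : ℝ)..1, ((deriv v x - deriv u x) ^ 2 + (σ x - ρ x) ^ 2) := by
  have hM : 0 ≤ M := (abs_nonneg _).trans (bu 0)
  have smooth_deriv : ∀ {f : ℝ → ℝ}, ContDiff ℝ ∞ f → ContDiff ℝ ∞ (deriv f) := fun hf =>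
    (contDiff_infty_iff_deriv.1 hf).2
  have hd : ∀ {f : ℝ → ℝ}, ContDiff ℝ ∞ f → ∀ x, HasDerivAt f (deriv f x) x := fun hf x =>
    (hf.differentiable (by simp) x).hasDerivAt
  set w : ℝ → ℝ := fun x => deriv v x - deriv u x with hw
  set z : ℝ → ℝ := fun x => σ x - ρ x with hz
  have sw : ContDiff ℝ ∞ w := (smooth_deriv hv).sub (smooth_deriv hu)
  have sz : ContDiff ℝ ∞ z := hσ.sub hρ
  have cw := sw.continuous
  have cz := sz.continuous
  have cu := hu.continuous
  have cv := hv.continuous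
  have cρ := hρ.continuous
  have cσ := hσ.continuous
  have cu1 := (smooth_deriv hu).continuous
  have cv1 := (smooth_deriv hv).continuous
  have cρ1 := (smooth_deriv hρ).continuous
  have cσ1 := (smooth_deriv hσ).continuous
  have cu2 := (smooth_deriv (smooth_deriv hu)).continuous
  have cv2 := (smooth_deriv (smooth_deriv hv)).continuous
  have cw' : Continuous w' := by rw [funext hw']; fun_prop
  have cz' : Continuous z' := by rw [funext hz']; fun_prop
  set n := ∫ x in (0 : ℝ)..1, |w x| with hn
  have hn2 : n ^ 2 ≤ ∫ x in (0 : ℝ)..1, (w x ^ 2 + z x ^ 2) := by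
    refine (sq_integral_abs_le cw).trans ?_
    refine intervalIntegral.integral_mono_on zero_le_one ?_ ?_ fun x _ => by nlinarith [sq_nonneg (z x)]
    all_goals exact Continuous.intervalIntegrable (by fun_prop) _ _
  have hvu : ∀ x ∈ Icc (0 : ℝ) 1, |v x - u x| ≤ n := by
    intro x hx
    have e : v x - u x = ∫ y in (0 : ℝ)..x, w y := by
      have := intervalIntegral.integral_eq_sub_of_hasDerivAt (a := 0) (b := x)
        (f := fun y => v y - u y) (f' := w) (fun y _ => (hd hv y).sub (hd hu y))
        (cw.intervalIntegrable _ _)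
      rw [this]; simp [h0]
    rw [e]
    refine (intervalIntegral.abs_integral_le_integral_abs hx.1).trans ?_
    exact intervalIntegral.integral_mono_interval le_rfl hx.1 hx.2
      (Eventually.of_forall fun y => abs_nonneg _) (cw.abs.intervalIntegrable _ _)
  have hint : ∫ x in (0 : ℝ)..1, w x = 0 := by
    have := intervalIntegral.integral_eq_sub_of_hasDerivAt (a := 0) (b := 1)
        (f := fun y => v y - u y) (f' := w) (fun y _ => (hd hv y).sub (hd hu y))
        (cw.intervalIntegrable _ _)
    rw [this]
    have e1 := pu 0
    have e2 := pv 0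
    rw [zero_add] at e1 e2
    rw [e1, e2]; ring
  have hflux : ∫ x in (0 : ℝ)..1, (deriv v x * (w x ^ 2 + z x ^ 2)
      + v x * (2 * w x * deriv w x + 2 * z x * deriv z x)) = 0 := by
    have cw1 := (smooth_deriv sw).continuous
    have cz1 := (smooth_deriv sz).continuous
    have := intervalIntegral.integral_eq_sub_of_hasDerivAt (a := 0) (b := 1)
        (f := fun y => v y * (w y ^ 2 + z y ^ 2)) (f' := fun x => deriv v x * (w x ^ 2 + z x ^ 2)
      + v x * (2 * w x * deriv w x + 2 * z x * deriv z x))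
        (fun y _ => ((hd hv y).mul (((hd sw y).pow 2).add ((hd sz y).pow 2))).congr_deriv (by
          simp))
        (Continuous.intervalIntegrable (by fun_prop) _ _)
    rw [this]
    have e2 := pv 0
    have e3 := periodic_deriv pu 0
    have e4 := periodic_deriv pv 0
    have e5 := pρ 0
    have e6 := pσ 0
    rw [zero_add] at e2 e3 e4 e5 e6
    simp only [hw, hz, e2, e3, e4, e5, e6]; ring
  have dw : ∀ x, deriv w x = deriv (deriv v) x - deriv (deriv u) x := fun x =>
    ((hd (smooth_deriv hv) x).sub (hd (smooth_deriv hu) x)).deriv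
  have dz : ∀ x, deriv z x = deriv σ x - deriv ρ x := fun x => ((hd hσ x).sub (hd hρ x)).deriv
  have cw1 := (smooth_deriv sw).continuous
  have cz1 := (smooth_deriv sz).continuous
  have key : ∫ x in (0 : ℝ)..1, (2 * w x * w' x + 2 * z x * z' x) =
      ∫ x in (0 : ℝ)..1, (deriv v x * (w x ^ 2 + z x ^ 2)
        - 2 * w x * (v x - u x) * deriv (deriv u) x + 2 * lam * (deriv v x + deriv u x) * w x ^ 2
        + 2 * kap * (σ x + ρ x) * z x * w x - 2 * z x * (v x - u x) * deriv ρ x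
        + 4 * lam * (z x ^ 2 * deriv v x + ρ x * w x * z x)) := by
    have e : ∀ x, 2 * w x * w' x + 2 * z x * z' x =
      (deriv v x * (w x ^ 2 + z x ^ 2)
        - 2 * w x * (v x - u x) * deriv (deriv u) x + 2 * lam * (deriv v x + deriv u x) * w x ^ 2
        + 2 * kap * (σ x + ρ x) * z x * w x - 2 * z x * (v x - u x) * deriv ρ x
        + 4 * lam * (z x ^ 2 * deriv v x + ρ x * w x * z x))
      + (2 * (Iv - Iu)) * w x - (deriv v x * (w x ^ 2 + z x ^ 2)
      + v x * (2 * w x * deriv w x + 2 * z x * deriv z x)) := by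
      intro x
      rw [hw', hz', dw, dz]
      simp only [hw, hz]
      ring
    rw [intervalIntegral.integral_congr fun x _ => e x, intervalIntegral.integral_sub,
      intervalIntegral.integral_add, hflux, intervalIntegral.integral_const_mul, hint]
    · simp
    all_goals exact Continuous.intervalIntegrable (by fun_prop) _ _
  rw [key]
  -- The two terms with the factor `v - u` cost `M (w² + n²)` and `M (z² + n²)` by Young's
  -- inequality; this is the source of `2 M n²`, absorbed at the end through `n² ≤ ∫ (w² + z²)`.
  have bound : ∫ x in (0 : ℝ)..1, (deriv v x * (w x ^ 2 + z x ^ 2)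
        - 2 * w x * (v x - u x) * deriv (deriv u) x + 2 * lam * (deriv v x + deriv u x) * w x ^ 2
        + 2 * kap * (σ x + ρ x) * z x * w x - 2 * z x * (v x - u x) * deriv ρ x
        + 4 * lam * (z x ^ 2 * deriv v x + ρ x * w x * z x)) ≤
      ∫ x in (0 : ℝ)..1, (M * (2 + 2 * |kap| + 6 * |lam|) * (w x ^ 2 + z x ^ 2)
        + 2 * M * n ^ 2) := by
    refine intervalIntegral.integral_mono_on zero_le_one
      (Continuous.intervalIntegrable (by fun_prop) _ _)
      (Continuous.intervalIntegrable (by fun_prop) _ _) fun x hx => ?_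
    have hn0 : 0 ≤ n := (abs_nonneg _).trans (hvu x hx)
    have mulb : ∀ {a b A B : ℝ}, |a| ≤ A → |b| ≤ B → |a * b| ≤ A * B := fun ha hb => by
      rw [abs_mul]; exact mul_le_mul ha hb (abs_nonneg _) ((abs_nonneg _).trans ha)
    have t1 := mulb (bv x) (le_refl |w x ^ 2 + z x ^ 2|)
    have t2 := mulb (mulb (le_refl |w x|) (hvu x hx)) (buu x)
    have t3 := mulb (mulb (le_refl |lam|) ((abs_add_le _ _).trans (add_le_add (bv x) (bu x))))
      (le_refl |w x ^ 2|)
    have t4 := mulb (mulb (le_refl |kap|) ((abs_add_le _ _).trans (add_le_add (bσ x) (bρ x))))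
      (le_refl |z x * w x|)
    have t5 := mulb (mulb (le_refl |z x|) (hvu x hx)) (bρx x)
    have t6 := mulb (le_refl |lam|) (mulb (bv x) (le_refl |z x ^ 2|))
    have t7 := mulb (le_refl |lam|) (mulb (bρ x) (le_refl |w x * z x|))
    have hq : |w x ^ 2 + z x ^ 2| = w x ^ 2 + z x ^ 2 := abs_of_nonneg (by positivity)
    have ew : |w x ^ 2| = w x ^ 2 := abs_of_nonneg (by positivity)
    have ez : |z x ^ 2| = z x ^ 2 := abs_of_nonneg (by positivity)
    have h2 : 2 * |w x * z x| ≤ w x ^ 2 + z x ^ 2 := by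
      rw [abs_mul, ← sq_abs (w x), ← sq_abs (z x)]; nlinarith [sq_nonneg (|w x| - |z x|)]
    have h3 : 2 * (|w x| * n) ≤ w x ^ 2 + n ^ 2 := by
      rw [← sq_abs (w x)]; nlinarith [sq_nonneg (|w x| - n)]
    have h4 : 2 * (|z x| * n) ≤ z x ^ 2 + n ^ 2 := by
      rw [← sq_abs (z x)]; nlinarith [sq_nonneg (|z x| - n)]
    have h5 : |z x * w x| = |w x * z x| := by rw [mul_comm]
    rw [hq] at t1
    rw [ew] at t3
    rw [h5] at t4
    rw [ez] at t6
    have k3 := mul_le_mul_of_nonneg_left h3 hM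
    have k4 := mul_le_mul_of_nonneg_left h4 hM
    have k5 := mul_le_mul_of_nonneg_left h2 (mul_nonneg hM (abs_nonneg kap))
    have k6 := mul_le_mul_of_nonneg_left h2 (mul_nonneg hM (abs_nonneg lam))
    have := le_abs_self (deriv v x * (w x ^ 2 + z x ^ 2))
    have := neg_abs_le (w x * (v x - u x) * deriv (deriv u) x)
    have := le_abs_self (lam * (deriv v x + deriv u x) * w x ^ 2)
    have := le_abs_self (kap * (σ x + ρ x) * (z x * w x))
    have := neg_abs_le (z x * (v x - u x) * deriv ρ x)
    have := le_abs_self (lam * (deriv v x * z x ^ 2))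
    have := le_abs_self (lam * (ρ x * (w x * z x)))
    linarith
  refine bound.trans ?_
  rw [intervalIntegral.integral_add, intervalIntegral.integral_const_mul]
  · simp only [intervalIntegral.integral_const, sub_zero, one_smul]
    nlinarith [mul_le_mul_of_nonneg_left hn2 hM]
  all_goals exact Continuous.intervalIntegrable (by fun_prop) _ _


theorem uniqueDiffOn_Ico_zero (T : ℝ) : UniqueDiffOn ℝ (Ico 0 T) := uniqueDiffOn_Ico 0 T

theorem SmoothOn.exists_bound {T T' : ℝ} {f : ℝ → ℝ → ℝ} (hf : SmoothOn (Ico 0 T) f)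
    (hp : ∀ t ∈ Ico 0 T, Function.Periodic (fun x => f x t) 1) (hT : T' < T) :
    ∃ M, 0 ≤ M ∧ ∀ t ∈ Icc 0 T', ∀ x, |f x t| ≤ M := by
  obtain ⟨M, hM⟩ := ((isCompact_Icc (a := (0 : ℝ)) (b := 1)).prod
    (isCompact_Icc (a := (0 : ℝ)) (b := T'))).exists_bound_of_continuousOn
    (hf.continuousOn.mono (prod_mono (subset_univ _)
      (fun t ht => ⟨ht.1, ht.2.trans_lt hT⟩ : Icc 0 T' ⊆ Ico 0 T)))
  refine ⟨max M 0, le_max_right _ _, fun t ht x => ?_⟩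
  have e : f (Int.fract x) t = f x t := by
    have h := (hp t ⟨ht.1, ht.2.trans_lt hT⟩).sub_zsmul_eq (x := x) ⌊x⌋
    simp only [zsmul_eq_mul, mul_one] at h
    exact h
  rw [← e]
  exact (hM (Int.fract x, t) ⟨⟨Int.fract_nonneg x, (Int.fract_lt_one x).le⟩, ht⟩).trans
    (le_max_left _ _)

/-- The characteristic of `v - u (0, ·)` starting at the origin. -/
theorem exists_shift {T T' : ℝ} {u v : ℝ → ℝ → ℝ} (hu : SmoothOn (Ico 0 T) u)
    (hv : SmoothOn (Ico 0 T) v)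
    (pv : ∀ t ∈ Ico 0 T, Function.Periodic (fun x => v x t) 1) (hT0 : 0 ≤ T') (hT : T' < T) :
    ∃ s : ℝ → ℝ, s 0 = 0 ∧ ∀ t ∈ Icc 0 T',
      HasDerivWithinAt s (v (s t) t - u 0 t) (Icc 0 T') t := by
  have hsub : Icc 0 T' ⊆ Ico 0 T := fun t ht => ⟨ht.1, ht.2.trans_lt hT⟩
  obtain ⟨M, hM0, hM⟩ := hv.exists_bound pv hT
  obtain ⟨K, hK0, hK⟩ := (hv.dx (uniqueDiffOn_Ico_zero T)).exists_bound
    (fun t ht => periodic_deriv (pv t ht)) hT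
  obtain ⟨N, hN⟩ := (isCompact_Icc (a := (0 : ℝ)) (b := T')).exists_bound_of_continuousOn
    (f := fun t => u 0 t) (hu.continuousOn.comp (f := fun t => ((0 : ℝ), t)) (by fun_prop)
      (fun t ht => ⟨mem_univ _, hsub ht⟩))
  have hN0 : 0 ≤ N := (norm_nonneg _).trans (hN 0 ⟨le_rfl, hT0⟩)
  -- By periodicity the field is bounded by `M + N` and Lipschitz on the whole line, so no curve
  -- leaves the ball of radius `(M + N) T'` before `T'` and existence is global on `[0, T']`.
  have hP : IsPicardLindelof (fun t y => v y t - u 0 t) (⟨0, le_rfl, hT0⟩ : Icc 0 T') (0 : ℝ)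
      (Real.toNNReal ((M + N) * T')) 0 (Real.toNNReal (M + N)) (Real.toNNReal K) := by
    refine ⟨fun t ht => ?_, fun x _ => ?_, fun t ht x _ => ?_, ?_⟩
    · refine LipschitzWith.lipschitzOnWith ?_
      have hd : ∀ x, HasDerivAt (fun y => v y t - u 0 t) (dx v x t) x := fun x =>
        (hv.hasDerivAt_dx (hsub ht)).sub_const _
      refine lipschitzWith_of_nnnorm_deriv_le (fun x => (hd x).differentiableAt) fun x => ?_
      rw [(hd x).deriv, ← NNReal.coe_le_coe, Real.coe_toNNReal _ hK0]
      exact hK t ht x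
    · refine ContinuousOn.sub ?_ ?_
      · exact hv.continuousOn.comp (f := fun t => (x, t)) (by fun_prop)
          (fun t ht => ⟨mem_univ _, hsub ht⟩)
      · exact hu.continuousOn.comp (f := fun t => ((0 : ℝ), t)) (by fun_prop)
          (fun t ht => ⟨mem_univ _, hsub ht⟩)
    · rw [Real.coe_toNNReal _ (by positivity)]
      exact (norm_sub_le _ _).trans (add_le_add (hM t ht x) (hN t ht))
    · simp [Real.coe_toNNReal _ (show 0 ≤ (M + N) * T' by positivity),
        Real.coe_toNNReal _ (show 0 ≤ M + N by positivity), hT0]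
  obtain ⟨s, hs0, hs⟩ := hP.exists_eq_forall_mem_Icc_hasDerivWithinAt₀
  exact ⟨s, hs0, hs⟩

/-- In the frame moving with `s' = v(s, t) - u(0, t)` the second velocity becomes `v(x + s, t) -
s'`, which agrees with `u` at the origin. The energy of the difference then obeys a Gronwall
inequality and starts from zero. -/
theorem IsSmoothSolution.eq_translate {lam kap T : ℝ} {u₀ ρ₀ : ℝ → ℝ} {u ρ v σ : ℝ → ℝ → ℝ}
    (h1 : IsSmoothSolution lam kap u₀ ρ₀ T u ρ) (h2 : IsSmoothSolution lam kap u₀ ρ₀ T v σ)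
    {t : ℝ} (ht : t ∈ Ico 0 T) :
    ∃ a, (∀ x, dx v (x + a) t = dx u x t) ∧ ∀ x, σ (x + a) t = ρ x t := by
  obtain ⟨T', htT', hT'⟩ := exists_between ht.2
  have hT0 : 0 ≤ T' := ht.1.trans htT'.le
  have hsub : Icc 0 T' ⊆ Ico 0 T := fun t ht => ⟨ht.1, ht.2.trans_lt hT'⟩
  have hsubo : Ioo 0 T' ⊆ Ioo 0 T := Ioo_subset_Ioo le_rfl hT'.le
  have hI := uniqueDiffOn_Ico_zero T
  have su : SmoothOn (Ico 0 T) u := h1.smooth_u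
  have sρ : SmoothOn (Ico 0 T) ρ := h1.smooth_ρ
  have sv : SmoothOn (Ico 0 T) v := h2.smooth_u
  have sσ : SmoothOn (Ico 0 T) σ := h2.smooth_ρ
  obtain ⟨s, hs0, hs⟩ := exists_shift su sv h2.periodic_u hT0 hT'
  have hsd : ∀ t ∈ Ioo 0 T', HasDerivAt s (v (s t) t - u 0 t) t := fun t ht =>
    (hs t (Ioo_subset_Icc_self ht)).hasDerivAt (Icc_mem_nhds ht.1 ht.2)
  have hsc : ContinuousOn s (Icc 0 T') := fun t ht => (hs t ht).continuousWithinAt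
  obtain ⟨M1, -, b1⟩ := (su.dx hI).exists_bound (fun t ht => periodic_deriv (h1.periodic_u t ht)) hT'
  obtain ⟨M2, -, b2⟩ := (sv.dx hI).exists_bound (fun t ht => periodic_deriv (h2.periodic_u t ht)) hT'
  obtain ⟨M3, -, b3⟩ := ((su.dx hI).dx hI).exists_bound
    (fun t ht => periodic_deriv (periodic_deriv (h1.periodic_u t ht))) hT'
  obtain ⟨M4, -, b4⟩ := sρ.exists_bound h1.periodic_ρ hT'
  obtain ⟨M5, -, b5⟩ := sσ.exists_bound h2.periodic_ρ hT'
  obtain ⟨M6, -, b6⟩ := (sρ.dx hI).exists_bound (fun t ht => periodic_deriv (h1.periodic_ρ t ht)) hT'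
  set M := |M1| + |M2| + |M3| + |M4| + |M5| + |M6| with hM
  have a1 := abs_nonneg M1; have a2 := abs_nonneg M2; have a3 := abs_nonneg M3
  have a4 := abs_nonneg M4; have a5 := abs_nonneg M5; have a6 := abs_nonneg M6
  set K := M * (4 + 2 * |kap| + 6 * |lam|) with hK
  -- the difference and its energy
  set w : ℝ → ℝ → ℝ := fun x t => dx v (x + s t) t - dx u x t with hw
  set z : ℝ → ℝ → ℝ := fun x t => σ (x + s t) t - ρ x t with hz
  set q : ℝ → ℝ → ℝ := fun x t => w x t ^ 2 + z x t ^ 2 with hq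
  have hqc : ContinuousOn (fun p : ℝ × ℝ => q p.1 p.2) (univ ×ˢ Icc 0 T') := by
    have hm : MapsTo (fun p : ℝ × ℝ => (p.1 + s p.2, p.2)) (univ ×ˢ Icc 0 T') (univ ×ˢ Ico 0 T) :=
      fun p hp => ⟨mem_univ _, hsub hp.2⟩
    have hc : ContinuousOn (fun p : ℝ × ℝ => (p.1 + s p.2, p.2)) (univ ×ˢ Icc 0 T') :=
      (continuousOn_fst.add (hsc.comp continuousOn_snd fun p hp => hp.2)).prodMk continuousOn_snd
    have e1 := (sv.dx hI).continuousOn.comp hc hm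
    have e2 := sσ.continuousOn.comp hc hm
    have e3 := (su.dx hI).continuousOn.mono (prod_mono (subset_univ univ) hsub)
    have e4 := sρ.continuousOn.mono (prod_mono (subset_univ univ) hsub)
    exact ((e1.sub e3).pow 2).add ((e2.sub e4).pow 2)
  set En : ℝ → ℝ := fun t => ∫ x in (0 : ℝ)..1, q x t with hEn
  have hEc : ContinuousOn En (Icc 0 T') := by
    intro τ hτ
    obtain ⟨C, hC⟩ := ((isCompact_uIcc (a := (0 : ℝ)) (b := 1)).prod
      (isCompact_Icc (a := (0 : ℝ)) (b := T'))).exists_bound_of_continuousOn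
      (hqc.mono (prod_mono (subset_univ _) subset_rfl))
    refine intervalIntegral.continuousWithinAt_of_dominated_interval (bound := fun _ => C) ?_ ?_
      intervalIntegrable_const ?_
    · filter_upwards [self_mem_nhdsWithin] with r hr
      exact (hqc.comp_continuous (f := fun x => (x, r)) (by fun_prop)
        (fun x => ⟨mem_univ _, hr⟩)).aestronglyMeasurable
    · filter_upwards [self_mem_nhdsWithin] with r hr
      exact Eventually.of_forall fun x hx => hC (x, r) ⟨uIoc_subset_uIcc hx, hr⟩
    · refine Eventually.of_forall fun x _ => ?_
      exact (hqc (x, τ) ⟨mem_univ _, hτ⟩).comp (f := fun r => (x, r))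
        (by fun_prop) (fun r hr => ⟨mem_univ _, hr⟩)
  -- One continuous derivative of the shift is enough to differentiate the energy under the
  -- integral.
  have hsC1 : ContDiffOn ℝ 1 s (Ioo 0 T') := by
    have hder : ContinuousOn (deriv s) (Ioo 0 T') := by
      refine ContinuousOn.congr (f := fun t => v (s t) t - u 0 t) ?_ fun t ht => (hsd t ht).deriv
      refine ContinuousOn.sub ?_ ?_
      · exact sv.continuousOn.comp (f := fun t => (s t, t))
          ((hsc.mono Ioo_subset_Icc_self).prodMk continuousOn_id)
          (fun t ht => ⟨mem_univ _, hsub (Ioo_subset_Icc_self ht)⟩)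
      · exact su.continuousOn.comp (f := fun t => ((0 : ℝ), t)) (by fun_prop)
          (fun t ht => ⟨mem_univ _, hsub (Ioo_subset_Icc_self ht)⟩)
    have := (contDiffOn_succ_iff_deriv_of_isOpen (n := 0) (𝕜 := ℝ) (f := s)
      (isOpen_Ioo (a := (0 : ℝ)) (b := T'))).2
      ⟨fun t ht => (hsd t ht).differentiableAt.differentiableWithinAt, by simp,
        contDiffOn_zero.2 hder⟩
    simpa using this
  have hqC1 : ContDiffOn ℝ 1 (fun p : ℝ × ℝ => q p.1 p.2) (univ ×ˢ Ioo 0 T') := by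
    have hsubI : Ioo 0 T' ⊆ Ico 0 T := Ioo_subset_Icc_self.trans hsub
    have hm : MapsTo (fun p : ℝ × ℝ => (p.1 + s p.2, p.2)) (univ ×ˢ Ioo 0 T') (univ ×ˢ Ico 0 T) :=
      fun p hp => ⟨mem_univ _, hsubI hp.2⟩
    have hc : ContDiffOn ℝ 1 (fun p : ℝ × ℝ => (p.1 + s p.2, p.2)) (univ ×ˢ Ioo 0 T') :=
      (contDiffOn_fst.add (hsC1.comp contDiffOn_snd fun p hp => hp.2)).prodMk contDiffOn_snd
    have e1 := (ContDiffOn.of_le (sv.dx hI) (m := 1) (by simp)).comp hc hm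
    have e2 := (ContDiffOn.of_le sσ (m := 1) (by simp)).comp hc hm
    have e3 := (ContDiffOn.of_le (su.dx hI) (m := 1) (by simp)).mono
      (prod_mono (subset_univ univ) hsubI)
    have e4 := (ContDiffOn.of_le sρ (m := 1) (by simp)).mono (prod_mono (subset_univ univ) hsubI)
    exact ((e1.sub e3).pow 2).add ((e2.sub e4).pow 2)
  have hEd : ∀ τ ∈ Ioo 0 T', ∃ E', HasDerivAt En E' τ ∧ E' ≤ K * En τ := by
    intro τ hτ
    refine ⟨_, hasDerivAt_integral_of_contDiffOn isOpen_Ioo hqC1 0 1 hτ, ?_⟩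
    have hτo := hsubo hτ
    have hτc : τ ∈ Icc 0 T' := Ioo_subset_Icc_self hτ
    have hτI := hsub hτc
    have hn : Ico 0 T ∈ 𝓝 τ := Ico_mem_nhds hτo.1 hτo.2
    set w' : ℝ → ℝ := fun x => (dx (dx v) (x + s τ) τ * (v (s τ) τ - u 0 τ) + dt (dx v) (x + s τ) τ)
      - dt (dx u) x τ with hw'
    set z' : ℝ → ℝ := fun x => (dx σ (x + s τ) τ * (v (s τ) τ - u 0 τ) + dt σ (x + s τ) τ)
      - dt ρ x τ with hz'
    have edt : ∀ x, dt q x τ = 2 * w x τ * w' x + 2 * z x τ * z' x := by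
      intro x
      have hc : HasDerivAt (fun r => x + s r) (v (s τ) τ - u 0 τ) τ := (hsd τ hτ).const_add x
      have dw : HasDerivAt (fun r => w x r) (w' x) τ :=
        ((sv.dx hI).hasDerivAt_curve hn hc).sub ((su.dx hI).hasDerivAt_dt hn)
      have dz : HasDerivAt (fun r => z x r) (z' x) τ :=
        (sσ.hasDerivAt_curve hn hc).sub (sρ.hasDerivAt_dt hn)
      exact (((dw.pow 2).add (dz.pow 2)).congr_deriv (by simp)).deriv
    simp_rw [edt]
    have cs : ∀ {f : ℝ → ℝ → ℝ}, SmoothOn (Ico 0 T) f → ContDiff ℝ ∞ (fun x => f (x + s τ) τ) :=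
      fun hf => (hf.contDiff_slice hτI).comp (contDiff_id.add contDiff_const)
    have ds1 : deriv (fun x => v (x + s τ) τ - (v (s τ) τ - u 0 τ)) =
        fun x => dx v (x + s τ) τ := by
      funext x
      rw [deriv_sub_const, deriv_comp_add_const (fun y => v y τ)]; rfl
    have ds2 : deriv (fun x => dx v (x + s τ) τ) = fun x => dx (dx v) (x + s τ) τ := by
      funext x
      rw [deriv_comp_add_const (fun y => dx v y τ)]; rfl
    have ds3 : deriv (fun x => σ (x + s τ) τ) = fun x => dx σ (x + s τ) τ := by
      funext x
      rw [deriv_comp_add_const (fun y => σ y τ)]; rfl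
    have hE := energy_inequality (lam := lam) (kap := kap) (M := M)
      (Iu := nonlocal lam kap u ρ τ) (Iv := nonlocal lam kap v σ τ)
      (u := fun x => u x τ) (v := fun x => v (x + s τ) τ - (v (s τ) τ - u 0 τ))
      (ρ := fun x => ρ x τ) (σ := fun x => σ (x + s τ) τ) (w' := w') (z' := z')
      (su.contDiff_slice hτI) ((cs sv).sub contDiff_const) (sρ.contDiff_slice hτI) (cs sσ)
      (h1.periodic_u τ hτI)
      (fun x => by
        have := h2.periodic_u τ hτI (x + s τ)
        simp only at this ⊢
        rw [← this]; ring_nf)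
      (h1.periodic_ρ τ hτI)
      (fun x => by
        have := h2.periodic_ρ τ hτI (x + s τ)
        simp only at this ⊢
        rw [← this]; ring_nf)
      (by simp)
      (fun x => (b1 τ hτc x).trans (by linarith [le_abs_self M1]))
      (fun x => by rw [ds1]; exact (b2 τ hτc _).trans (by linarith [le_abs_self M2]))
      (fun x => (b3 τ hτc x).trans (by linarith [le_abs_self M3]))
      (fun x => (b4 τ hτc x).trans (by linarith [le_abs_self M4]))
      (fun x => (b5 τ hτc _).trans (by linarith [le_abs_self M5]))
      (fun x => (b6 τ hτc x).trans (by linarith [le_abs_self M6]))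
      (fun x => by
        rw [ds1, ds2]
        have e1 := h1.eq_u τ hτo x
        have e2 := h2.eq_u τ hτo (x + s τ)
        change _ = _ - (-u x τ * dx (dx u) x τ + lam * dx u x τ ^ 2 + kap * ρ x τ ^ 2 + _)
        simp only [hw']
        linear_combination e2 - e1)
      (fun x => by
        rw [ds1, ds3]
        have e1 := h1.eq_ρ τ hτo x
        have e2 := h2.eq_ρ τ hτo (x + s τ)
        change _ = _ - (-u x τ * dx ρ x τ + 2 * lam * ρ x τ * dx u x τ)
        simp only [hz']
        linear_combination e2 - e1)
    rw [ds1] at hE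
    exact hE
  -- Gronwall's inequality in integrating-factor form.
  have hanti : AntitoneOn (fun τ => En τ * Real.exp (-K * τ)) (Icc 0 T') := by
    refine antitoneOn_of_deriv_nonpos (convex_Icc _ _) ?_ ?_ ?_
    · exact hEc.mul (Continuous.continuousOn (by fun_prop))
    · intro τ hτ
      rw [interior_Icc] at hτ
      obtain ⟨E', hE', -⟩ := hEd τ hτ
      exact (hE'.differentiableAt.mul (by fun_prop)).differentiableWithinAt
    · intro τ hτ
      rw [interior_Icc] at hτ
      obtain ⟨E', hE', hle⟩ := hEd τ hτ
      have hexp : HasDerivAt (fun τ => Real.exp (-K * τ)) (Real.exp (-K * τ) * (-K)) τ := by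
        simpa using ((hasDerivAt_id τ).const_mul (-K)).exp
      change deriv (En * fun τ => Real.exp (-K * τ)) τ ≤ 0
      rw [(hE'.mul hexp).deriv]
      nlinarith [Real.exp_pos (-K * τ)]
  have htc : t ∈ Icc 0 T' := ⟨ht.1, htT'.le⟩
  have h0c : (0 : ℝ) ∈ Icc 0 T' := ⟨le_rfl, hT0⟩
  have hE0 : En 0 = 0 := by
    have : ∀ x, q x 0 = 0 := by
      intro x
      have eu : (fun y => u y 0) = u₀ := funext h1.init_u
      have ev : (fun y => v y 0) = u₀ := funext h2.init_u
      simp only [hq, hw, hz, hs0, add_zero, dx, h1.init_ρ, h2.init_ρ, eu, ev]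
      ring
    simp [hEn, this]
  have hEt : En t ≤ 0 := by
    have := hanti h0c htc ht.1
    simp only [hE0, zero_mul] at this
    exact nonpos_of_mul_nonpos_left this (Real.exp_pos _)
  have hqcont : Continuous fun x => q x t :=
    hqc.comp_continuous (f := fun x => (x, t)) (by fun_prop) (fun x => ⟨mem_univ _, htc⟩)
  have hq0 : ∀ x, 0 ≤ q x t := fun x => by positivity
  have hqz : ∀ x, q x t = 0 := by
    have hper : Function.Periodic (fun x => q x t) 1 := by
      intro x
      have p1 := periodic_deriv (h1.periodic_u t (hsub htc)) x
      have p2 := periodic_deriv (h2.periodic_u t (hsub htc)) (x + s t)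
      have p3 := h1.periodic_ρ t (hsub htc) x
      have p4 := h2.periodic_ρ t (hsub htc) (x + s t)
      simp only [hq, hw, hz]
      rw [show x + 1 + s t = x + s t + 1 by ring]
      simp only [dx]
      rw [p1, p2]
      simp only at p3 p4
      rw [p3, p4]
    intro x
    -- By periodicity the energy may be computed over the period that starts at `x`, so a positive
    -- value at `x` contradicts zero energy.
    have hint : ∫ y in x..x + 1, q y t = 0 := by
      have := hper.intervalIntegral_add_eq x 0
      rw [this, zero_add]
      exact le_antisymm hEt (intervalIntegral.integral_nonneg zero_le_one fun y _ => hq0 y)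
    by_contra hne
    have hpos : 0 < ∫ y in x..x + 1, q y t := by
      refine intervalIntegral.integral_pos (by linarith) hqcont.continuousOn (fun y _ => hq0 y)
        ⟨x, ⟨le_rfl, by linarith⟩, lt_of_le_of_ne (hq0 x) (Ne.symm hne)⟩
    linarith
  refine ⟨s t, fun x => ?_, fun x => ?_⟩
  · have := hqz x
    simp only [hq] at this
    have h : w x t = 0 := by nlinarith [sq_nonneg (w x t), sq_nonneg (z x t)]
    exact sub_eq_zero.1 h
  · have := hqz x
    simp only [hq] at this
    have h : z x t = 0 := by nlinarith [sq_nonneg (w x t), sq_nonneg (z x t)]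
    exact sub_eq_zero.1 h


/-! ### From Lagrangian to Eulerian variables -/

theorem SmoothOn.hasFDerivAt {I : Set ℝ} {f : ℝ → ℝ → ℝ} {x t : ℝ} (hf : SmoothOn I f)
    (ht : I ∈ 𝓝 t) :
    HasFDerivAt (fun q : ℝ × ℝ => f q.1 q.2)
      (GHS.dx f x t • ContinuousLinearMap.fst ℝ ℝ ℝ + GHS.dt f x t • ContinuousLinearMap.snd ℝ ℝ ℝ)
      (x, t) := by
  have h := ((hf.contDiffAt ht (x := x)).differentiableAt (by simp)).hasFDerivAt
  have hx := h.comp_hasDerivAt (f := fun y => (y, t)) x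
    ((hasDerivAt_id x).prodMk (hasDerivAt_const x t))
  have ht' := h.comp_hasDerivAt (f := fun τ => (x, τ)) t
    ((hasDerivAt_const t x).prodMk (hasDerivAt_id t))
  have ex : GHS.dx f x t = _ := hx.deriv
  have et : GHS.dt f x t = _ := ht'.deriv
  refine h.congr_fderiv ?_
  ext <;> simp [ex, et]

/-- The flow with initial position `α`, Jacobian `J` and constant speed `k` of the origin. -/
noncomputable def flow (k : ℝ) (J : ℝ → ℝ → ℝ) (α t : ℝ) : ℝ := k * t + ∫ y in (0 : ℝ)..α, J y t

/-- The inverse of the flow in its first variable. -/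
noncomputable def flowInv (k : ℝ) (J : ℝ → ℝ → ℝ) (W : Set ℝ) (x t : ℝ) : ℝ :=
  (Function.invFunOn (fun q : ℝ × ℝ => (flow k J q.1 q.2, q.2)) (univ ×ˢ W) (x, t)).1

/-- A smooth periodic family of densities of total mass one. -/
structure IsJacobian (W : Set ℝ) (J : ℝ → ℝ → ℝ) : Prop where
  isOpen : IsOpen W
  smooth : SmoothOn W J
  pos : ∀ t ∈ W, ∀ α, 0 < J α t
  periodic : ∀ t ∈ W, Function.Periodic (fun α => J α t) 1
  integral : ∀ t ∈ W, ∫ α in (0 : ℝ)..1, J α t = 1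

namespace IsJacobian

variable {W : Set ℝ} {J : ℝ → ℝ → ℝ} {t : ℝ} (k : ℝ)

theorem flow_smooth (hJ : IsJacobian W J) : SmoothOn W (flow k J) :=
  ContDiffOn.add (contDiff_const.mul contDiff_snd).contDiffOn (hJ.smooth.primitive hJ.isOpen)

theorem hasDerivAt_flow (hJ : IsJacobian W J) (ht : t ∈ W) (α : ℝ) :
    HasDerivAt (fun α => flow k J α t) (J α t) α := by
  have hc := hJ.smooth.continuous_slice ht
  exact (intervalIntegral.integral_hasDerivAt_right (hc.intervalIntegrable _ _)
    (hc.stronglyMeasurableAtFilter _ _) hc.continuousAt).const_add _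

theorem dx_flow (hJ : IsJacobian W J) (ht : t ∈ W) (α : ℝ) : dx (flow k J) α t = J α t :=
  (hJ.hasDerivAt_flow k ht α).deriv

theorem dt_flow (hJ : IsJacobian W J) (ht : t ∈ W) (α : ℝ) :
    dt (flow k J) α t = k + ∫ y in (0 : ℝ)..α, dt J y t := by
  have h := ((hasDerivAt_id t).const_mul k).add (hJ.smooth.hasDerivAt_integral hJ.isOpen 0 α ht)
  rw [mul_one] at h
  exact h.deriv

theorem hasDerivAt_dt_flow (hJ : IsJacobian W J) (ht : t ∈ W) (α : ℝ) :
    HasDerivAt (fun α => dt (flow k J) α t) (dt J α t) α := by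
  have hc := (hJ.smooth.dt hJ.isOpen).continuous_slice ht
  rw [funext fun α => hJ.dt_flow k ht α]
  exact (intervalIntegral.integral_hasDerivAt_right (hc.intervalIntegrable _ _)
    (hc.stronglyMeasurableAtFilter _ _) hc.continuousAt).const_add _

theorem flow_add_one (hJ : IsJacobian W J) (ht : t ∈ W) (α : ℝ) :
    flow k J (α + 1) t = flow k J α t + 1 := by
  have hc := hJ.smooth.continuous_slice ht
  have h1 := (hJ.periodic t ht).intervalIntegral_add_eq α 0
  rw [zero_add, hJ.integral t ht] at h1
  rw [flow, flow, ← intervalIntegral.integral_add_adjacent_intervals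
    (hc.intervalIntegrable 0 α) (hc.intervalIntegrable α (α + 1)), h1]
  ring

theorem flow_strictMono (hJ : IsJacobian W J) (ht : t ∈ W) : StrictMono fun α => flow k J α t :=
  strictMono_of_hasDerivAt_pos (hJ.hasDerivAt_flow k ht) (hJ.pos t ht)

/-- Total mass one makes the flow minus the identity periodic, so the flow takes values `flow 0 + n`
at the integers; the intermediate value theorem fills the gaps. -/
theorem flow_surjective (hJ : IsJacobian W J) (ht : t ∈ W) :
    Function.Surjective fun α => flow k J α t := by
  intro x
  have hp : Function.Periodic (fun α => flow k J α t - α) 1 := fun α => by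
    simp only [hJ.flow_add_one k ht α]; ring
  have hn : ∀ n : ℤ, flow k J n t = flow k J 0 t + n := fun n => by
    have := hp.int_mul n 0
    simp only [zero_add, mul_one, sub_zero] at this
    linarith
  have hc : Continuous fun α => flow k J α t := (hJ.flow_smooth k).continuous_slice ht
  refine mem_range_of_exists_le_of_exists_ge hc ⟨(⌊x - flow k J 0 t⌋ : ℤ), ?_⟩
    ⟨((⌊x - flow k J 0 t⌋ + 1 : ℤ) : ℝ), ?_⟩
  · simp only [hn]
    linarith [Int.floor_le (x - flow k J 0 t)]
  · simp only [hn]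
    push_cast
    linarith [Int.lt_floor_add_one (x - flow k J 0 t)]

theorem image_flow (hJ : IsJacobian W J) :
    (fun q : ℝ × ℝ => (flow k J q.1 q.2, q.2)) '' (univ ×ˢ W) = univ ×ˢ W := by
  ext ⟨x, t⟩
  constructor
  · rintro ⟨q, hq, hqe⟩
    simp only [Prod.mk.injEq] at hqe
    exact ⟨mem_univ _, hqe.2 ▸ hq.2⟩
  · rintro ⟨-, ht⟩
    obtain ⟨α, hα⟩ := hJ.flow_surjective k ht x
    exact ⟨(α, t), ⟨mem_univ _, ht⟩, Prod.ext hα rfl⟩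

theorem injOn_flow (hJ : IsJacobian W J) :
    InjOn (fun q : ℝ × ℝ => (flow k J q.1 q.2, q.2)) (univ ×ˢ W) := by
  rintro ⟨α, t⟩ ⟨-, ht⟩ ⟨β, s⟩ - h
  simp only [Prod.mk.injEq] at h
  obtain ⟨h1, rfl⟩ := h
  rw [(hJ.flow_strictMono k ht).injective h1]

theorem flowInv_flow (hJ : IsJacobian W J) (ht : t ∈ W) (α : ℝ) :
    flowInv k J W (flow k J α t) t = α := by
  have := (hJ.injOn_flow k).leftInvOn_invFunOn (x := (α, t)) ⟨mem_univ _, ht⟩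
  exact congrArg Prod.fst this

theorem flow_flowInv (hJ : IsJacobian W J) (ht : t ∈ W) (x : ℝ) :
    flow k J (flowInv k J W x t) t = x := by
  obtain ⟨α, rfl⟩ := hJ.flow_surjective k ht x
  simp only [hJ.flowInv_flow k ht]

theorem flowInv_add_one (hJ : IsJacobian W J) (ht : t ∈ W) (x : ℝ) :
    flowInv k J W (x + 1) t = flowInv k J W x t + 1 := by
  apply (hJ.flow_strictMono k ht).injective
  simp only [hJ.flow_flowInv k ht, hJ.flow_add_one k ht]

/-- The inverse is taken jointly in position and time: the map `(α, t) ↦ (flow α t, t)` has a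
triangular derivative with diagonal `(J, 1)`, so smoothness in both variables comes at once. -/
theorem flowInv_smooth (hJ : IsJacobian W J) : SmoothOn W (flowInv k J W) := by
  have hO : IsOpen ((univ : Set ℝ) ×ˢ W) := isOpen_univ.prod hJ.isOpen
  have h := contDiffOn_invFunOn hO (h := fun q : ℝ × ℝ => (flow k J q.1 q.2, q.2))
    (ContDiffOn.prodMk (hJ.flow_smooth k) contDiffOn_snd) (hJ.injOn_flow k) (by
      rintro ⟨α, t⟩ ⟨-, ht⟩
      have hpos := (hJ.pos t ht α).ne'
      set L : ℝ × ℝ →L[ℝ] ℝ := dx (flow k J) α t • ContinuousLinearMap.fst ℝ ℝ ℝ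
        + dt (flow k J) α t • ContinuousLinearMap.snd ℝ ℝ ℝ with hL
      have hF := ((hJ.flow_smooth k).hasFDerivAt (x := α) (hJ.isOpen.mem_nhds ht))
      refine ⟨ContinuousLinearEquiv.equivOfInverse (L.prod (ContinuousLinearMap.snd ℝ ℝ ℝ))
        (((J α t)⁻¹ • (ContinuousLinearMap.fst ℝ ℝ ℝ -
          dt (flow k J) α t • ContinuousLinearMap.snd ℝ ℝ ℝ)).prod
          (ContinuousLinearMap.snd ℝ ℝ ℝ)) ?_ ?_, ?_⟩
      · rintro ⟨a, b⟩
        simp [hL, hJ.dx_flow k ht]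
        field_simp
      · rintro ⟨a, b⟩
        simp [hL, hJ.dx_flow k ht]
        field_simp
        ring
      · exact hF.prodMk hasFDerivAt_snd)
  rw [hJ.image_flow k] at h
  exact contDiff_fst.comp_contDiffOn h.2

theorem smooth_comp_flowInv (hJ : IsJacobian W J) {f : ℝ → ℝ → ℝ} (hf : SmoothOn W f) :
    SmoothOn W (fun x t => f (flowInv k J W x t) t) :=
  ContDiffOn.comp (t := univ ×ˢ W) hf (f := fun q : ℝ × ℝ => (flowInv k J W q.1 q.2, q.2))
    (ContDiffOn.prodMk (hJ.flowInv_smooth k) contDiffOn_snd) (fun _ hq => ⟨mem_univ _, hq.2⟩)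

theorem integral_comp_flow (hJ : IsJacobian W J) (ht : t ∈ W) {h : ℝ → ℝ} (hc : Continuous h)
    (hp : Function.Periodic h 1) :
    ∫ x in (0 : ℝ)..1, h x = ∫ α in (0 : ℝ)..1, h (flow k J α t) * J α t := by
  have h1 := intervalIntegral.integral_comp_mul_deriv (a := 0) (b := 1)
    (fun α _ => hJ.hasDerivAt_flow k ht α) (hJ.smooth.continuous_slice ht).continuousOn hc
  have h2 := hp.intervalIntegral_add_eq (flow k J 0 t) 0
  rw [zero_add] at h2
  have h3 := hJ.flow_add_one k ht 0
  rw [zero_add] at h3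
  rw [← h2, ← h3]
  exact h1.symm

theorem integral_dt (hJ : IsJacobian W J) (ht : t ∈ W) : ∫ α in (0 : ℝ)..1, dt J α t = 0 := by
  have h1 := hJ.smooth.hasDerivAt_integral hJ.isOpen 0 1 ht
  have h2 : HasDerivAt (fun t => ∫ α in (0 : ℝ)..1, J α t) 0 t := by
    refine (hasDerivAt_const t (1 : ℝ)).congr_of_eventuallyEq ?_
    filter_upwards [hJ.isOpen.mem_nhds ht] with s hs using hJ.integral s hs
  exact h1.unique h2

theorem integral_dt_dt (hJ : IsJacobian W J) (ht : t ∈ W) :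
    ∫ α in (0 : ℝ)..1, dt (dt J) α t = 0 := by
  have h1 := (hJ.smooth.dt hJ.isOpen).hasDerivAt_integral hJ.isOpen 0 1 ht
  have h2 : HasDerivAt (fun t => ∫ α in (0 : ℝ)..1, dt J α t) 0 t := by
    refine (hasDerivAt_const t (0 : ℝ)).congr_of_eventuallyEq ?_
    filter_upwards [hJ.isOpen.mem_nhds ht] with s hs using hJ.integral_dt hs
  exact h1.unique h2

/-- The Eulerian velocity. -/
noncomputable def velocity (J : ℝ → ℝ → ℝ) (W : Set ℝ) (x t : ℝ) : ℝ :=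
  dt (flow k J) (flowInv k J W x t) t

theorem velocity_smooth (hJ : IsJacobian W J) : SmoothOn W (velocity k J W) :=
  hJ.smooth_comp_flowInv k ((hJ.flow_smooth k).dt hJ.isOpen)

theorem velocity_flow (hJ : IsJacobian W J) (ht : t ∈ W) (α : ℝ) :
    velocity k J W (flow k J α t) t = dt (flow k J) α t := by
  rw [velocity, hJ.flowInv_flow k ht]

theorem velocity_periodic (hJ : IsJacobian W J) (ht : t ∈ W) :
    Function.Periodic (fun x => velocity k J W x t) 1 := by
  intro x
  simp only [velocity, hJ.flowInv_add_one k ht]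
  have hd : ∀ α, HasDerivAt (fun t => flow k J α t) (dt (flow k J) α t) t := fun α =>
    (hJ.flow_smooth k).hasDerivAt_dt (hJ.isOpen.mem_nhds ht)
  refine (hd _).unique (((hd _).add_const 1).congr_of_eventuallyEq ?_)
  filter_upwards [hJ.isOpen.mem_nhds ht] with s hs using hJ.flow_add_one k hs _

/-- Differentiate `u(γ(α, t), t) = γ_t(α, t)` in `α`. -/
theorem dx_velocity_flow (hJ : IsJacobian W J) (ht : t ∈ W) (α : ℝ) :
    dx (velocity k J W) (flow k J α t) t = dt J α t / J α t := by
  rw [eq_div_iff (hJ.pos t ht α).ne']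
  have h1 := ((hJ.velocity_smooth k).hasDerivAt_dx (x := flow k J α t) ht).comp α
    (hJ.hasDerivAt_flow k ht α)
  have h2 := hJ.hasDerivAt_dt_flow k ht α
  refine h1.unique (h2.congr_of_eventuallyEq (Eventually.of_forall fun β => ?_))
  exact hJ.velocity_flow k ht β

/-- The material derivative. -/
theorem material_derivative (hJ : IsJacobian W J) (ht : t ∈ W) (α : ℝ) {f : ℝ → ℝ → ℝ}
    (hf : SmoothOn W f) :
    HasDerivAt (fun τ => f (flow k J α τ) τ)
      (dt f (flow k J α t) t + velocity k J W (flow k J α t) t * dx f (flow k J α t) t) t := by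
  have h := hf.hasDerivAt_curve (hJ.isOpen.mem_nhds ht)
    ((hJ.flow_smooth k).hasDerivAt_dt (x := α) (hJ.isOpen.mem_nhds ht))
  rw [hJ.velocity_flow k ht]
  exact h.congr_deriv (by ring)

end IsJacobian

/-- The right-hand side `F` may be any function of time: multiplying the Lagrangian equation by `J`
and integrating, with `∫ J = 1` and hence `∫ J_tt = 0`, shows that it equals the nonlocal term. The
origin moves with speed `u₀ 0`, so the initial velocity is `u₀ 0 + ∫ u₀' = u₀`. -/
theorem isSmoothSolution_of_lagrangian {W : Set ℝ} {J R : ℝ → ℝ → ℝ} {lam kap T : ℝ}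
    {u₀ ρ₀ : ℝ → ℝ} {F : ℝ → ℝ}
    (hJ : IsJacobian W J) (hR : SmoothOn W R)
    (pR : ∀ t ∈ W, Function.Periodic (fun α => R α t) 1) (hTW : Ico 0 T ⊆ W)
    (h0W : 0 ∈ W) (hu₀ : ContDiff ℝ ∞ u₀) (hJ0 : ∀ α, J α 0 = 1)
    (hJ1 : ∀ α, dt J α 0 = deriv u₀ α) (hR0 : ∀ α, R α 0 = ρ₀ α)
    (hJeq : ∀ t ∈ Ioo 0 T, ∀ α, dt (dt J) α t / J α t - (dt J α t / J α t) ^ 2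
      - lam * (dt J α t / J α t) ^ 2 - kap * R α t ^ 2 = F t)
    (hReq : ∀ t ∈ Ioo 0 T, ∀ α, dt R α t = 2 * lam * R α t * (dt J α t / J α t)) :
    IsSmoothSolution lam kap u₀ ρ₀ T (IsJacobian.velocity (u₀ 0) J W)
      (fun x t => R (flowInv (u₀ 0) J W x t) t) := by
  set k := u₀ 0
  set u := IsJacobian.velocity k J W with hu
  set ρ : ℝ → ℝ → ℝ := fun x t => R (flowInv k J W x t) t with hρ
  have su : SmoothOn W u := hJ.velocity_smooth k
  have sρ : SmoothOn W ρ := hJ.smooth_comp_flowInv k hR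
  have pu : ∀ t ∈ W, Function.Periodic (fun x => u x t) 1 := fun t ht => hJ.velocity_periodic k ht
  have pρ : ∀ t ∈ W, Function.Periodic (fun x => ρ x t) 1 := fun t ht x => by
    simp only [hρ, hJ.flowInv_add_one k ht]
    exact pR t ht _
  have hflow0 : ∀ α, flow k J α 0 = α := fun α => by simp [flow, hJ0]
  have hinv0 : ∀ x, flowInv k J W x 0 = x := fun x => by
    have := hJ.flowInv_flow k h0W x
    rwa [hflow0] at this
  have ρflow : ∀ t ∈ W, ∀ α, ρ (flow k J α t) t = R α t := fun t ht α => by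
    simp only [hρ, hJ.flowInv_flow k ht]
  have hJW := hJ.isOpen
  have hU := su.dx hJW.uniqueDiffOn
  refine ⟨su.mono hTW, sρ.mono hTW, fun t ht => pu t (hTW ht), fun t ht => pρ t (hTW ht),
    fun x => ?_, fun x => ?_, fun t ht x => ?_, fun t ht x => ?_⟩
  · simp only [hu, IsJacobian.velocity, hinv0]
    rw [hJ.dt_flow k h0W]
    simp_rw [hJ1]
    rw [intervalIntegral.integral_deriv_eq_sub' u₀ rfl
      (fun y _ => hu₀.differentiable (by simp) y)
      ((contDiff_infty_iff_deriv.1 hu₀).2.continuous.continuousOn)]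
    simp [k]
  · simp only [hρ, hinv0, hR0]
  · have htW : t ∈ W := hTW ⟨ht.1.le, ht.2⟩
    have hn := hJW.mem_nhds htW
    have lag : ∀ α, dt (dx u) (flow k J α t) t
        + u (flow k J α t) t * dx (dx u) (flow k J α t) t
        = dt (dt J) α t / J α t - (dt J α t / J α t) ^ 2 := by
      intro α
      have h1 := hJ.material_derivative k htW α hU
      have h2 : HasDerivAt (fun τ => dt J α τ / J α τ) _ t :=
        ((hJ.smooth.dt hJW).hasDerivAt_dt (x := α) hn).div (hJ.smooth.hasDerivAt_dt (x := α) hn)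
          (hJ.pos t htW α).ne'
      have h3 := h1.unique (h2.congr_of_eventuallyEq (by
        filter_upwards [hn] with s hs using hJ.dx_velocity_flow k hs α))
      have hJp := (hJ.pos t htW α).ne'
      rw [h3]
      field_simp
    have hnl : nonlocal lam kap u ρ t = F t := by
      have c1 := hU.continuous_slice htW
      have c2 := sρ.continuous_slice htW
      rw [nonlocal, hJ.integral_comp_flow k htW (h := fun x => ρ x t ^ 2) (c2.pow 2)
        (fun x => by simpa using congrArg (· ^ 2) (pρ t htW x)),
        hJ.integral_comp_flow k htW (h := fun x => dx u x t ^ 2) (c1.pow 2)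
        (fun x => congrArg (· ^ 2) (periodic_deriv (pu t htW) x))]
      simp_rw [ρflow t htW, hu, hJ.dx_velocity_flow k htW]
      have cJ := hJ.smooth.continuous_slice htW
      have cJt := (hJ.smooth.dt hJW).continuous_slice htW
      have cJtt := ((hJ.smooth.dt hJW).dt hJW).continuous_slice htW
      have cR := hR.continuous_slice htW
      have cU : Continuous fun α => dt J α t / J α t := cJt.div cJ fun α => (hJ.pos t htW α).ne'
      -- The coefficient `1 + λ` of the nonlocal term arises here: one square comes from
      -- differentiating `J_t / J`, the other `λ` squares from the equation.
      have e : ∀ α, F t * J α t = dt (dt J) α t - (1 + lam) * ((dt J α t / J α t) ^ 2 * J α t)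
          - kap * (R α t ^ 2 * J α t) := fun α => by
        have hJp := (hJ.pos t htW α).ne'
        rw [← hJeq t ht α]
        field_simp
        ring
      have h1 : F t = ∫ α in (0 : ℝ)..1, F t * J α t := by
        rw [intervalIntegral.integral_const_mul, hJ.integral t htW, mul_one]
      rw [h1, intervalIntegral.integral_congr fun α _ => e α, intervalIntegral.integral_sub,
        intervalIntegral.integral_sub, hJ.integral_dt_dt htW, intervalIntegral.integral_const_mul,
        intervalIntegral.integral_const_mul]
      · ring
      all_goals exact Continuous.intervalIntegrable (by fun_prop) _ _
    obtain ⟨α, rfl⟩ := hJ.flow_surjective k htW x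
    simp only [] at *
    rw [hnl, lag, ρflow t htW, hu, hJ.dx_velocity_flow k htW, ← hJeq t ht α]
  · have htW : t ∈ W := hTW ⟨ht.1.le, ht.2⟩
    have hn := hJW.mem_nhds htW
    obtain ⟨α, rfl⟩ := hJ.flow_surjective k htW x
    simp only []
    have h1 := hJ.material_derivative k htW α sρ
    have h3 := h1.unique ((hR.hasDerivAt_dt (x := α) hn).congr_of_eventuallyEq (by
        filter_upwards [hn] with s hs using ρflow s hs α))
    rw [ρflow t htW, hu, hJ.dx_velocity_flow k htW, ← hReq t ht α]
    exact h3


/-! ### The explicit solution -/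

section Explicit

variable {lam kap : ℝ} {u₀ ρ₀ : ℝ → ℝ}

/-- `∂_η 𝒬`. -/
noncomputable def Qη (lam kap : ℝ) (u₀ ρ₀ : ℝ → ℝ) (x η : ℝ) : ℝ :=
  2 * c lam kap u₀ ρ₀ x * η - 2 * lam * deriv u₀ x

theorem hasDerivAt_Q (x η : ℝ) :
    HasDerivAt (fun η => Q lam kap u₀ ρ₀ x η) (Qη lam kap u₀ ρ₀ x η) η := by
  have h := ((((hasDerivAt_id η).pow 2).const_mul (c lam kap u₀ ρ₀ x)).sub
    ((hasDerivAt_id η).const_mul (2 * lam * deriv u₀ x))).add_const 1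
  exact h.congr_deriv (by simp [Qη]; ring)

theorem hasDerivAt_Qη (x η : ℝ) :
    HasDerivAt (fun η => Qη lam kap u₀ ρ₀ x η) (2 * c lam kap u₀ ρ₀ x) η := by
  have h := ((hasDerivAt_id η).const_mul (2 * c lam kap u₀ ρ₀ x)).sub_const
    (2 * lam * deriv u₀ x)
  exact h.congr_deriv (by simp)

/-- The left side does not depend on `η`: it is the discriminant of a quadratic polynomial. This
identity feeds `ρ` into the Riccati equation. -/
theorem discriminant_Q (x η : ℝ) : Qη lam kap u₀ ρ₀ x η ^ 2
    - 4 * c lam kap u₀ ρ₀ x * Q lam kap u₀ ρ₀ x η = 4 * (lam * kap) * ρ₀ x ^ 2 := by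
  simp only [Qη, Q, c]; ring

theorem Q_zero (x : ℝ) : Q lam kap u₀ ρ₀ x 0 = 1 := by simp [Q]

namespace IsSmoothPeriodicData

variable (h : IsSmoothPeriodicData u₀ ρ₀)
include h

theorem smooth_deriv : ContDiff ℝ ∞ (deriv u₀) := (contDiff_infty_iff_deriv.1 h.smooth_u).2

theorem smooth_c : ContDiff ℝ ∞ (c lam kap u₀ ρ₀) :=
  contDiff_const.mul ((contDiff_const.mul (h.smooth_deriv.pow 2)).sub
    (contDiff_const.mul (h.smooth_ρ.pow 2)))

theorem smooth_Q : ContDiff ℝ ∞ (fun q : ℝ × ℝ => Q lam kap u₀ ρ₀ q.1 q.2) :=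
  (((h.smooth_c.comp contDiff_fst).mul (contDiff_snd.pow 2)).sub
    ((contDiff_const.mul (h.smooth_deriv.comp contDiff_fst)).mul contDiff_snd)).add contDiff_const

theorem periodic_deriv : Function.Periodic (deriv u₀) 1 := GHS.periodic_deriv h.periodic_u

theorem periodic_Q (η : ℝ) : Function.Periodic (fun x => Q lam kap u₀ ρ₀ x η) 1 := fun x => by
  simp only [Q, c, h.periodic_deriv x, h.periodic_ρ x]

end IsSmoothPeriodicData

/-- The ratio `η' / 𝒬`. -/
noncomputable def ratio (lam kap : ℝ) (u₀ ρ₀ : ℝ → ℝ) (η E : ℝ → ℝ) (α t : ℝ) : ℝ :=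
  E t / Q lam kap u₀ ρ₀ α (η t)

/-- The Jacobian of the flow. -/
noncomputable def jac (lam kap : ℝ) (u₀ ρ₀ : ℝ → ℝ) (η E : ℝ → ℝ) (α t : ℝ) : ℝ :=
  ratio lam kap u₀ ρ₀ η E α t ^ (1 / (2 * lam))

/-- `ρ` along the flow. -/
noncomputable def dens (lam kap : ℝ) (u₀ ρ₀ : ℝ → ℝ) (η E : ℝ → ℝ) (α t : ℝ) : ℝ :=
  ρ₀ α * ratio lam kap u₀ ρ₀ η E α t

/-- The logarithmic time derivative of the ratio. -/
noncomputable def logRate (lam kap : ℝ) (u₀ ρ₀ : ℝ → ℝ) (η E : ℝ → ℝ) (α t : ℝ) : ℝ :=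
  deriv E t / E t - Qη lam kap u₀ ρ₀ α (η t) * E t / Q lam kap u₀ ρ₀ α (η t)

/-- A time change `η` with speed `E > 0` for which `𝒬` stays positive. -/
structure IsClock (lam kap : ℝ) (u₀ ρ₀ : ℝ → ℝ) (W : Set ℝ) (η E : ℝ → ℝ) : Prop where
  isOpen : IsOpen W
  deriv_eta : ∀ t ∈ W, HasDerivAt η (E t) t
  smooth : ContDiffOn ℝ ∞ E W
  pos : ∀ t ∈ W, 0 < E t
  Q_pos : ∀ t ∈ W, ∀ α, 0 < Q lam kap u₀ ρ₀ α (η t)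

namespace IsClock

variable {W : Set ℝ} {η E : ℝ → ℝ} {t : ℝ}

theorem smooth_eta (hc : IsClock lam kap u₀ ρ₀ W η E) : ContDiffOn ℝ ∞ η W := by
  rw [contDiffOn_infty_iff_deriv_of_isOpen hc.isOpen]
  exact ⟨fun t ht => (hc.deriv_eta t ht).differentiableAt.differentiableWithinAt,
    hc.smooth.congr fun t ht => (hc.deriv_eta t ht).deriv⟩

theorem hasDerivAt_E (hc : IsClock lam kap u₀ ρ₀ W η E) (ht : t ∈ W) :
    HasDerivAt E (deriv E t) t :=
  ((hc.smooth.contDiffAt (hc.isOpen.mem_nhds ht)).differentiableAt (by simp)).hasDerivAt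

theorem hasDerivAt_deriv_E (hc : IsClock lam kap u₀ ρ₀ W η E) (ht : t ∈ W) :
    HasDerivAt (deriv E) (deriv (deriv E) t) t :=
  ((((contDiffOn_infty_iff_deriv_of_isOpen hc.isOpen).1 hc.smooth).2.contDiffAt
    (hc.isOpen.mem_nhds ht)).differentiableAt (by simp)).hasDerivAt

theorem ratio_pos (hc : IsClock lam kap u₀ ρ₀ W η E) (ht : t ∈ W) (α : ℝ) :
    0 < ratio lam kap u₀ ρ₀ η E α t :=
  div_pos (hc.pos t ht) (hc.Q_pos t ht α)

theorem ratio_smooth (hc : IsClock lam kap u₀ ρ₀ W η E) (h : IsSmoothPeriodicData u₀ ρ₀) :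
    SmoothOn W (ratio lam kap u₀ ρ₀ η E) := by
  have hE : ContDiffOn ℝ ∞ (fun q : ℝ × ℝ => E q.2) (univ ×ˢ W) :=
    hc.smooth.comp contDiffOn_snd fun q hq => hq.2
  have hη : ContDiffOn ℝ ∞ (fun q : ℝ × ℝ => (q.1, η q.2)) (univ ×ˢ W) :=
    contDiffOn_fst.prodMk (hc.smooth_eta.comp contDiffOn_snd fun q hq => hq.2)
  exact hE.div (h.smooth_Q.comp_contDiffOn hη) fun q hq => (hc.Q_pos q.2 hq.2 q.1).ne'

theorem jac_smooth (hc : IsClock lam kap u₀ ρ₀ W η E) (h : IsSmoothPeriodicData u₀ ρ₀) :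
    SmoothOn W (jac lam kap u₀ ρ₀ η E) :=
  ContDiffOn.rpow_const_of_ne (hc.ratio_smooth h) fun q hq => (hc.ratio_pos hq.2 q.1).ne'

theorem dens_smooth (hc : IsClock lam kap u₀ ρ₀ W η E) (h : IsSmoothPeriodicData u₀ ρ₀) :
    SmoothOn W (dens lam kap u₀ ρ₀ η E) :=
  ContDiffOn.mul (h.smooth_ρ.comp contDiff_fst).contDiffOn (hc.ratio_smooth h)

theorem hasDerivAt_ratio (hc : IsClock lam kap u₀ ρ₀ W η E) (ht : t ∈ W) (α : ℝ) :
    HasDerivAt (fun t => ratio lam kap u₀ ρ₀ η E α t)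
      (ratio lam kap u₀ ρ₀ η E α t * logRate lam kap u₀ ρ₀ η E α t) t := by
  have h1 := (hc.hasDerivAt_E ht).div
    ((hasDerivAt_Q (lam := lam) (kap := kap) (u₀ := u₀) (ρ₀ := ρ₀) α (η t)).comp t
      (hc.deriv_eta t ht)) (hc.Q_pos t ht α).ne'
  refine h1.congr_deriv ?_
  have e1 := (hc.Q_pos t ht α).ne'
  have e2 := (hc.pos t ht).ne'
  simp only [ratio, logRate, Function.comp]
  field_simp

theorem hasDerivAt_jac (hc : IsClock lam kap u₀ ρ₀ W η E) (ht : t ∈ W) (α : ℝ) :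
    HasDerivAt (fun t => jac lam kap u₀ ρ₀ η E α t)
      (1 / (2 * lam) * logRate lam kap u₀ ρ₀ η E α t * jac lam kap u₀ ρ₀ η E α t) t := by
  have hp := hc.ratio_pos ht α
  refine ((hc.hasDerivAt_ratio ht α).rpow_const (Or.inl hp.ne')).congr_deriv ?_
  rw [Real.rpow_sub_one hp.ne', jac]
  field_simp

theorem hasDerivAt_dens (hc : IsClock lam kap u₀ ρ₀ W η E) (ht : t ∈ W) (α : ℝ) :
    HasDerivAt (fun t => dens lam kap u₀ ρ₀ η E α t)
      (dens lam kap u₀ ρ₀ η E α t * logRate lam kap u₀ ρ₀ η E α t) t :=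
  ((hc.hasDerivAt_ratio ht α).const_mul (ρ₀ α)).congr_deriv (by simp only [dens]; ring)

/-- The Riccati equation: divided by `2λ` it reads `(u_x)_t = λ u_x² + κ ρ²` along the flow, up to a
function of time. That function is a multiple of the Schwarzian derivative of `η`, and
`discriminant_Q` supplies the term in `ρ`. -/
theorem hasDerivAt_logRate (hc : IsClock lam kap u₀ ρ₀ W η E) (ht : t ∈ W) (α : ℝ) :
    HasDerivAt (fun t => logRate lam kap u₀ ρ₀ η E α t)
      (deriv (deriv E) t / E t - 3 / 2 * (deriv E t / E t) ^ 2
        + 1 / 2 * logRate lam kap u₀ ρ₀ η E α t ^ 2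
        + 2 * (lam * kap) * dens lam kap u₀ ρ₀ η E α t ^ 2) t := by
  have hη := hc.deriv_eta t ht
  have h1 := ((hc.hasDerivAt_deriv_E ht).div (hc.hasDerivAt_E ht) (hc.pos t ht).ne').sub
    ((((hasDerivAt_Qη (lam := lam) (kap := kap) (u₀ := u₀) (ρ₀ := ρ₀) α (η t)).comp t hη).mul
      (hc.hasDerivAt_E ht)).div
    ((hasDerivAt_Q (lam := lam) (kap := kap) (u₀ := u₀) (ρ₀ := ρ₀) α (η t)).comp t hη)
      (hc.Q_pos t ht α).ne')
  refine h1.congr_deriv ?_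
  have e1 := (hc.Q_pos t ht α).ne'
  have e2 := (hc.pos t ht).ne'
  have hd : 2 * (lam * kap) * dens lam kap u₀ ρ₀ η E α t ^ 2 =
      1 / 2 * (Qη lam kap u₀ ρ₀ α (η t) ^ 2
        - 4 * c lam kap u₀ ρ₀ α * Q lam kap u₀ ρ₀ α (η t))
        * (E t / Q lam kap u₀ ρ₀ α (η t)) ^ 2 := by
    rw [discriminant_Q, dens, ratio]; ring
  rw [hd]
  simp only [logRate, Function.comp, Pi.mul_apply]
  field_simp
  ring

theorem dt_jac (hc : IsClock lam kap u₀ ρ₀ W η E) (ht : t ∈ W) (α : ℝ) :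
    dt (jac lam kap u₀ ρ₀ η E) α t =
      1 / (2 * lam) * logRate lam kap u₀ ρ₀ η E α t * jac lam kap u₀ ρ₀ η E α t :=
  (hc.hasDerivAt_jac ht α).deriv

theorem jac_pos (hc : IsClock lam kap u₀ ρ₀ W η E) (ht : t ∈ W) (α : ℝ) :
    0 < jac lam kap u₀ ρ₀ η E α t :=
  Real.rpow_pos_of_pos (hc.ratio_pos ht α) _

theorem dt_jac_div (hc : IsClock lam kap u₀ ρ₀ W η E) (ht : t ∈ W) (α : ℝ) :
    dt (jac lam kap u₀ ρ₀ η E) α t / jac lam kap u₀ ρ₀ η E α t =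
      1 / (2 * lam) * logRate lam kap u₀ ρ₀ η E α t := by
  rw [hc.dt_jac ht, mul_div_cancel_right₀ _ (hc.jac_pos ht α).ne']

theorem isSmoothSolution (hc : IsClock lam kap u₀ ρ₀ W η E) (h : IsSmoothPeriodicData u₀ ρ₀)
    (hlam : lam ≠ 0) {T : ℝ} (hTW : Ico 0 T ⊆ W) (h0W : 0 ∈ W) (hη0 : η 0 = 0) (hE0 : E 0 = 1)
    (hint : ∀ t ∈ W, ∫ α in (0 : ℝ)..1, jac lam kap u₀ ρ₀ η E α t = 1) :
    IsJacobian W (jac lam kap u₀ ρ₀ η E) ∧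
    IsSmoothSolution lam kap u₀ ρ₀ T
      (IsJacobian.velocity (u₀ 0) (jac lam kap u₀ ρ₀ η E) W)
      (fun x t => dens lam kap u₀ ρ₀ η E (flowInv (u₀ 0) (jac lam kap u₀ ρ₀ η E) W x t) t) := by
  have hper : ∀ t, Function.Periodic (fun α => ratio lam kap u₀ ρ₀ η E α t) 1 := fun t α => by
    have := h.periodic_Q (lam := lam) (kap := kap) (η t) α
    simp only at this
    simp only [ratio, this]
  have hJ : IsJacobian W (jac lam kap u₀ ρ₀ η E) :=
    ⟨hc.isOpen, hc.jac_smooth h, fun t ht => hc.jac_pos ht, fun t _ α => by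
      have := hper t α
      simp only at this
      simp only [jac, this], hint⟩
  have hr0 : ∀ α, ratio lam kap u₀ ρ₀ η E α 0 = 1 := fun α => by
    rw [ratio, hη0, hE0, Q_zero, div_one]
  have hj0 : ∀ α, jac lam kap u₀ ρ₀ η E α 0 = 1 := fun α => by
    rw [jac, hr0, Real.one_rpow]
  have hdt0 : ∀ α, dt (jac lam kap u₀ ρ₀ η E) α 0 = 1 / (2 * lam) * deriv E 0 + deriv u₀ α := by
    intro α
    rw [hc.dt_jac h0W, hj0, logRate, hη0, hE0, Q_zero, Qη]
    field_simp
    ring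
  -- Conservation of mass at time zero, with `∫ u₀' = 0`; therefore `J_t(·, 0)` is exactly `u₀'`.
  have hE' : deriv E 0 = 0 := by
    have h1 := hJ.integral_dt h0W
    simp_rw [hdt0] at h1
    rw [intervalIntegral.integral_add (by simp) (h.smooth_deriv.continuous.intervalIntegrable _ _),
      intervalIntegral.integral_deriv_eq_sub' u₀ rfl
      (fun y _ => h.smooth_u.differentiable (by simp) y) h.smooth_deriv.continuous.continuousOn] at h1
    have h2 := h.periodic_u 0
    rw [zero_add] at h2
    simpa [h2, hlam] using h1
  refine ⟨hJ, isSmoothSolution_of_lagrangian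
    (F := fun t => 1 / (2 * lam) * (deriv (deriv E) t / E t - 3 / 2 * (deriv E t / E t) ^ 2))
    hJ (hc.dens_smooth h) (fun t _ α => ?_) hTW h0W h.smooth_u hj0 ?_ ?_ ?_ ?_⟩
  · have := hper t α
    simp only at this
    simp only [dens, this, h.periodic_ρ α]
  · intro α
    rw [hdt0, hE']; ring
  · intro α
    rw [dens, hr0, mul_one]
  · intro t ht α
    have htW := hTW ⟨ht.1.le, ht.2⟩
    have h2 : dt (dt (jac lam kap u₀ ρ₀ η E)) α t = _ :=
      ((((hc.hasDerivAt_logRate htW α).const_mul (1 / (2 * lam))).mul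
      (hc.hasDerivAt_jac htW α)).congr_of_eventuallyEq (by
        filter_upwards [hc.isOpen.mem_nhds htW] with s hs using hc.dt_jac hs α)).deriv
    have hjp := (hc.jac_pos htW α).ne'
    rw [hc.dt_jac_div htW, h2]
    field_simp
    ring
  · intro t ht α
    have htW := hTW ⟨ht.1.le, ht.2⟩
    rw [hc.dt_jac_div htW]
    refine (hc.hasDerivAt_dens htW α).deriv.trans ?_
    field_simp

end IsClock

end Explicit


/-! ### The time change determined by conservation of mass -/

section Clock

variable {lam kap : ℝ} {u₀ ρ₀ : ℝ → ℝ}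

/-- `∫₀¹ 𝒬(x, η)^(-1/(2λ)) dx`. -/
noncomputable def mass (lam kap : ℝ) (u₀ ρ₀ : ℝ → ℝ) (η : ℝ) : ℝ :=
  ∫ x in (0 : ℝ)..1, 1 / Q lam kap u₀ ρ₀ x η ^ (1 / (2 * lam))

theorem smoothOn_mass_integrand (h : IsSmoothPeriodicData u₀ ρ₀) {O : Set ℝ}
    (hQ : ∀ η ∈ O, ∀ x, 0 < Q lam kap u₀ ρ₀ x η) :
    SmoothOn O (fun x η => 1 / Q lam kap u₀ ρ₀ x η ^ (1 / (2 * lam))) :=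
  ContDiffOn.div contDiffOn_const
    (h.smooth_Q.contDiffOn.rpow_const_of_ne fun q hq => (hQ q.2 hq.2 q.1).ne')
    fun q hq => (Real.rpow_pos_of_pos (hQ q.2 hq.2 q.1) _).ne'

theorem mass_pos (h : IsSmoothPeriodicData u₀ ρ₀) {η : ℝ} (hQ : ∀ x, 0 < Q lam kap u₀ ρ₀ x η) :
    0 < mass lam kap u₀ ρ₀ η := by
  have hs := smoothOn_mass_integrand (O := {η}) h (fun e he x => by
    rw [mem_singleton_iff.1 he]; exact hQ x)
  exact intervalIntegral.intervalIntegral_pos_of_pos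
    ((hs.continuous_slice (mem_singleton η)).intervalIntegrable _ _)
    (fun x => one_div_pos.2 (Real.rpow_pos_of_pos (hQ x) _)) zero_lt_one

/-- The function `η` inverts `timeOf`, which is strictly increasing with derivative `A^(2λ)`; hence
`E = A(η)^(-2λ)`. The inversion is done on `(-δ, ηs)`, so that time zero is an interior point of `W`
and smoothness up to the initial time is automatic. -/
theorem exists_clock (h : IsSmoothPeriodicData u₀ ρ₀) (hlam : lam ≠ 0) {δ ηs ts : ℝ}
    (hδ : 0 < δ) (hηs : 0 < ηs) (hQ : ∀ η ∈ Ioo (-δ) ηs, ∀ x, 0 < Q lam kap u₀ ρ₀ x η)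
    (hts : Tendsto (timeOf lam kap u₀ ρ₀) (𝓝[<] ηs) (𝓝 ts)) :
    0 < ts ∧ ∃ (W : Set ℝ) (η E : ℝ → ℝ), IsClock lam kap u₀ ρ₀ W η E ∧ Ico 0 ts ⊆ W ∧ 0 ∈ W ∧
      η 0 = 0 ∧ E 0 = 1 ∧ (∀ t ∈ W, ∫ α in (0 : ℝ)..1, jac lam kap u₀ ρ₀ η E α t = 1) ∧
      (∀ t ∈ Ico 0 ts, η t ∈ Ico 0 ηs) ∧
      (∀ t, E t = mass lam kap u₀ ρ₀ (η t) ^ (-(2 * lam))) ∧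
      Tendsto η (𝓝[<] ts) (𝓝[<] ηs) := by
  set O := Ioo (-δ) ηs with hO
  set T := timeOf lam kap u₀ ρ₀ with hT
  set A := mass lam kap u₀ ρ₀ with hA
  have h0O : (0 : ℝ) ∈ O := ⟨by linarith, hηs⟩
  have hOo : IsOpen O := isOpen_Ioo
  have sA : ContDiffOn ℝ ∞ A O := (smoothOn_mass_integrand h hQ).contDiffOn_integral hOo 0 1
  have Apos : ∀ e ∈ O, 0 < A e := fun e he => mass_pos h (hQ e he)
  have sAp : ContDiffOn ℝ ∞ (fun e => A e ^ (2 * lam)) O :=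
    sA.rpow_const_of_ne fun e he => (Apos e he).ne'
  have hTd : ∀ e ∈ O, HasDerivAt T (A e ^ (2 * lam)) e := by
    intro e he
    have hsub : uIcc 0 e ⊆ O := (ordConnected_Ioo (a := -δ) (b := ηs)).uIcc_subset h0O he
    exact intervalIntegral.integral_hasDerivAt_right
      ((sAp.continuousOn.mono hsub).intervalIntegrable)
      (sAp.continuousOn.stronglyMeasurableAtFilter hOo e he)
      (sAp.continuousOn.continuousAt (hOo.mem_nhds he))
  have hTpos : ∀ e ∈ O, 0 < A e ^ (2 * lam) := fun e he => Real.rpow_pos_of_pos (Apos e he) _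
  have hTc : ContinuousOn T O := fun e he => (hTd e he).continuousAt.continuousWithinAt
  have hmono : StrictMonoOn T O := by
    refine strictMonoOn_of_deriv_pos (convex_Ioo _ _) hTc fun e he => ?_
    rw [interior_Ioo] at he
    rw [(hTd e he).deriv]
    exact hTpos e he
  have hTs : ContDiffOn ℝ ∞ T O := by
    rw [contDiffOn_infty_iff_deriv_of_isOpen hOo]
    exact ⟨fun e he => (hTd e he).differentiableAt.differentiableWithinAt,
      sAp.congr fun e he => (hTd e he).deriv⟩
  obtain ⟨hWo, hηs'⟩ := contDiffOn_invFunOn hOo hTs hmono.injOn fun e he =>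
    ⟨_, (hTd e he).hasFDerivAt_equiv (hTpos e he).ne'⟩
  set η := Function.invFunOn T O with hη
  have hT0 : T 0 = 0 := by simp [hT, timeOf]
  have hηT : ∀ e ∈ O, η (T e) = e := fun e he => hmono.injOn.leftInvOn_invFunOn he
  have hηO : ∀ t ∈ T '' O, η t ∈ O := fun t ht => Function.invFunOn_mem ht
  have hTη : ∀ t ∈ T '' O, T (η t) = t := fun t ht => Function.invFunOn_eq ht
  have hlt : ∀ e ∈ Ico 0 ηs, T e < ts := by
    intro e he
    obtain ⟨e', he1, he2⟩ := exists_between he.2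
    have heO : e ∈ O := ⟨by linarith [he.1], he.2⟩
    have he'O : e' ∈ O := ⟨by linarith [he.1], he2⟩
    refine (hmono heO he'O he1).trans_le (ge_of_tendsto hts ?_)
    filter_upwards [Ioo_mem_nhdsLT he2] with x hx
    exact (hmono he'O ⟨by linarith [he.1, hx.1], hx.2⟩ hx.1).le
  have hts0 : 0 < ts := hT0 ▸ hlt 0 ⟨le_rfl, hηs⟩
  have hsurj : ∀ t ∈ Ico 0 ts, ∃ e ∈ Ico 0 ηs, T e = t := by
    intro t ht
    obtain ⟨e, hte, he⟩ := ((hts.eventually_const_lt ht.2).and (Ioo_mem_nhdsLT hηs)).exists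
    have hsub : Icc 0 e ⊆ O := fun y hy => ⟨by linarith [hy.1], hy.2.trans_lt he.2⟩
    obtain ⟨y, hy, hyt⟩ := intermediate_value_Icc he.1.le (hTc.mono hsub)
      (show t ∈ Icc (T 0) (T e) from ⟨hT0.le.trans ht.1, hte.le⟩)
    exact ⟨y, ⟨hy.1, hy.2.trans_lt he.2⟩, hyt⟩
  have mem_O : ∀ e ∈ Ico 0 ηs, e ∈ O := fun e he => ⟨by linarith [he.1], he.2⟩
  have hsubW : Ico 0 ts ⊆ T '' O := fun t ht => by
    obtain ⟨e, he, rfl⟩ := hsurj t ht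
    exact mem_image_of_mem T (mem_O e he)
  have hIco : ∀ t ∈ Ico 0 ts, η t ∈ Ico 0 ηs := fun t ht => by
    obtain ⟨e, he, rfl⟩ := hsurj t ht
    rw [hηT e (mem_O e he)]; exact he
  have h0W : (0 : ℝ) ∈ T '' O := ⟨0, h0O, hT0⟩
  have hη0 : η 0 = 0 := by
    have := hηT 0 h0O
    rwa [hT0] at this
  have hclock : IsClock lam kap u₀ ρ₀ (T '' O) η (fun t => A (η t) ^ (-(2 * lam))) := by
    refine ⟨hWo, fun t ht => ?_, ?_, fun t ht => Real.rpow_pos_of_pos (Apos _ (hηO t ht)) _,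
      fun t ht => hQ _ (hηO t ht)⟩
    · have := HasDerivAt.of_local_left_inverse
        (hηs'.continuousOn.continuousAt (hWo.mem_nhds ht)) (hTd (η t) (hηO t ht))
        (hTpos _ (hηO t ht)).ne' (by filter_upwards [hWo.mem_nhds ht] with s hs using hTη s hs)
      rwa [Real.rpow_neg (Apos _ (hηO t ht)).le]
    · exact (sA.comp hηs' hηO).rpow_const_of_ne fun t ht => (Apos _ (hηO t ht)).ne'
  refine ⟨hts0, T '' O, η, fun t => A (η t) ^ (-(2 * lam)), hclock, hsubW, h0W, hη0, ?_, ?_, hIco,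
    fun t => rfl, ?_⟩
  · simp [hη0, hA, mass, Q_zero]
  · intro t ht
    have hp := Apos _ (hηO t ht)
    have e : ∀ α, jac lam kap u₀ ρ₀ η (fun t => A (η t) ^ (-(2 * lam))) α t =
        (A (η t))⁻¹ * (1 / Q lam kap u₀ ρ₀ α (η t) ^ (1 / (2 * lam))) := by
      intro α
      rw [jac, ratio, Real.div_rpow (Real.rpow_nonneg hp.le _) (hQ _ (hηO t ht) α).le,
        ← Real.rpow_mul hp.le, show -(2 * lam) * (1 / (2 * lam)) = -1 by field_simp,
        Real.rpow_neg_one]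
      ring
    simp_rw [e]
    rw [intervalIntegral.integral_const_mul]
    exact inv_mul_cancel₀ hp.ne'
  · refine tendsto_nhdsWithin_iff.2 ⟨tendsto_order.2 ⟨fun e he => ?_, fun e he => ?_⟩, ?_⟩
    · have hm : max e 0 ∈ Ico 0 ηs := ⟨le_max_right _ _, max_lt he hηs⟩
      have h0T := hmono.monotoneOn h0O (mem_O _ hm) hm.1
      rw [hT0] at h0T
      filter_upwards [Ioo_mem_nhdsLT (hlt _ hm)] with t ht
      have htI : t ∈ Ico 0 ts := ⟨h0T.trans ht.1.le, ht.2⟩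
      refine (le_max_left e 0).trans_lt ?_
      rw [← hmono.lt_iff_lt (mem_O _ hm) (hηO t (hsubW htI)), hTη t (hsubW htI)]
      exact ht.1
    · filter_upwards [Ioo_mem_nhdsLT hts0] with t ht
      exact (hIco t ⟨ht.1.le, ht.2⟩).2.trans he
    · filter_upwards [Ioo_mem_nhdsLT hts0] with t ht
      exact (hIco t ⟨ht.1.le, ht.2⟩).2

end Clock


/-! ### Norms in Lagrangian variables -/

theorem normLp_eq {f : ℝ → ℝ} (hf : Continuous f) {p : ℝ} (hp : 1 ≤ p) :
    normLp p f = ENNReal.ofReal ((∫ x in (0 : ℝ)..1, |f x| ^ p) ^ (1 / p)) := by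
  have hp0 : 0 < p := by linarith
  have hc : Continuous fun x => |f x| ^ p := hf.abs.rpow_const fun _ => Or.inr hp0.le
  rw [normLp, eLpNorm_eq_lintegral_rpow_enorm_toReal (by simpa using hp0) ENNReal.ofReal_ne_top,
    ENNReal.toReal_ofReal hp0.le, ← ENNReal.ofReal_rpow_of_nonneg
    (intervalIntegral.integral_nonneg zero_le_one fun x _ => by positivity) (by positivity),
    intervalIntegral.integral_of_le zero_le_one, ← integral_Icc_eq_integral_Ioc,
    ofReal_integral_eq_lintegral_ofReal (hc.integrableOn_Icc)
      (Eventually.of_forall fun x => by positivity)]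
  congr 1
  refine lintegral_congr fun x => ?_
  rw [Real.enorm_eq_ofReal_abs, ENNReal.ofReal_rpow_of_nonneg (abs_nonneg _) hp0.le]

theorem normLp_translate {f : ℝ → ℝ} (hf : Continuous f) (hper : Function.Periodic f 1) {p : ℝ}
    (hp : 1 ≤ p) (a : ℝ) : normLp p (fun x => f (x + a)) = normLp p f := by
  have hfa : Continuous fun x => f (x + a) := by fun_prop
  rw [normLp_eq hfa hp, normLp_eq hf hp]
  congr 2
  have h1 : Function.Periodic (fun x => |f x| ^ p) 1 := fun x => by simp only [hper x]
  have h2 := intervalIntegral.integral_comp_add_right (a := 0) (b := 1) (fun x => |f x| ^ p) a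
  rw [h2, zero_add, add_comm]
  simpa using h1.intervalIntegral_add_eq a 0

theorem tendsto_ofReal_rpow_top {N η : ℝ → ℝ} {p ts ηs : ℝ} (hp : 1 ≤ p)
    (hη : Tendsto η (𝓝[<] ts) (𝓝[<] ηs)) (hN : Tendsto N (𝓝[<] ηs) atTop) :
    Tendsto (fun t => ENNReal.ofReal (N (η t) ^ (1 / p))) (𝓝[<] ts) (𝓝 ⊤) :=
  ENNReal.tendsto_ofReal_atTop.comp
    ((tendsto_rpow_atTop (by positivity)).comp (hN.comp hη))

theorem tendsto_ofReal_rpow {N η : ℝ → ℝ} {p ts ηs L : ℝ} (hp : 1 ≤ p)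
    (hη : Tendsto η (𝓝[<] ts) (𝓝[<] ηs)) (hN : Tendsto N (𝓝[<] ηs) (𝓝 L)) :
    ∃ L' : ℝ≥0, Tendsto (fun t => ENNReal.ofReal (N (η t) ^ (1 / p))) (𝓝[<] ts)
      (𝓝 (L' : ℝ≥0∞)) :=
  ⟨Real.toNNReal (L ^ (1 / p)), (ENNReal.continuous_ofReal.tendsto _).comp
    ((hN.comp hη).rpow_const (Or.inr (by positivity)))⟩

section Norms

variable {lam kap : ℝ} {u₀ ρ₀ : ℝ → ℝ}

/-- The Jacobian as a function of `(x, η)`. -/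
noncomputable def jacOf (lam kap : ℝ) (u₀ ρ₀ : ℝ → ℝ) (x η : ℝ) : ℝ :=
  1 / Q lam kap u₀ ρ₀ x η ^ (1 / (2 * lam)) / mass lam kap u₀ ρ₀ η

/-- The mean of `∂_η 𝒬 / 𝒬` with respect to the Jacobian. -/
noncomputable def meanRate (lam kap : ℝ) (u₀ ρ₀ : ℝ → ℝ) (η : ℝ) : ℝ :=
  ∫ x in (0 : ℝ)..1, Qη lam kap u₀ ρ₀ x η / Q lam kap u₀ ρ₀ x η * jacOf lam kap u₀ ρ₀ x η

/-- `‖u_x‖_p ^ p` as a function of `η`. -/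
noncomputable def powNormU (lam kap : ℝ) (u₀ ρ₀ : ℝ → ℝ) (p η : ℝ) : ℝ :=
  ∫ x in (0 : ℝ)..1, |1 / (2 * lam) * mass lam kap u₀ ρ₀ η ^ (-(2 * lam)) *
    (meanRate lam kap u₀ ρ₀ η - Qη lam kap u₀ ρ₀ x η / Q lam kap u₀ ρ₀ x η)| ^ p
      * jacOf lam kap u₀ ρ₀ x η

/-- `‖ρ‖_p ^ p` as a function of `η`. -/
noncomputable def powNormR (lam kap : ℝ) (u₀ ρ₀ : ℝ → ℝ) (p η : ℝ) : ℝ :=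
  ∫ x in (0 : ℝ)..1, |ρ₀ x * (mass lam kap u₀ ρ₀ η ^ (-(2 * lam)) / Q lam kap u₀ ρ₀ x η)| ^ p
      * jacOf lam kap u₀ ρ₀ x η

theorem jac_eq_jacOf (hlam : lam ≠ 0) {η E : ℝ → ℝ} {t : ℝ}
    (hE : E t = mass lam kap u₀ ρ₀ (η t) ^ (-(2 * lam)))
    (hm : 0 < mass lam kap u₀ ρ₀ (η t)) (hQ : ∀ x, 0 < Q lam kap u₀ ρ₀ x (η t)) (x : ℝ) :
    jac lam kap u₀ ρ₀ η E x t = jacOf lam kap u₀ ρ₀ x (η t) := by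
  rw [jac, ratio, hE, Real.div_rpow (Real.rpow_nonneg hm.le _) (hQ x).le,
    ← Real.rpow_mul hm.le, show -(2 * lam) * (1 / (2 * lam)) = -1 by field_simp,
    Real.rpow_neg_one, jacOf]
  field_simp

/-- Integrating `J_t = (2λ)⁻¹ (E'/E - E 𝒬_η/𝒬) J` gives zero on the left. So `E'/E` is `E` times the
mean of `𝒬_η/𝒬`, and no derivative of the mass is ever computed. -/
theorem IsClock.deriv_div (h : IsSmoothPeriodicData u₀ ρ₀) (hlam : lam ≠ 0) {W : Set ℝ}
    {η E : ℝ → ℝ} (hc : IsClock lam kap u₀ ρ₀ W η E)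
    (hJ : IsJacobian W (jac lam kap u₀ ρ₀ η E)) {t : ℝ} (htW : t ∈ W)
    (hjac : ∀ x, jac lam kap u₀ ρ₀ η E x t = jacOf lam kap u₀ ρ₀ x (η t)) :
    deriv E t / E t = E t * meanRate lam kap u₀ ρ₀ (η t) := by
  have h1 := hJ.integral_dt htW
  have cJ := hJ.smooth.continuous_slice htW
  have cq : Continuous fun x => Qη lam kap u₀ ρ₀ x (η t) / Q lam kap u₀ ρ₀ x (η t) := by
    have e2 := (h.smooth_c (lam := lam) (kap := kap)).continuous
    have e3 := h.smooth_deriv.continuous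
    refine Continuous.div (by unfold Qη; fun_prop) (by unfold Q; fun_prop) fun x => (hc.Q_pos t htW x).ne'
  have e : ∀ α, dt (jac lam kap u₀ ρ₀ η E) α t = 1 / (2 * lam) * (deriv E t / E t) *
      jac lam kap u₀ ρ₀ η E α t - 1 / (2 * lam) * E t * (Qη lam kap u₀ ρ₀ α (η t) /
      Q lam kap u₀ ρ₀ α (η t) * jac lam kap u₀ ρ₀ η E α t) := fun α => by
    rw [hc.dt_jac htW, logRate]; ring
  rw [intervalIntegral.integral_congr fun α _ => e α, intervalIntegral.integral_sub
      (Continuous.intervalIntegrable (by fun_prop) _ _)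
      (Continuous.intervalIntegrable (by fun_prop) _ _), intervalIntegral.integral_const_mul,
    intervalIntegral.integral_const_mul, hJ.integral t htW] at h1
  rw [meanRate]
  simp_rw [← hjac]
  refine sub_eq_zero.1 ((mul_eq_zero.1 ?_).resolve_left
    (one_div_ne_zero (mul_ne_zero two_ne_zero hlam)))
  linear_combination h1

/-- An arbitrary solution is replaced by the explicit one through the translation result; the flow
then turns its norms into integrals in which time enters only through `η`. -/
theorem norm_solution (h : IsSmoothPeriodicData u₀ ρ₀) (hlam : lam ≠ 0) {W : Set ℝ}
    {η E : ℝ → ℝ} (hc : IsClock lam kap u₀ ρ₀ W η E) {ts : ℝ} (hTW : Ico 0 ts ⊆ W)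
    (h0W : 0 ∈ W) (hη0 : η 0 = 0) (hE0 : E 0 = 1)
    (hint : ∀ t ∈ W, ∫ α in (0 : ℝ)..1, jac lam kap u₀ ρ₀ η E α t = 1)
    (hE : ∀ t, E t = mass lam kap u₀ ρ₀ (η t) ^ (-(2 * lam)))
    {u ρ : ℝ → ℝ → ℝ} (hs : IsSmoothSolution lam kap u₀ ρ₀ ts u ρ) {p : ℝ} (hp : 1 ≤ p)
    {t : ℝ} (ht : t ∈ Ico 0 ts) :
    normLp p (fun x => dx u x t) = ENNReal.ofReal (powNormU lam kap u₀ ρ₀ p (η t) ^ (1 / p)) ∧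
    normLp p (fun x => ρ x t) = ENNReal.ofReal (powNormR lam kap u₀ ρ₀ p (η t) ^ (1 / p)) := by
  obtain ⟨hJ, hsol⟩ := hc.isSmoothSolution h hlam hTW h0W hη0 hE0 hint
  have htW := hTW ht
  obtain ⟨a, ha1, ha2⟩ := hsol.eq_translate hs ht
  set v := IsJacobian.velocity (u₀ 0) (jac lam kap u₀ ρ₀ η E) W with hv
  set σ : ℝ → ℝ → ℝ := fun x t =>
    dens lam kap u₀ ρ₀ η E (flowInv (u₀ 0) (jac lam kap u₀ ρ₀ η E) W x t) t with hσ
  have su : SmoothOn (Ico 0 ts) u := hs.smooth_u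
  have sρ : SmoothOn (Ico 0 ts) ρ := hs.smooth_ρ
  have sv : SmoothOn (Ico 0 ts) v := hsol.smooth_u
  have sσ : SmoothOn (Ico 0 ts) σ := hsol.smooth_ρ
  have hI := uniqueDiffOn_Ico_zero ts
  have hp0 : 0 < p := by linarith
  have hm : 0 < mass lam kap u₀ ρ₀ (η t) := mass_pos h (hc.Q_pos t htW)
  have hjac := jac_eq_jacOf (hE := hE t) hlam hm (hc.Q_pos t htW)
  have cv := (sv.dx hI).continuous_slice ht
  have cσ := sσ.continuous_slice ht
  have pv : Function.Periodic (fun x => dx v x t) 1 := periodic_deriv (hsol.periodic_u t ht)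
  have pσ := hsol.periodic_ρ t ht
  have hmean := hc.deriv_div h hlam hJ htW hjac
  constructor
  · have e1 : normLp p (fun x => dx u x t) = normLp p (fun x => dx v x t) := by
      rw [← normLp_translate ((su.dx hI).continuous_slice ht)
        (periodic_deriv (hs.periodic_u t ht)) hp a]
      simp_rw [ha1]
    rw [e1, normLp_eq cv hp, hJ.integral_comp_flow (u₀ 0) htW
      (h := fun x => |dx v x t| ^ p) (cv.abs.rpow_const fun _ => Or.inr hp0.le)
      (fun x => by simp only [pv x])]
    congr 2
    refine intervalIntegral.integral_congr fun α _ => ?_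
    rw [hv, hJ.dx_velocity_flow _ htW, hc.dt_jac_div htW, hjac, logRate, hmean, ← hE t]
    congr 3
    ring
  · have e1 : normLp p (fun x => ρ x t) = normLp p (fun x => σ x t) := by
      rw [← normLp_translate (sρ.continuous_slice ht) (hs.periodic_ρ t ht) hp a]
      simp_rw [ha2]
      rfl
    rw [e1, normLp_eq cσ hp, hJ.integral_comp_flow (u₀ 0) htW
      (h := fun x => |σ x t| ^ p) (cσ.abs.rpow_const fun _ => Or.inr hp0.le)
      (fun x => by simp only [pσ x])]
    congr 2
    refine intervalIntegral.integral_congr fun α _ => ?_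
    rw [hσ]
    simp only
    rw [hJ.flowInv_flow _ htW, hjac, dens, ratio, ← hE t]

end Norms


/-! ### Behaviour of `𝒬` up to the earliest root -/

/-- A nonnegative function is comparable to the square of the distance at a nondegenerate zero. -/
theorem exists_quadratic_bounds {f : ℝ → ℝ} {x₀ : ℝ} (hf : ∀ᶠ x in 𝓝 x₀, DifferentiableAt ℝ f x)
    (h0 : ∀ x, 0 ≤ f x) (hx₀ : f x₀ = 0) (h1 : deriv f x₀ = 0) (h2 : deriv (deriv f) x₀ ≠ 0) :
    ∃ r > 0, ∃ k > 0, ∃ K > 0, ∀ x, |x - x₀| < r →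
      k * (x - x₀) ^ 2 ≤ f x ∧ f x ≤ K * (x - x₀) ^ 2 := by
  obtain ⟨s, hs, hsf⟩ := Metric.eventually_nhds_iff_ball.1 hf
  set k := deriv (deriv f) x₀ / 2 with hk
  have hk0 : k ≠ 0 := div_ne_zero h2 two_ne_zero
  -- A nonzero value of `deriv` certifies differentiability, its default value being zero. Hence
  -- `f'` has a first-order expansion at `x₀`, which integrates to `f = k (x - x₀)² + o((x - x₀)²)`;
  -- nonnegativity of `f` forces `k > 0`.
  have hd : HasDerivAt (deriv f) (deriv (deriv f) x₀) x₀ :=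
    (differentiableAt_of_deriv_ne_zero h2).hasDerivAt
  have hlo : (fun x => deriv f x - 2 * k * (x - x₀)) =o[𝓝[Metric.ball x₀ s] x₀]
      fun x => (x - x₀) ^ 1 := by
    have := hd.isLittleO
    refine (this.congr (fun x => ?_) (fun x => ?_)).mono nhdsWithin_le_nhds
    · rw [h1, smul_eq_mul, hk]; ring
    · simp
  have hlo2 := Convex.isLittleO_pow_succ_real (f := fun x => f x - k * (x - x₀) ^ 2)
    (convex_ball x₀ s) (Metric.mem_ball_self hs) (fun x hx => by
      have e1 := (hsf x hx).hasDerivAt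
      have e2 := (((hasDerivAt_id x).sub_const x₀).pow 2).const_mul k
      exact ((e1.sub e2).congr_deriv (by simp; ring)).hasDerivWithinAt) hlo
  rw [nhdsWithin_eq_nhds.2 (Metric.ball_mem_nhds x₀ hs)] at hlo2
  have hev := hlo2.def (show 0 < |k| / 2 by positivity)
  obtain ⟨r, hr, hrf⟩ := Metric.eventually_nhds_iff.1 hev
  have key : ∀ x, |x - x₀| < r → |f x - k * (x - x₀) ^ 2| ≤ |k| / 2 * (x - x₀) ^ 2 := by
    intro x hx
    have := hrf (y := x) (by rwa [Real.dist_eq])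
    simpa [hx₀, abs_of_nonneg (sq_nonneg (x - x₀))] using this
  have hkpos : 0 < k := by
    by_contra hneg
    have hneg : k < 0 := lt_of_le_of_ne (not_lt.1 hneg) hk0
    have := (abs_le.1 (key (x₀ + r / 2) (by
      rw [add_sub_cancel_left, abs_of_pos (by positivity)]; linarith))).2
    rw [abs_of_neg hneg, add_sub_cancel_left] at this
    have hr2 : 0 < (r / 2) ^ 2 := by positivity
    nlinarith [h0 (x₀ + r / 2)]
  refine ⟨r, hr, k / 2, by positivity, 3 / 2 * k, by positivity, fun x hx => ?_⟩
  have := abs_le.1 (key x hx)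
  rw [abs_of_pos hkpos] at this
  constructor <;> linarith [this.1, this.2]

theorem periodic_fract {f : ℝ → ℝ} (hf : Function.Periodic f 1) (x : ℝ) : f (Int.fract x) = f x := by
  have h := hf.sub_zsmul_eq (x := x) ⌊x⌋
  simp only [zsmul_eq_mul, mul_one] at h
  exact h

theorem periodic_exists_bound {f : ℝ → ℝ} (hf : Function.Periodic f 1) (hc : Continuous f) :
    ∃ M, 0 < M ∧ ∀ x, |f x| ≤ M := by
  obtain ⟨M, hM⟩ := (isCompact_Icc (a := (0 : ℝ)) (b := 1)).exists_bound_of_continuousOn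
    hc.continuousOn
  refine ⟨max M 1, by positivity, fun x => ?_⟩
  rw [← periodic_fract hf]
  exact (hM _ ⟨Int.fract_nonneg x, (Int.fract_lt_one x).le⟩).trans (le_max_left _ _)

theorem periodic_exists_pos_le {f : ℝ → ℝ} (hf : Function.Periodic f 1) (hc : Continuous f)
    (hpos : ∀ x, 0 < f x) : ∃ m, 0 < m ∧ ∀ x, m ≤ f x := by
  obtain ⟨y, -, hy⟩ := (isCompact_Icc (a := (0 : ℝ)) (b := 1)).exists_isMinOn
    (nonempty_Icc.2 zero_le_one) hc.continuousOn
  refine ⟨f y, hpos y, fun x => ?_⟩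
  rw [← periodic_fract hf x]
  exact hy ⟨Int.fract_nonneg x, (Int.fract_lt_one x).le⟩

/-! ### Factorisation of `Q` and its vanishing factor -/

section Profile

variable {lam kap : ℝ} {u₀ ρ₀ : ℝ → ℝ} {ηs : ℝ}

/-- The larger reciprocal root of `𝒬 (x, ·)`. -/
noncomputable def rootP (lam kap : ℝ) (u₀ ρ₀ : ℝ → ℝ) (x : ℝ) : ℝ :=
  lam * deriv u₀ x + √(lam * kap) * |ρ₀ x|

/-- The smaller reciprocal root of `𝒬 (x, ·)`. -/
noncomputable def rootM (lam kap : ℝ) (u₀ ρ₀ : ℝ → ℝ) (x : ℝ) : ℝ :=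
  lam * deriv u₀ x - √(lam * kap) * |ρ₀ x|

theorem Q_eq_mul (hlk : 0 < lam * kap) (x η : ℝ) : Q lam kap u₀ ρ₀ x η =
    (1 - η * rootP lam kap u₀ ρ₀ x) * (1 - η * rootM lam kap u₀ ρ₀ x) := by
  have h1 := Real.sq_sqrt hlk.le
  have h2 := sq_abs (ρ₀ x)
  simp only [Q, c, rootP, rootM]
  linear_combination η ^ 2 * |ρ₀ x| ^ 2 * h1 + η ^ 2 * lam * kap * h2

theorem Qη_eq (hlk : 0 < lam * kap) (x η : ℝ) : Qη lam kap u₀ ρ₀ x η =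
    -rootP lam kap u₀ ρ₀ x * (1 - η * rootM lam kap u₀ ρ₀ x)
      - rootM lam kap u₀ ρ₀ x * (1 - η * rootP lam kap u₀ ρ₀ x) := by
  have h1 := Real.sq_sqrt hlk.le
  have h2 := sq_abs (ρ₀ x)
  simp only [Qη, c, rootP, rootM]
  linear_combination 2 * η * |ρ₀ x| ^ 2 * h1 + 2 * η * lam * kap * h2

theorem rootM_le_rootP (x : ℝ) : rootM lam kap u₀ ρ₀ x ≤ rootP lam kap u₀ ρ₀ x := by
  have := mul_nonneg (Real.sqrt_nonneg (lam * kap)) (abs_nonneg (ρ₀ x))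
  simp only [rootM, rootP]; linarith

theorem sqrt_ratio (hlk : 0 < lam * kap) : |lam| * √(kap / lam) = √(lam * kap) := by
  have hlam : lam ≠ 0 := fun h => by simp [h] at hlk
  rw [← Real.sqrt_sq_eq_abs, ← Real.sqrt_mul (sq_nonneg lam)]
  congr 1
  field_simp

theorem rootP_eq_gPlus (hlk : 0 < lam * kap) (hlam : 0 < lam) :
    rootP lam kap u₀ ρ₀ = fun x => lam * gPlus lam kap u₀ ρ₀ x := by
  funext x
  rw [rootP, gPlus, ← sqrt_ratio hlk, abs_of_pos hlam]; ring

/-- Multiplication by a negative `λ` exchanges the two signs; this is why admissibility refers to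
`gMinus` for `λ < 0` and to `gPlus` for `λ > 0`. -/
theorem rootP_eq_gMinus (hlk : 0 < lam * kap) (hlam : lam < 0) :
    rootP lam kap u₀ ρ₀ = fun x => lam * gMinus lam kap u₀ ρ₀ x := by
  funext x
  rw [rootP, gMinus, ← sqrt_ratio hlk, abs_of_neg hlam]; ring

namespace IsSmoothPeriodicData

variable (h : IsSmoothPeriodicData u₀ ρ₀)
include h

theorem continuous_rootP : Continuous (rootP lam kap u₀ ρ₀) := by
  have h1 := h.smooth_deriv.continuous
  have h2 := h.smooth_ρ.continuous
  unfold rootP; fun_prop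

theorem continuous_rootM : Continuous (rootM lam kap u₀ ρ₀) := by
  have h1 := h.smooth_deriv.continuous
  have h2 := h.smooth_ρ.continuous
  unfold rootM; fun_prop

theorem periodic_rootP : Function.Periodic (rootP lam kap u₀ ρ₀) 1 := fun x => by
  simp only [rootP, h.periodic_deriv x, h.periodic_ρ x]

theorem periodic_rootM : Function.Periodic (rootM lam kap u₀ ρ₀) 1 := fun x => by
  simp only [rootM, h.periodic_deriv x, h.periodic_ρ x]

theorem periodic_Qη (η : ℝ) : Function.Periodic (fun x => Qη lam kap u₀ ρ₀ x η) 1 := fun x => by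
  simp only [Qη, c, h.periodic_deriv x, h.periodic_ρ x]

theorem continuous_Q (η : ℝ) : Continuous fun x => Q lam kap u₀ ρ₀ x η := by
  have h1 := (h.smooth_c (lam := lam) (kap := kap)).continuous
  have h2 := h.smooth_deriv.continuous
  unfold Q; fun_prop

theorem continuous_Qη : Continuous fun q : ℝ × ℝ => Qη lam kap u₀ ρ₀ q.1 q.2 := by
  have h1 := (h.smooth_c (lam := lam) (kap := kap)).continuous
  have h2 := h.smooth_deriv.continuous
  unfold Qη; fun_prop

end IsSmoothPeriodicData

/-- The factor of `𝒬 (·, ηs)` that vanishes. -/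
noncomputable def profile (lam kap : ℝ) (u₀ ρ₀ : ℝ → ℝ) (ηs x : ℝ) : ℝ :=
  1 - ηs * rootP lam kap u₀ ρ₀ x

namespace IsEarliestSimpleRoot

variable (hr : IsEarliestSimpleRoot lam kap u₀ ρ₀ ηs) (h : IsSmoothPeriodicData u₀ ρ₀)
  (hlk : 0 < lam * kap)
include hr

theorem pos : 0 < ηs := hr.earliest.1.1

include h

theorem Q_pos {η : ℝ} (hη : η ∈ Ico 0 ηs) (x : ℝ) : 0 < Q lam kap u₀ ρ₀ x η := by
  rw [← periodic_fract (h.periodic_Q η) x]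
  set y := Int.fract x
  have hy : y ∈ Icc (0 : ℝ) 1 := ⟨Int.fract_nonneg x, (Int.fract_lt_one x).le⟩
  by_contra hneg
  have hc : ContinuousOn (fun η => Q lam kap u₀ ρ₀ y η) (Icc 0 η) := fun e _ =>
    (hasDerivAt_Q y e).continuousAt.continuousWithinAt
  obtain ⟨e, he, hQ⟩ := intermediate_value_Icc' hη.1 hc (show (0 : ℝ) ∈ Icc _ _ from
    ⟨not_lt.1 hneg, by rw [Q_zero]; exact zero_le_one⟩)
  have he0 : 0 < e := lt_of_le_of_ne he.1 (by
    rintro rfl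
    simp [Q_zero] at hQ)
  have := hr.earliest.2 ⟨he0, y, hy, hQ⟩
  linarith [he.2, hη.2]

include hlk

theorem exists_Q_pos :
    ∃ δ > 0, ∀ η ∈ Ioo (-δ) ηs, ∀ x, 0 < Q lam kap u₀ ρ₀ x η := by
  obtain ⟨M, hM, hMb⟩ := periodic_exists_bound (h.periodic_rootP (lam := lam) (kap := kap))
    h.continuous_rootP
  obtain ⟨N, hN, hNb⟩ := periodic_exists_bound (h.periodic_rootM (lam := lam) (kap := kap))
    h.continuous_rootM
  -- For negative `η` with `|η| (M + N) < 1` both linear factors are positive.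
  refine ⟨1 / (M + N), by positivity, fun η hη x => ?_⟩
  rcases le_or_gt 0 η with h0 | h0
  · exact hr.Q_pos h ⟨h0, hη.2⟩ x
  · have e : -η * (M + N) < 1 := by
      rw [← lt_div_iff₀ (by positivity)]; linarith [hη.1]
    have hMx := abs_le.1 (hMb x)
    have hNx := abs_le.1 (hNb x)
    rw [Q_eq_mul hlk]
    refine mul_pos ?_ ?_
    · nlinarith [hMx.1]
    · nlinarith [hNx.1]

/-- A negative value would put the root `1 / rootP` before `ηs`, against minimality. -/
theorem profile_nonneg (x : ℝ) : 0 ≤ profile lam kap u₀ ρ₀ ηs x := by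
  by_contra hneg
  have h1 : 1 < ηs * rootP lam kap u₀ ρ₀ x := by
    rw [profile] at hneg; linarith
  have ha : 0 < rootP lam kap u₀ ρ₀ x := pos_of_mul_pos_right (zero_lt_one.trans h1) hr.pos.le
  have hlt : 1 / rootP lam kap u₀ ρ₀ x < ηs := by rwa [div_lt_iff₀ ha]
  have := hr.Q_pos h ⟨(by positivity : 0 ≤ 1 / rootP lam kap u₀ ρ₀ x), hlt⟩ x
  rw [Q_eq_mul hlk, one_div_mul_cancel ha.ne'] at this
  simp at this

theorem profile_le (x : ℝ) :
    profile lam kap u₀ ρ₀ ηs x ≤ 1 - ηs * rootM lam kap u₀ ρ₀ x := by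
  have := mul_le_mul_of_nonneg_left (rootM_le_rootP (lam := lam) (kap := kap) (u₀ := u₀)
    (ρ₀ := ρ₀) x) hr.pos.le
  rw [profile]; linarith

theorem Qη_ne_zero {x : ℝ} (hx : Q lam kap u₀ ρ₀ x ηs = 0) : Qη lam kap u₀ ρ₀ x ηs ≠ 0 := by
  rw [← periodic_fract (h.periodic_Q ηs)] at hx
  rw [← periodic_fract (h.periodic_Qη ηs)]
  have := hr.simple _ ⟨Int.fract_nonneg x, (Int.fract_lt_one x).le⟩ hx
  rwa [(hasDerivAt_Q _ _).deriv] at this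

/-- Since the profile lies between zero and this factor, a zero here makes both factors vanish and
the root double, which simplicity excludes. -/
theorem coprofile_pos (x : ℝ) : 0 < 1 - ηs * rootM lam kap u₀ ρ₀ x := by
  have h1 := hr.profile_nonneg h hlk x
  have h2 := hr.profile_le h hlk x
  refine lt_of_le_of_ne (h1.trans h2) fun he => ?_
  have hf : 1 - ηs * rootP lam kap u₀ ρ₀ x = 0 := le_antisymm (by rw [he]; exact h2) h1
  have := hr.Qη_ne_zero h hlk (x := x) (by rw [Q_eq_mul hlk, hf, zero_mul])
  rw [Qη_eq hlk, hf, ← he] at this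
  simp at this

theorem Q_eq_zero_iff (x : ℝ) :
    Q lam kap u₀ ρ₀ x ηs = 0 ↔ profile lam kap u₀ ρ₀ ηs x = 0 := by
  rw [Q_eq_mul hlk, mul_eq_zero, profile]
  exact or_iff_left (hr.coprofile_pos h hlk x).ne'

/-- Each linear factor at `η = s ηs` is the convex combination of `1` and its value at `ηs`, with
weights `1 - s` and `s`. So the first is comparable to `(ηs - η) + profile`, and the second stays
between positive constants. -/
theorem exists_Q_bounds : ∃ k > 0, ∃ K > 0, ∀ η ∈ Ico 0 ηs, ∀ x,
    k * ((ηs - η) + profile lam kap u₀ ρ₀ ηs x) ≤ Q lam kap u₀ ρ₀ x η ∧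
    Q lam kap u₀ ρ₀ x η ≤ K * ((ηs - η) + profile lam kap u₀ ρ₀ ηs x) := by
  have hηs := hr.pos
  obtain ⟨M, hM, hMb⟩ := periodic_exists_bound (h.periodic_rootP (lam := lam) (kap := kap))
    h.continuous_rootP
  obtain ⟨N, hN, hNb⟩ := periodic_exists_bound (h.periodic_rootM (lam := lam) (kap := kap))
    h.continuous_rootM
  obtain ⟨m, hm, hmb⟩ := periodic_exists_pos_le (f := fun x => 1 - ηs * rootM lam kap u₀ ρ₀ x)
    (fun x => by simp only [h.periodic_rootM x])
    (continuous_const.sub (continuous_const.mul h.continuous_rootM)) (hr.coprofile_pos h hlk)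
  set F := 1 + ηs * M with hF
  refine ⟨min 1 m * (1 / (2 * (1 + F)) * min (1 / ηs) 1), by positivity,
    (1 + ηs * N) * (1 + 1 / ηs), by positivity, fun η hη x => ?_⟩
  set f := profile lam kap u₀ ρ₀ ηs x with hf
  have hf0 : 0 ≤ f := hr.profile_nonneg h hlk x
  have hfF : f ≤ F := by
    have := (abs_le.1 (hMb x)).1
    rw [hf, profile]; nlinarith
  set s := η / ηs with hs
  have hs0 : 0 ≤ s := div_nonneg hη.1 hηs.le
  have hs1 : s < 1 := (div_lt_one hηs).2 hη.2
  have hηe : η = s * ηs := by rw [hs]; field_simp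
  have hP : 1 - η * rootP lam kap u₀ ρ₀ x = (1 - s) + s * f := by
    rw [hf, profile, hηe]; ring
  have hP2 : 1 - η * rootM lam kap u₀ ρ₀ x
      = (1 - s) + s * (1 - ηs * rootM lam kap u₀ ρ₀ x) := by
    rw [hηe]; ring
  have hε : ηs - η = ηs * (1 - s) := by rw [hηe]; ring
  have lowM : min 1 m ≤ 1 - η * rootM lam kap u₀ ρ₀ x := by
    rw [hP2]
    have e1 : min 1 m ≤ 1 := min_le_left _ _
    have e2 : min 1 m ≤ 1 - ηs * rootM lam kap u₀ ρ₀ x := (min_le_right _ _).trans (hmb x)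
    nlinarith
  have upM : 1 - η * rootM lam kap u₀ ρ₀ x ≤ 1 + ηs * N := by
    have := (abs_le.1 (hNb x)).1
    nlinarith [hη.1, hη.2]
  have hmin : min (1 / ηs) 1 * ((ηs - η) + f) ≤ (1 - s) + f := by
    have e1 : min (1 / ηs) 1 ≤ 1 / ηs := min_le_left _ _
    have e2 : min (1 / ηs) 1 ≤ 1 := min_le_right _ _
    have e3 : 1 / ηs * (ηs - η) = 1 - s := by rw [hε]; field_simp
    have := mul_le_mul_of_nonneg_right e1 (sub_nonneg.2 hη.2.le)
    have := mul_le_mul_of_nonneg_right e2 hf0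
    nlinarith
  have lowP : 1 / (2 * (1 + F)) * ((1 - s) + f) ≤ (1 - s) + s * f := by
    rw [one_div_mul_eq_div, div_le_iff₀ (by positivity)]
    have hF0 : 0 ≤ F := hf0.trans hfF
    -- For small `s` the term `1 - s` alone dominates the bounded profile; for large `s` at least
    -- half of the profile survives.
    rcases le_total s (1 / 2) with hs2 | hs2
    · nlinarith [mul_nonneg hs0 hf0, mul_nonneg (mul_nonneg hs0 hf0) hF0]
    · nlinarith [mul_nonneg hs0 hf0, mul_nonneg (mul_nonneg hs0 hf0) hF0,
        mul_nonneg (sub_nonneg.2 hs2) hf0, mul_nonneg hF0 (sub_nonneg.2 hs1.le)]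
  have upP : (1 - s) + s * f ≤ (1 + 1 / ηs) * ((ηs - η) + f) := by
    have e3 : 1 / ηs * (ηs - η) = 1 - s := by rw [hε]; field_simp
    have e4 : 0 ≤ 1 / ηs * f := by positivity
    nlinarith [hη.2, mul_nonneg (sub_nonneg.2 hs1.le) hf0]
  have hP0 : 0 ≤ (1 - s) + s * f := by nlinarith [mul_nonneg hs0 hf0]
  have hM0 : 0 ≤ min 1 m := by positivity
  rw [Q_eq_mul hlk, hP]
  constructor
  · have h1 : 1 / (2 * (1 + F)) * min (1 / ηs) 1 * ((ηs - η) + f) ≤ (1 - s) + s * f := by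
      refine le_trans ?_ lowP
      rw [mul_assoc]
      exact mul_le_mul_of_nonneg_left hmin (by positivity)
    calc min 1 m * (1 / (2 * (1 + F)) * min (1 / ηs) 1) * ((ηs - η) + f)
        = (1 / (2 * (1 + F)) * min (1 / ηs) 1 * ((ηs - η) + f)) * min 1 m := by ring
      _ ≤ _ := mul_le_mul h1 lowM hM0 hP0
  · calc ((1 - s) + s * f) * (1 - η * rootM lam kap u₀ ρ₀ x)
        ≤ ((1 + 1 / ηs) * ((ηs - η) + f)) * (1 + ηs * N) :=
          mul_le_mul upP upM (hM0.trans lowM) (hP0.trans upP)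
      _ = _ := by ring

theorem ρ_ne_zero {x : ℝ} (hx : profile lam kap u₀ ρ₀ ηs x = 0) : ρ₀ x ≠ 0 := by
  intro h0
  have h1 := hr.coprofile_pos h hlk x
  simp only [profile, rootP, rootM, h0, abs_zero, mul_zero, add_zero, sub_zero] at hx h1
  linarith

theorem profile_quadratic {x₀ : ℝ} (hx₀ : x₀ ∈ Icc (0 : ℝ) 1)
    (hx : profile lam kap u₀ ρ₀ ηs x₀ = 0) :
    ∃ r > 0, ∃ k > 0, ∃ K > 0, ∀ x, |x - x₀| < r →
      k * (x - x₀) ^ 2 ≤ profile lam kap u₀ ρ₀ ηs x ∧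
      profile lam kap u₀ ρ₀ ηs x ≤ K * (x - x₀) ^ 2 := by
  have hQ := (hr.Q_eq_zero_iff h hlk x₀).2 hx
  have hlam : lam ≠ 0 := fun h => by simp [h] at hlk
  obtain ⟨g, hg, hg1, hg2⟩ : ∃ g : ℝ → ℝ, rootP lam kap u₀ ρ₀ = (fun x => lam * g x) ∧
      deriv g x₀ = 0 ∧ deriv (deriv g) x₀ ≠ 0 := by
    rcases lt_or_gt_of_ne hlam with hl | hl
    · exact ⟨_, rootP_eq_gMinus hlk hl, hr.nondeg_neg hl x₀ hx₀ hQ⟩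
    · exact ⟨_, rootP_eq_gPlus hlk hl, hr.nondeg_pos hl x₀ hx₀ hQ⟩
  have hpr : profile lam kap u₀ ρ₀ ηs = fun x => 1 - (ηs * lam) * g x := by
    funext x
    rw [profile, hg]; ring
  have hd : deriv (profile lam kap u₀ ρ₀ ηs) = fun x => -((ηs * lam) * deriv g x) := by
    funext x
    rw [hpr, deriv_const_sub, deriv_const_mul_field]
  refine exists_quadratic_bounds ?_ (hr.profile_nonneg h hlk) hx ?_ ?_
  · have hne : ∀ᶠ x in 𝓝 x₀, ρ₀ x ≠ 0 :=
      h.smooth_ρ.continuous.continuousAt.eventually_ne (hr.ρ_ne_zero h hlk hx)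
    filter_upwards [hne] with x hx
    have h1 : DifferentiableAt ℝ (deriv u₀) x := h.smooth_deriv.differentiable (by simp) x
    have h2 : DifferentiableAt ℝ (fun x => |ρ₀ x|) x :=
      (h.smooth_ρ.differentiable (by simp) x).abs hx
    unfold profile rootP
    fun_prop
  · rw [hd]; simp [hg1]
  · rw [hd, deriv.fun_neg, deriv_const_mul_field]
    exact neg_ne_zero.2 (mul_ne_zero (mul_ne_zero hr.pos.ne' hlam) hg2)

theorem continuous_profile : Continuous (profile lam kap u₀ ρ₀ ηs) :=
  continuous_const.sub (continuous_const.mul h.continuous_rootP)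

theorem profile_quadratic_lower {x₀ : ℝ} (hx₀ : x₀ ∈ Icc (0 : ℝ) 1) :
    ∃ r > 0, ∃ k > 0, ∀ x, |x - x₀| < r → k * (x - x₀) ^ 2 ≤ profile lam kap u₀ ρ₀ ηs x := by
  rcases (hr.profile_nonneg h hlk x₀).eq_or_lt with h0 | h0
  · obtain ⟨r, hr, k, hk, K, -, hb⟩ := hr.profile_quadratic h hlk hx₀ h0.symm
    exact ⟨r, hr, k, hk, fun x hx => (hb x hx).1⟩
  · have hc := hr.continuous_profile h hlk
    have := hc.continuousAt.eventually_const_lt (half_lt_self h0)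
    obtain ⟨r, hr', hb⟩ := Metric.eventually_nhds_iff.1 this
    refine ⟨min r 1, by positivity, profile lam kap u₀ ρ₀ ηs x₀ / 2, by positivity, fun x hx => ?_⟩
    have h1 := hb (y := x) (by rw [Real.dist_eq]; exact hx.trans_le (min_le_left _ _))
    have h2 : (x - x₀) ^ 2 ≤ 1 := by
      rw [← sq_abs]
      exact pow_le_one₀ (abs_nonneg _) (hx.le.trans (min_le_right _ _))
    nlinarith

/-- There is a zero of the profile in `[0, 1)`. -/
theorem exists_zero : ∃ x₀ ∈ Ico (0 : ℝ) 1, profile lam kap u₀ ρ₀ ηs x₀ = 0 := by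
  obtain ⟨-, x, -, hx⟩ := hr.earliest.1
  refine ⟨Int.fract x, ⟨Int.fract_nonneg x, Int.fract_lt_one x⟩, ?_⟩
  rw [← hr.Q_eq_zero_iff h hlk, periodic_fract (h.periodic_Q ηs), hx]

theorem Qη_neg {x : ℝ} (hx : profile lam kap u₀ ρ₀ ηs x = 0) : Qη lam kap u₀ ρ₀ x ηs < 0 := by
  have h1 := hr.coprofile_pos h hlk x
  rw [profile] at hx
  rw [Qη_eq hlk, hx, mul_zero, sub_zero]
  have : 0 < rootP lam kap u₀ ρ₀ x :=
    pos_of_mul_pos_right (a := ηs) (by linarith) hr.pos.le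
  nlinarith

end IsEarliestSimpleRoot

end Profile


/-! ### Integrals up to the earliest root -/

theorem intervalIntegrable_abs_sub_rpow {s : ℝ} (hs : -1 < s) (x₀ a b : ℝ) :
    IntervalIntegrable (fun x => |x - x₀| ^ s) volume a b := by
  have h : ∀ a b : ℝ, IntervalIntegrable (fun x => |x| ^ s) volume a b := fun a b => by
    refine intervalIntegrable_of_even (fun x => by simp) (fun x hx => ?_)
    refine (intervalIntegral.intervalIntegrable_rpow' (r := s) hs).congr ?_
    intro y hy
    rw [uIoc_of_le hx.le] at hy
    simp [abs_of_pos hy.1]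
  have := (h (a - x₀) (b - x₀)).comp_sub_right x₀
  simpa using this

/-- Locally `f^(-a)` is bounded by a multiple of `|x - x₀|^(-2a)`, integrable because `2a < 1`;
compactness globalises. The same bound isolates the points where `f ≤ 0`, so they form a null set.
-/
theorem integrableOn_rpow_neg_of_quadratic {f : ℝ → ℝ} (hf : Continuous f)
    (hq : ∀ x₀ ∈ Icc (0 : ℝ) 1, ∃ r > 0, ∃ k > 0, ∀ x, |x - x₀| < r → k * (x - x₀) ^ 2 ≤ f x)
    {a : ℝ} (ha0 : 0 ≤ a) (ha : a < 1 / 2) :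
    IntegrableOn (fun x => f x ^ (-a)) (Icc 0 1) ∧ volume (Icc (0 : ℝ) 1 ∩ {x | f x ≤ 0}) = 0 := by
  refine isCompact_Icc.induction_on
    (p := fun s => IntegrableOn (fun x => f x ^ (-a)) s ∧ volume (s ∩ {x | f x ≤ 0}) = 0)
    ?_ ?_ ?_ ?_
  · simp
  · exact fun s t hst ht => ⟨ht.1.mono_set hst, measure_mono_null (inter_subset_inter_left _ hst) ht.2⟩
  · exact fun s t hs ht => ⟨hs.1.union ht.1, by
      rw [union_inter_distrib_right]; exact measure_union_null hs.2 ht.2⟩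
  · intro x₀ hx₀
    obtain ⟨r, hr, k, hk, hb⟩ := hq x₀ hx₀
    have hpos : ∀ x, |x - x₀| < r → x ≠ x₀ → 0 < k * (x - x₀) ^ 2 := fun x _ hx => by
      have := sub_ne_zero.2 hx
      positivity
    refine ⟨Ioo (x₀ - r) (x₀ + r), mem_nhdsWithin_of_mem_nhds
      (Ioo_mem_nhds (by linarith) (by linarith)), ?_, ?_⟩
    · have hint : IntegrableOn (fun x => k ^ (-a) * |x - x₀| ^ (-(2 * a)))
          (Ioo (x₀ - r) (x₀ + r)) := by
        refine IntegrableOn.mono_set (t := Ioc (x₀ - r) (x₀ + r)) ?_ Ioo_subset_Ioc_self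
        rw [← intervalIntegrable_iff_integrableOn_Ioc_of_le (by linarith)]
        exact (intervalIntegrable_abs_sub_rpow (by linarith) x₀ _ _).const_mul _
      refine Integrable.mono' hint (hf.measurable.pow_const _).aestronglyMeasurable ?_
      have hne : ∀ᵐ x ∂(volume.restrict (Ioo (x₀ - r) (x₀ + r))), x ≠ x₀ :=
        ae_restrict_of_ae (by simp [ae_iff])
      filter_upwards [hne, ae_restrict_mem measurableSet_Ioo] with x hx hxm
      have hxr : |x - x₀| < r := abs_lt.2 ⟨by linarith [hxm.1], by linarith [hxm.2]⟩
      have hp := hpos x hxr hx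
      have h1 := Real.rpow_le_rpow_of_nonpos hp (hb x hxr) (neg_nonpos.2 ha0)
      rw [Real.norm_eq_abs, abs_of_nonneg (Real.rpow_nonneg (hp.le.trans (hb x hxr)) _)]
      refine h1.trans (le_of_eq ?_)
      rw [Real.mul_rpow hk.le (sq_nonneg _), ← sq_abs, ← Real.rpow_natCast,
        ← Real.rpow_mul (abs_nonneg _)]
      norm_num
    · refine measure_mono_null (t := {x₀}) ?_ (by simp)
      rintro x ⟨hxm, hx⟩
      by_contra hne
      have hxr : |x - x₀| < r := abs_lt.2 ⟨by linarith [hxm.1], by linarith [hxm.2]⟩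
      have := (hpos x hxr hne).trans_le (hb x hxr)
      exact absurd hx (not_le.2 this)

section

variable {lam kap : ℝ} {u₀ ρ₀ : ℝ → ℝ} {ηs : ℝ}

namespace IsEarliestSimpleRoot

variable (hr : IsEarliestSimpleRoot lam kap u₀ ρ₀ ηs) (h : IsSmoothPeriodicData u₀ ρ₀)
  (hlk : 0 < lam * kap)
include hr h hlk

theorem profile_rpow_integrable {a : ℝ} (ha0 : 0 ≤ a) (ha : a < 1 / 2) :
    IntervalIntegrable (fun x => profile lam kap u₀ ρ₀ ηs x ^ (-a)) volume 0 1 := by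
  rw [intervalIntegrable_iff_integrableOn_Icc_of_le zero_le_one]
  exact (integrableOn_rpow_neg_of_quadratic (hr.continuous_profile h hlk)
    (fun x hx => hr.profile_quadratic_lower h hlk hx) ha0 ha).1

theorem profile_pos_ae : ∀ᵐ x, x ∈ Icc (0 : ℝ) 1 → 0 < profile lam kap u₀ ρ₀ ηs x := by
  have := (integrableOn_rpow_neg_of_quadratic (hr.continuous_profile h hlk)
    (fun x hx => hr.profile_quadratic_lower h hlk hx) le_rfl (by norm_num : (0 : ℝ) < 1 / 2)).2
  rw [ae_iff]
  refine measure_mono_null (fun x hx => ?_) this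
  simp only [mem_ofPred_eq, Classical.not_imp, not_lt] at hx
  exact hx

/-- Dominated convergence as `η ↗ ηs`. -/
theorem tendsto_integral {G : ℝ → ℝ → ℝ} {g : ℝ → ℝ} {a C : ℝ} (ha0 : 0 ≤ a) (ha : a < 1 / 2)
    (hC : 0 ≤ C) (hc : ∀ η ∈ Ico 0 ηs, Continuous fun x => G x η)
    (hb : ∀ᶠ η in 𝓝[<] ηs, ∀ x, |G x η| ≤ C * Q lam kap u₀ ρ₀ x η ^ (-a))
    (hl : ∀ x, 0 < profile lam kap u₀ ρ₀ ηs x → Tendsto (G x) (𝓝[<] ηs) (𝓝 (g x))) :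
    Tendsto (fun η => ∫ x in (0 : ℝ)..1, G x η) (𝓝[<] ηs) (𝓝 (∫ x in (0 : ℝ)..1, g x)) := by
  obtain ⟨k, hk, K, -, hQ⟩ := hr.exists_Q_bounds h hlk
  have hev : ∀ᶠ η in 𝓝[<] ηs, η ∈ Ico 0 ηs := by
    filter_upwards [Ioo_mem_nhdsLT hr.pos] with η hη using ⟨hη.1.le, hη.2⟩
  have hae := hr.profile_pos_ae h hlk
  have hsub : ∀ x : ℝ, x ∈ uIoc (0 : ℝ) 1 → x ∈ Icc (0 : ℝ) 1 := fun x hx => by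
    rw [uIoc_of_le zero_le_one] at hx
    exact Ioc_subset_Icc_self hx
  refine intervalIntegral.tendsto_integral_filter_of_dominated_convergence
    (fun x => C * k ^ (-a) * profile lam kap u₀ ρ₀ ηs x ^ (-a)) ?_ ?_ ?_ ?_
  · filter_upwards [hev] with η hη using (hc η hη).aestronglyMeasurable
  · filter_upwards [hev, hb] with η hη hbη
    filter_upwards [hae] with x hx hxm
    have hf := hx (hsub x hxm)
    refine (hbη x).trans ?_
    rw [mul_assoc, ← Real.mul_rpow hk.le hf.le]
    refine mul_le_mul_of_nonneg_left (Real.rpow_le_rpow_of_nonpos (mul_pos hk hf) ?_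
      (neg_nonpos.2 ha0)) hC
    refine le_trans ?_ (hQ η hη x).1
    exact mul_le_mul_of_nonneg_left (by linarith [hη.2]) hk.le
  · exact (hr.profile_rpow_integrable h hlk ha0 ha).const_mul _
  · filter_upwards [hae] with x hx hxm using hl x (hx (hsub x hxm))

theorem Q_le : ∃ K > 0, ∀ η ∈ Ico 0 ηs, ∀ x, Q lam kap u₀ ρ₀ x η ≤ K := by
  obtain ⟨k, hk, K, hK, hQ⟩ := hr.exists_Q_bounds h hlk
  obtain ⟨M, hM, hMb⟩ := periodic_exists_bound (f := profile lam kap u₀ ρ₀ ηs)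
    (fun x => by simp only [profile, h.periodic_rootP x]) (hr.continuous_profile h hlk)
  have := hr.pos
  refine ⟨K * (ηs + M), by positivity, fun η hη x => (hQ η hη x).2.trans ?_⟩
  refine mul_le_mul_of_nonneg_left ?_ hK.le
  linarith [hη.1, (abs_le.1 (hMb x)).2]

theorem Qη_le : ∃ M > 0, ∀ η ∈ Icc 0 ηs, ∀ x, |Qη lam kap u₀ ρ₀ x η| ≤ M := by
  obtain ⟨M, hM⟩ := ((isCompact_Icc (a := (0 : ℝ)) (b := 1)).prod
    (isCompact_Icc (a := (0 : ℝ)) (b := ηs))).exists_bound_of_continuousOn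
    (h.continuous_Qη (lam := lam) (kap := kap)).continuousOn
  refine ⟨max M 1, by positivity, fun η hη x => ?_⟩
  rw [← periodic_fract (h.periodic_Qη η)]
  exact (hM (Int.fract x, η) ⟨⟨Int.fract_nonneg x, (Int.fract_lt_one x).le⟩, hη⟩).trans
    (le_max_left _ _)

/-! ### Bounds on the mass and finiteness of the final time -/

theorem mass_pos {η : ℝ} (hη : η ∈ Ico 0 ηs) : 0 < mass lam kap u₀ ρ₀ η :=
  GHS.mass_pos h (hr.Q_pos h hη)

theorem continuous_weight {η : ℝ} (hη : η ∈ Ico 0 ηs) :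
    Continuous fun x => 1 / Q lam kap u₀ ρ₀ x η ^ (1 / (2 * lam)) :=
  continuous_const.div ((h.continuous_Q η).rpow_const fun x => Or.inl (hr.Q_pos h hη x).ne')
    fun x => (Real.rpow_pos_of_pos (hr.Q_pos h hη x) _).ne'

/-- Growth of the mass when `λ > 0`. -/
theorem mass_le_of_pos (hlam : 0 < lam) {θ : ℝ} (h0 : 0 ≤ θ) (h1 : θ ≤ 1)
    (hθ : (1 - θ) * (1 / (2 * lam)) < 1 / 2) :
    ∃ C > 0, ∀ η ∈ Ico 0 ηs,
      mass lam kap u₀ ρ₀ η ≤ C * (ηs - η) ^ (-(θ * (1 / (2 * lam)))) := by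
  obtain ⟨k, hk, K, hK, hQ⟩ := hr.exists_Q_bounds h hlk
  set m := 1 / (2 * lam) with hm
  have hm0 : 0 < m := by positivity
  have hint := hr.profile_rpow_integrable h hlk (a := (1 - θ) * m)
    (mul_nonneg (by linarith) hm0.le) hθ
  have hI0 : 0 ≤ ∫ x in (0 : ℝ)..1, profile lam kap u₀ ρ₀ ηs x ^ (-((1 - θ) * m)) :=
    intervalIntegral.integral_nonneg zero_le_one fun x _ =>
      Real.rpow_nonneg (hr.profile_nonneg h hlk x) _
  refine ⟨k ^ (-m) * ((∫ x in (0 : ℝ)..1, profile lam kap u₀ ρ₀ ηs x ^ (-((1 - θ) * m))) + 1),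
    by positivity, fun η hη => ?_⟩
  have hε : 0 < ηs - η := sub_pos.2 hη.2
  have hle : mass lam kap u₀ ρ₀ η ≤ ∫ x in (0 : ℝ)..1, k ^ (-m) * (ηs - η) ^ (-(θ * m)) *
      profile lam kap u₀ ρ₀ ηs x ^ (-((1 - θ) * m)) := by
    refine intervalIntegral.integral_mono_ae_restrict zero_le_one
      ((hr.continuous_weight h hlk hη).intervalIntegrable _ _) (hint.const_mul _) ?_
    filter_upwards [ae_restrict_of_ae (hr.profile_pos_ae h hlk),
      ae_restrict_mem measurableSet_Icc] with x hx hxm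
    have hf := hx hxm
    have hQp := hr.Q_pos h hη x
    rw [one_div, ← Real.rpow_neg hQp.le]
    -- Interpolation: the share `θ` of the singularity is paid in powers of `ηs - η`, the rest in an
    -- integrable power of the profile. The exact asymptotics of the mass, which change at `λ = 1`,
    -- are thereby avoided.
    have e1 : (ηs - η) ^ θ * profile lam kap u₀ ρ₀ ηs x ^ (1 - θ) ≤
        (ηs - η) + profile lam kap u₀ ρ₀ ηs x := by
      have hs : 0 < (ηs - η) + profile lam kap u₀ ρ₀ ηs x := by positivity
      calc _ ≤ ((ηs - η) + profile lam kap u₀ ρ₀ ηs x) ^ θ *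
            ((ηs - η) + profile lam kap u₀ ρ₀ ηs x) ^ (1 - θ) := by
            refine mul_le_mul ?_ ?_ (by positivity) (by positivity)
            · exact Real.rpow_le_rpow hε.le (by linarith) h0
            · exact Real.rpow_le_rpow hf.le (by linarith) (by linarith)
        _ = _ := by
            rw [← Real.rpow_add hs]; simp
    have e2 := Real.rpow_le_rpow_of_nonpos (z := -m) (by positivity)
      ((mul_le_mul_of_nonneg_left e1 hk.le).trans (hQ η hη x).1) (by linarith)
    refine e2.trans (le_of_eq ?_)
    rw [Real.mul_rpow hk.le (by positivity), Real.mul_rpow (by positivity) (by positivity),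
      ← Real.rpow_mul hε.le, ← Real.rpow_mul hf.le, mul_assoc]
    congr 3 <;> ring_nf
  refine hle.trans ?_
  rw [intervalIntegral.integral_const_mul]
  have : 0 ≤ k ^ (-m) * (ηs - η) ^ (-(θ * m)) := by positivity
  nlinarith

/-- Bounds for the mass when `λ < 0`. -/
theorem exists_mass_upper (hlam : lam < 0) : ∃ C > 0, ∀ η ∈ Ico 0 ηs,
      mass lam kap u₀ ρ₀ η ≤ C := by
  obtain ⟨K, hK, hQ⟩ := hr.Q_le h hlk
  refine ⟨K ^ (-(1 / (2 * lam))), by positivity, fun η hη => ?_⟩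
  have : mass lam kap u₀ ρ₀ η ≤ ∫ x in (0 : ℝ)..1, K ^ (-(1 / (2 * lam))) := by
    refine intervalIntegral.integral_mono_on zero_le_one
      ((hr.continuous_weight h hlk hη).intervalIntegrable _ _) (by simp) fun x _ => ?_
    have hQp := hr.Q_pos h hη x
    rw [one_div, ← Real.rpow_neg hQp.le]
    refine Real.rpow_le_rpow hQp.le (hQ η hη x) ?_
    rw [neg_nonneg]
    exact div_nonpos_of_nonneg_of_nonpos zero_le_one (by linarith)
  simpa using this

/-- On some interval `𝒬` stays away from zero. -/
theorem exists_far : ∃ y z q : ℝ, 0 ≤ y ∧ y < z ∧ z ≤ 1 ∧ 0 < q ∧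
    ∀ η ∈ Ico 0 ηs, ∀ x ∈ Icc y z, q ≤ Q lam kap u₀ ρ₀ x η := by
  obtain ⟨x₀, hx₀, -⟩ := hr.exists_zero h hlk
  obtain ⟨r, hr0, k, hk, hf⟩ := hr.profile_quadratic_lower h hlk (Ico_subset_Icc_self hx₀)
  obtain ⟨k', hk', K, -, hQ⟩ := hr.exists_Q_bounds h hlk
  -- The zero lies in `[0, 1)`, so there is room to its right; on `[x₀ + s/2, x₀ + s]` the quadratic
  -- bound keeps the profile away from zero.
  set s := min (r / 2) (1 - x₀) with hs
  have hs0 : 0 < s := lt_min (by linarith) (by linarith [hx₀.2])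
  have hs1 : s ≤ r / 2 := min_le_left _ _
  have hs2 : s ≤ 1 - x₀ := min_le_right _ _
  refine ⟨x₀ + s / 2, x₀ + s, k' * (k * (s / 2) ^ 2), by linarith [hx₀.1], by linarith,
    by linarith, by positivity, fun η hη x hx => ?_⟩
  refine le_trans ?_ (hQ η hη x).1
  refine mul_le_mul_of_nonneg_left ?_ hk'.le
  have h1 := hf x (by rw [abs_of_nonneg (by linarith [hx.1])]; linarith [hx.2])
  have h2 : (s / 2) ^ 2 ≤ (x - x₀) ^ 2 := pow_le_pow_left₀ (by linarith) (by linarith [hx.1]) 2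
  nlinarith [hη.2]

omit hr h hlk in
theorem mul_le_integral {g : ℝ → ℝ} (hg : Continuous g) (h0 : ∀ x, 0 ≤ g x) {y z v : ℝ}
    (hy : 0 ≤ y) (hyz : y ≤ z) (hz : z ≤ 1) (hv : ∀ x ∈ Icc y z, v ≤ g x) :
    (z - y) * v ≤ ∫ x in (0 : ℝ)..1, g x := by
  have h1 : ∫ _ in y..z, v ≤ ∫ x in y..z, g x :=
    intervalIntegral.integral_mono_on hyz (by simp) (hg.intervalIntegrable _ _) hv
  have h2 := intervalIntegral.integral_mono_interval hy hyz hz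
    (Eventually.of_forall h0) (hg.intervalIntegrable (μ := volume) 0 1)
  simp only [intervalIntegral.integral_const, smul_eq_mul] at h1
  exact h1.trans h2

theorem exists_mass_lower (hlam : lam < 0) : ∃ C > 0, ∀ η ∈ Ico 0 ηs,
    C ≤ mass lam kap u₀ ρ₀ η := by
  obtain ⟨y, z, q, hy, hyz, hz, hq, hQ⟩ := hr.exists_far h hlk
  refine ⟨(z - y) * q ^ (-(1 / (2 * lam))), mul_pos (by linarith) (by positivity), fun η hη => ?_⟩
  refine mul_le_integral (hr.continuous_weight h hlk hη)
    (fun x => one_div_nonneg.2 (Real.rpow_nonneg (hr.Q_pos h hη x).le _)) hy hyz.le hz fun x hx => ?_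
  rw [one_div (_ ^ _), ← Real.rpow_neg (hr.Q_pos h hη x).le]
  refine Real.rpow_le_rpow hq.le (hQ η hη x hx) ?_
  rw [neg_nonneg]
  exact div_nonpos_of_nonneg_of_nonpos zero_le_one (by linarith)

theorem tendsto_timeOf_of_bound {C θ : ℝ} (hθ : θ < 1)
    (hb : ∀ η ∈ Ico 0 ηs, mass lam kap u₀ ρ₀ η ^ (2 * lam) ≤ C * (ηs - η) ^ (-θ)) :
    ∃ ts, Tendsto (timeOf lam kap u₀ ρ₀) (𝓝[<] ηs) (𝓝 ts) := by
  obtain ⟨δ, hδ, hQ⟩ := hr.exists_Q_pos h hlk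
  have hηs := hr.pos
  have hcont : ContinuousOn (fun μ => mass lam kap u₀ ρ₀ μ ^ (2 * lam)) (Ioo (-δ) ηs) :=
    ((smoothOn_mass_integrand h hQ).contDiffOn_integral isOpen_Ioo 0 1).continuousOn.rpow_const
      fun e he => Or.inl (GHS.mass_pos h (hQ e he)).ne'
  have hint : IntervalIntegrable (fun μ => mass lam kap u₀ ρ₀ μ ^ (2 * lam)) volume 0 ηs := by
    have hdom : IntervalIntegrable (fun μ => C * |μ - ηs| ^ (-θ)) volume 0 ηs :=
      (intervalIntegrable_abs_sub_rpow (by linarith) ηs 0 ηs).const_mul C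
    refine hdom.mono_fun' ?_ ?_
    · rw [uIoc_of_le hηs.le, ← restrict_Ioo_eq_restrict_Ioc]
      exact (hcont.mono (Ioo_subset_Ioo_left (by linarith))).aestronglyMeasurable measurableSet_Ioo
    · rw [uIoc_of_le hηs.le, ← restrict_Ioo_eq_restrict_Ioc]
      filter_upwards [ae_restrict_mem measurableSet_Ioo] with μ hμ
      have hμ' : μ ∈ Ico 0 ηs := ⟨hμ.1.le, hμ.2⟩
      rw [Real.norm_eq_abs, abs_of_nonneg (Real.rpow_nonneg (hr.mass_pos h hlk hμ').le _),
        abs_sub_comm, abs_of_pos (sub_pos.2 hμ.2)]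
      exact hb μ hμ'
  have hprim := intervalIntegral.continuousOn_primitive_interval' hint left_mem_uIcc
  -- The integrand is integrable up to `ηs`, so its primitive is continuous there and the limit is
  -- the value at the endpoint.
  refine ⟨timeOf lam kap u₀ ρ₀ ηs, ?_⟩
  have := hprim ηs right_mem_uIcc
  rw [uIcc_of_le hηs.le] at this
  refine this.tendsto.mono_left ?_
  rw [nhdsWithin_le_iff]
  filter_upwards [Ioo_mem_nhdsLT hηs] with μ hμ using ⟨hμ.1.le, hμ.2.le⟩

theorem exists_tendsto_timeOf : ∃ ts, Tendsto (timeOf lam kap u₀ ρ₀) (𝓝[<] ηs) (𝓝 ts) := by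
  have hlam : lam ≠ 0 := fun h => by simp [h] at hlk
  rcases lt_or_gt_of_ne hlam with hl | hl
  · obtain ⟨C, hC, hm⟩ := hr.exists_mass_lower h hlk hl
    refine hr.tendsto_timeOf_of_bound h hlk (θ := 0) (C := C ^ (2 * lam)) zero_lt_one fun η hη => ?_
    rw [neg_zero, Real.rpow_zero, mul_one]
    exact Real.rpow_le_rpow_of_nonpos hC (hm η hη) (by linarith)
  -- The last condition gives `(1 - θ) / (2λ) ≤ 1/4 < 1/2`, as the mass bound requires; raised to
  -- the power `2λ` that bound is `(ηs - η)^(-θ)`, integrable for `θ < 1`.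
  · obtain ⟨θ, h0, h1, h2⟩ : ∃ θ : ℝ, 0 ≤ θ ∧ θ < 1 ∧ 1 - lam / 2 ≤ θ :=
      ⟨max 0 (1 - lam / 2), le_max_left _ _, max_lt zero_lt_one (by linarith), le_max_right _ _⟩
    obtain ⟨C, hC, hm⟩ := hr.mass_le_of_pos h hlk hl h0 h1.le (by
      have : 1 - θ ≤ lam / 2 := by linarith
      calc (1 - θ) * (1 / (2 * lam)) ≤ lam / 2 * (1 / (2 * lam)) :=
            mul_le_mul_of_nonneg_right this (by positivity)
        _ = 1 / 4 := by field_simp; norm_num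
        _ < 1 / 2 := by norm_num)
    refine hr.tendsto_timeOf_of_bound h hlk h1 (C := C ^ (2 * lam)) fun η hη => ?_
    have hε : 0 < ηs - η := sub_pos.2 hη.2
    refine (Real.rpow_le_rpow (hr.mass_pos h hlk hη).le (hm η hη) (by linarith)).trans
      (le_of_eq ?_)
    rw [Real.mul_rpow hC.le (by positivity), ← Real.rpow_mul hε.le]
    congr 2
    field_simp

end IsEarliestSimpleRoot

end


/-! ### Blow-up for `λ > 0` -/

theorem IsSmoothPeriodicData.continuous_Qη_left {lam kap : ℝ} {u₀ ρ₀ : ℝ → ℝ}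
    (h : IsSmoothPeriodicData u₀ ρ₀) (η : ℝ) : Continuous fun x => Qη lam kap u₀ ρ₀ x η := by
  have h1 := h.smooth_deriv.continuous
  have h2 := h.smooth_ρ.continuous
  unfold Qη c
  fun_prop

section

variable {lam kap : ℝ} {u₀ ρ₀ : ℝ → ℝ} {ηs : ℝ}

namespace IsEarliestSimpleRoot

variable (hr : IsEarliestSimpleRoot lam kap u₀ ρ₀ ηs) (h : IsSmoothPeriodicData u₀ ρ₀)
  (hlk : 0 < lam * kap)
include hr h hlk

/-- The behaviour of `𝒬` to the right of one of its zeros. -/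
theorem exists_local : ∃ x₀ r k K d : ℝ, 0 ≤ x₀ ∧ 0 < r ∧ r ≤ 1 ∧ x₀ + r ≤ 1 ∧ r ≤ ηs ∧ 0 < k ∧
    0 < K ∧ 0 < d ∧ ∀ η ∈ Ioo (ηs - r) ηs, ∀ x ∈ Icc x₀ (x₀ + r),
      k * ((ηs - η) + (x - x₀) ^ 2) ≤ Q lam kap u₀ ρ₀ x η ∧
      Q lam kap u₀ ρ₀ x η ≤ K * ((ηs - η) + (x - x₀) ^ 2) ∧
      d ≤ |ρ₀ x| ∧ d ≤ -Qη lam kap u₀ ρ₀ x η := by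
  obtain ⟨x₀, hx₀, hf0⟩ := hr.exists_zero h hlk
  obtain ⟨r₁, hr1, k, hk, K, hK, hq⟩ := hr.profile_quadratic h hlk (Ico_subset_Icc_self hx₀) hf0
  obtain ⟨k', hk', K', hK', hQ⟩ := hr.exists_Q_bounds h hlk
  have hηs := hr.pos
  have hρ : 0 < |ρ₀ x₀| := abs_pos.2 (hr.ρ_ne_zero h hlk hf0)
  have hQn := hr.Qη_neg h hlk hf0
  obtain ⟨r₂, hr2, hρb⟩ := Metric.eventually_nhds_iff.1
    (h.smooth_ρ.continuous.abs.continuousAt.eventually_const_lt (half_lt_self hρ))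
  have hQc : ContinuousAt (fun q : ℝ × ℝ => -Qη lam kap u₀ ρ₀ q.1 q.2) (x₀, ηs) :=
    (h.continuous_Qη (lam := lam) (kap := kap)).neg.continuousAt
  have hQe : ∀ᶠ q in 𝓝 (x₀, ηs), -Qη lam kap u₀ ρ₀ x₀ ηs / 2 < -Qη lam kap u₀ ρ₀ q.1 q.2 :=
    hQc.eventually_const_lt (half_lt_self (neg_pos.2 hQn))
  obtain ⟨r₃, hr3, hQb⟩ := Metric.eventually_nhds_iff.1 hQe
  obtain ⟨s, hs0, s1, s2, s3⟩ : ∃ s > 0, s ≤ r₁ ∧ s ≤ r₂ ∧ s ≤ r₃ :=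
    ⟨min r₁ (min r₂ r₃), lt_min hr1 (lt_min hr2 hr3), min_le_left _ _,
      (min_le_right _ _).trans (min_le_left _ _), (min_le_right _ _).trans (min_le_right _ _)⟩
  obtain ⟨r, hr0, e1, e2, e3⟩ : ∃ r > 0, r ≤ s / 2 ∧ r ≤ 1 - x₀ ∧ r ≤ ηs :=
    ⟨min (s / 2) (min (1 - x₀) ηs), lt_min (by linarith) (lt_min (by linarith [hx₀.2]) hηs),
      min_le_left _ _, (min_le_right _ _).trans (min_le_left _ _),
      (min_le_right _ _).trans (min_le_right _ _)⟩
  refine ⟨x₀, r, k' * min 1 k, K' * max 1 K, min (|ρ₀ x₀| / 2) (-Qη lam kap u₀ ρ₀ x₀ ηs / 2),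
    hx₀.1, hr0, by linarith [hx₀.1], by linarith, e3, by positivity, by positivity,
    lt_min (by linarith) (by linarith), fun η hη x hx => ?_⟩
  have hη' : η ∈ Ico 0 ηs := ⟨by linarith [hη.1], hη.2⟩
  have hxr : |x - x₀| < s := by
    rw [abs_of_nonneg (by linarith [hx.1])]; linarith [hx.2]
  have hε : 0 ≤ ηs - η := by linarith [hη.2]
  have hy := sq_nonneg (x - x₀)
  obtain ⟨f1, f2⟩ := hq x (hxr.trans_le s1)
  obtain ⟨q1, q2⟩ := hQ η hη' x
  refine ⟨le_trans ?_ q1, q2.trans ?_, ?_, ?_⟩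
  · rw [mul_assoc]
    refine mul_le_mul_of_nonneg_left ?_ hk'.le
    have a1 := mul_le_mul_of_nonneg_right (min_le_left 1 k) hε
    have a2 := mul_le_mul_of_nonneg_right (min_le_right 1 k) hy
    linarith
  · rw [mul_assoc]
    refine mul_le_mul_of_nonneg_left ?_ hK'.le
    have a1 := mul_le_mul_of_nonneg_right (le_max_left 1 K) hε
    have a2 := mul_le_mul_of_nonneg_right (le_max_right 1 K) hy
    linarith
  · exact (min_le_left _ _).trans (hρb (y := x) (by rw [Real.dist_eq]; exact hxr.trans_le s2)).le
  · refine (min_le_right _ _).trans (hQb (y := (x, η)) ?_).le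
    rw [Prod.dist_eq, Real.dist_eq, Real.dist_eq]
    refine max_lt (hxr.trans_le s3) ?_
    rw [abs_sub_comm, abs_of_nonneg hε]
    linarith [hη.1]

theorem continuous_jacOf {η : ℝ} (hη : η ∈ Ico 0 ηs) :
    Continuous fun x => jacOf lam kap u₀ ρ₀ x η :=
  (hr.continuous_weight h hlk hη).div_const _

theorem jacOf_pos {η : ℝ} (hη : η ∈ Ico 0 ηs) (x : ℝ) : 0 < jacOf lam kap u₀ ρ₀ x η :=
  div_pos (one_div_pos.2 (Real.rpow_pos_of_pos (hr.Q_pos h hη x) _)) (hr.mass_pos h hlk hη)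

theorem continuous_integrandU {η p : ℝ} (hη : η ∈ Ico 0 ηs) (hp : 0 ≤ p) :
    Continuous fun x => |1 / (2 * lam) * mass lam kap u₀ ρ₀ η ^ (-(2 * lam)) *
    (meanRate lam kap u₀ ρ₀ η - Qη lam kap u₀ ρ₀ x η / Q lam kap u₀ ρ₀ x η)| ^ p
      * jacOf lam kap u₀ ρ₀ x η := by
  have h1 : Continuous fun x => Qη lam kap u₀ ρ₀ x η :=
    h.continuous_Qη_left η
  have h2 : Continuous fun x => Qη lam kap u₀ ρ₀ x η / Q lam kap u₀ ρ₀ x η :=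
    h1.div (h.continuous_Q η) fun x => (hr.Q_pos h hη x).ne'
  exact ((continuous_const.mul (continuous_const.sub h2)).abs.rpow_const fun _ => Or.inr hp).mul
    (hr.continuous_jacOf h hlk hη)

theorem continuous_integrandR {η p : ℝ} (hη : η ∈ Ico 0 ηs) (hp : 0 ≤ p) :
    Continuous fun x => |ρ₀ x * (mass lam kap u₀ ρ₀ η ^ (-(2 * lam)) / Q lam kap u₀ ρ₀ x η)| ^ p
      * jacOf lam kap u₀ ρ₀ x η :=
  ((h.smooth_ρ.continuous.mul (continuous_const.div (h.continuous_Q η)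
    fun x => (hr.Q_pos h hη x).ne')).abs.rpow_const fun _ => Or.inr hp).mul
    (hr.continuous_jacOf h hlk hη)

omit h hlk in
theorem eventually_mem {r : ℝ} (hr0 : 0 < r) : ∀ᶠ η in 𝓝[<] ηs, η ∈ Ico 0 ηs ∧ ηs - η < r := by
  filter_upwards [Ioo_mem_nhdsLT hr.pos, Ioo_mem_nhdsLT (show ηs - r < ηs by linarith)] with η h1 h2
  exact ⟨⟨h1.1.le, h1.2⟩, by linarith [h2.1]⟩

/-- The common divergence criterion for `λ > 0`. -/
theorem tendsto_atTop_of_concentration (hlam : 0 < lam) {p c₁ c₂ : ℝ} (hp : 1 ≤ p) (hc₁ : 0 < c₁)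
    (hc₂ : 0 < c₂) {N : ℝ → ℝ}
    (hN : ∀ᶠ η in 𝓝[<] ηs, √(ηs - η) * ((c₁ * (mass lam kap u₀ ρ₀ η ^ (-(2 * lam)) / (ηs - η))) ^ p
      * (c₂ * (ηs - η) ^ (-(1 / (2 * lam))) / mass lam kap u₀ ρ₀ η)) ≤ N η) :
    Tendsto N (𝓝[<] ηs) atTop := by
  -- With this `θ` the hypothesis of the mass bound reads `1 / (2 (1 + λ)) < 1/2`, and the total
  -- power of `ε`, namely `1/2 - (1 - θ)(p + 1/(2λ))`, equals `-s` with `s = λ (2p - 1) / (2 (1 +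
  -- λ)) > 0`.
  set θ := 1 / (1 + lam) with hθ
  obtain ⟨C, hC, hm⟩ := hr.mass_le_of_pos h hlk hlam (θ := θ) (by positivity)
    (by rw [hθ, div_le_one (by positivity)]; linarith) (by
      have e : (1 - θ) * (1 / (2 * lam)) = 1 / (2 * (1 + lam)) := by
        rw [hθ]; field_simp; ring
      rw [e]
      exact one_div_lt_one_div_of_lt (by norm_num) (by linarith))
  set m := 1 / (2 * lam) with hmdef
  set s := lam * (2 * p - 1) / (2 * (1 + lam)) with hs
  have hs0 : 0 < s := div_pos (mul_pos hlam (by linarith)) (by positivity)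
  have hlim : Tendsto (fun η => (c₁ * C ^ (-(2 * lam))) ^ p * (c₂ * C⁻¹) * (ηs - η)⁻¹ ^ s)
      (𝓝[<] ηs) atTop := by
    refine Tendsto.const_mul_atTop (by positivity) ((tendsto_rpow_atTop hs0).comp ?_)
    refine tendsto_inv_nhdsGT_zero.comp ?_
    refine tendsto_nhdsWithin_iff.2 ⟨?_, ?_⟩
    · have : Tendsto (fun η => ηs - η) (𝓝 ηs) (𝓝 (ηs - ηs)) :=
        (continuous_const.sub continuous_id).tendsto _
      rw [sub_self] at this
      exact this.mono_left nhdsWithin_le_nhds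
    · filter_upwards [self_mem_nhdsWithin] with η hη using sub_pos.2 (mem_Iio.1 hη)
  refine tendsto_atTop_mono' _ ?_ hlim
  filter_upwards [hN, hr.eventually_mem one_pos] with η hη hmem
  refine le_trans ?_ hη
  have hε : 0 < ηs - η := sub_pos.2 hmem.1.2
  have hA := hr.mass_pos h hlk hmem.1
  set ε := ηs - η with hεdef
  set A := mass lam kap u₀ ρ₀ η with hAdef
  have hAle : A ≤ C * ε ^ (-(θ * m)) := hm η hmem.1
  have h1 : C ^ (-(2 * lam)) * ε ^ θ ≤ A ^ (-(2 * lam)) := by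
    have := Real.rpow_le_rpow_of_nonpos hA hAle (show -(2 * lam) ≤ 0 by linarith)
    rw [Real.mul_rpow hC.le (by positivity), ← Real.rpow_mul hε.le] at this
    convert this using 3
    rw [hmdef]; field_simp
  have h2 : C⁻¹ * ε ^ (θ * m) ≤ A⁻¹ := by
    have := inv_anti₀ hA hAle
    rwa [mul_inv, ← Real.rpow_neg hε.le, neg_neg] at this
  calc (c₁ * C ^ (-(2 * lam))) ^ p * (c₂ * C⁻¹) * ε⁻¹ ^ s
      = √ε * ((c₁ * (C ^ (-(2 * lam)) * ε ^ θ / ε)) ^ p * (c₂ * ε ^ (-m) * (C⁻¹ * ε ^ (θ * m)))) := by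
        have e1 : c₁ * (C ^ (-(2 * lam)) * ε ^ θ / ε) = c₁ * C ^ (-(2 * lam)) * ε ^ (θ - 1) := by
          rw [Real.rpow_sub_one hε.ne']; ring
        have e2 : ε⁻¹ ^ s = ε ^ (1 / 2 : ℝ) * ε ^ ((θ - 1) * p) * ε ^ (-m) * ε ^ (θ * m) := by
          rw [← Real.rpow_add hε, ← Real.rpow_add hε, ← Real.rpow_add hε, Real.inv_rpow hε.le,
            ← Real.rpow_neg hε.le]
          congr 1
          rw [hs, hθ, hmdef]
          field_simp
          ring
        rw [e1, Real.mul_rpow (x := c₁ * C ^ (-(2 * lam))) (y := ε ^ (θ - 1)) (by positivity)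
          (by positivity), ← Real.rpow_mul hε.le, e2,
          Real.sqrt_eq_rpow]
        ring
    _ ≤ √ε * ((c₁ * (A ^ (-(2 * lam)) / ε)) ^ p * (c₂ * ε ^ (-m) * A⁻¹)) := by gcongr
    _ = _ := by rw [div_eq_mul_inv (c₂ * ε ^ (-m))]

theorem jacOf_ge (hlam : 0 < lam) {η x B : ℝ} (hη : η ∈ Ico 0 ηs)
    (hB : Q lam kap u₀ ρ₀ x η ≤ B * (ηs - η)) (hB0 : 0 < B) :
    B ^ (-(1 / (2 * lam))) * (ηs - η) ^ (-(1 / (2 * lam))) / mass lam kap u₀ ρ₀ η ≤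
      jacOf lam kap u₀ ρ₀ x η := by
  have hε : 0 < ηs - η := sub_pos.2 hη.2
  have hQ := hr.Q_pos h hη x
  rw [jacOf, ← Real.mul_rpow hB0.le hε.le, one_div (_ ^ _), ← Real.rpow_neg hQ.le]
  refine div_le_div_of_nonneg_right ?_ (hr.mass_pos h hlk hη).le
  refine Real.rpow_le_rpow_of_nonpos hQ hB ?_
  rw [neg_nonpos]; positivity

/-- On `[x₀, x₀ + √ε]` one has `𝒬 ≤ 2 K ε` while `|ρ₀|` is bounded below; this interval alone gives
the divergence. -/
theorem powNormR_tendsto_atTop_of_pos (hlam : 0 < lam) {p : ℝ} (hp : 1 ≤ p) :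
    Tendsto (powNormR lam kap u₀ ρ₀ p) (𝓝[<] ηs) atTop := by
  obtain ⟨x₀, r, k, K, d, hx0, hr0, hr1, hxr, hrη, hk, hK, hd, hloc⟩ := hr.exists_local h hlk
  refine hr.tendsto_atTop_of_concentration h hlk hlam hp (c₁ := d / (2 * K))
    (c₂ := (2 * K) ^ (-(1 / (2 * lam)))) (by positivity) (by positivity) ?_
  filter_upwards [hr.eventually_mem hr0, hr.eventually_mem (pow_pos hr0 2)]
    with η h1 h2
  have hε : 0 < ηs - η := sub_pos.2 h1.1.2
  set ε := ηs - η with hεdef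
  have hsq : √ε ≤ r := by rw [Real.sqrt_le_left hr0.le]; exact h2.2.le
  have hsq0 := Real.sqrt_nonneg ε
  have hA := hr.mass_pos h hlk h1.1
  have := mul_le_integral (hr.continuous_integrandR h hlk h1.1 (by linarith : 0 ≤ p))
    (fun x => mul_nonneg (by positivity) (hr.jacOf_pos h hlk h1.1 x).le) hx0
    (show x₀ ≤ x₀ + √ε by linarith) (by linarith) (v := (d / (2 * K) *
      (mass lam kap u₀ ρ₀ η ^ (-(2 * lam)) / ε)) ^ p * ((2 * K) ^ (-(1 / (2 * lam)))
        * ε ^ (-(1 / (2 * lam))) / mass lam kap u₀ ρ₀ η)) (fun x hx => by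
      obtain ⟨-, q2, hρ, -⟩ := hloc η ⟨by linarith [h1.2], h1.1.2⟩ x ⟨hx.1, by linarith [hx.2]⟩
      have hQ := hr.Q_pos h h1.1 x
      have hQ2 : Q lam kap u₀ ρ₀ x η ≤ 2 * K * ε := by
        have : (x - x₀) ^ 2 ≤ ε := by
          rw [← Real.sq_sqrt hε.le]
          exact pow_le_pow_left₀ (by linarith [hx.1]) (by linarith [hx.2]) 2
        nlinarith
      refine mul_le_mul ?_ (hr.jacOf_ge h hlk hlam h1.1 hQ2 (by positivity)) (by positivity)
        (by positivity)
      refine Real.rpow_le_rpow (by positivity) ?_ (by linarith)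
      have hAp : 0 < mass lam kap u₀ ρ₀ η ^ (-(2 * lam)) := by positivity
      rw [abs_mul, abs_of_pos (div_pos hAp hQ)]
      calc d / (2 * K) * (mass lam kap u₀ ρ₀ η ^ (-(2 * lam)) / ε)
          = d * (mass lam kap u₀ ρ₀ η ^ (-(2 * lam)) / (2 * K * ε)) := by field_simp
        _ ≤ _ := by gcongr)
  rw [add_sub_cancel_left] at this
  exact this

/-- On `[x₀, x₀ + √ε]` the rate `𝒬_η/𝒬` is at most `-H/ε`, whereas on `[x₀ + L√ε, x₀ + (L+1)√ε]` it
is at least `-H/(2ε)`. The mean `D` therefore stays at distance `H/(4ε)` from the rate on one of the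
two intervals; the threshold between the cases is the midpoint `-3H/(4ε)`. -/
theorem powNormU_tendsto_atTop_of_pos (hlam : 0 < lam) {p : ℝ} (hp : 1 ≤ p) :
    Tendsto (powNormU lam kap u₀ ρ₀ p) (𝓝[<] ηs) atTop := by
  obtain ⟨x₀, r, k, K, d, hx0, hr0, hr1, hxr, hrη, hk, hK, hd, hloc⟩ := hr.exists_local h hlk
  obtain ⟨M, hM, hMb⟩ := hr.Qη_le h hlk
  -- At distance `L√ε` one has `𝒬 ≥ k L² ε`, so a large `L` halves the rate.
  obtain ⟨L, hL1, hL⟩ : ∃ L : ℝ, 1 ≤ L ∧ M / (k * L ^ 2) ≤ d / (2 * K) / 2 := by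
    refine ⟨1 + 4 * K * M / (k * d), by have : 0 < 4 * K * M / (k * d) := by positivity
                                        linarith, ?_⟩
    set X := 4 * K * M / (k * d) with hX
    have hX0 : 0 < X := by positivity
    rw [div_le_iff₀ (by positivity)]
    have e : M = d / (2 * K) / 2 * k * X := by rw [hX]; field_simp; norm_num
    calc M = d / (2 * K) / 2 * (k * X) := by rw [e]; ring
      _ ≤ _ := mul_le_mul_of_nonneg_left (mul_le_mul_of_nonneg_left (by nlinarith) hk.le)
          (by positivity)
  set H := d / (2 * K) with hH
  have hH0 : 0 < H := by positivity
  set B := K * (1 + (L + 1) ^ 2) with hB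
  have hB0 : 0 < B := by positivity
  refine hr.tendsto_atTop_of_concentration h hlk hlam hp (c₁ := 1 / (2 * lam) * (H / 4))
    (c₂ := B ^ (-(1 / (2 * lam)))) (by positivity) (by positivity) ?_
  filter_upwards [hr.eventually_mem hr0,
    hr.eventually_mem (show 0 < (r / (L + 1)) ^ 2 by positivity)] with η h1 h2
  have hε : 0 < ηs - η := sub_pos.2 h1.1.2
  set ε := ηs - η with hεdef
  have hsq : (L + 1) * √ε ≤ r := by
    have : √ε ≤ r / (L + 1) := by rw [Real.sqrt_le_left (by positivity)]; exact h2.2.le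
    rwa [le_div_iff₀ (by positivity), mul_comm] at this
  have hsq0 := Real.sqrt_pos.2 hε
  have hA := hr.mass_pos h hlk h1.1
  have hAp : 0 < mass lam kap u₀ ρ₀ η ^ (-(2 * lam)) := by positivity
  set D := meanRate lam kap u₀ ρ₀ η with hD
  -- on an interval where the rate is large, the integrand is large
  have concl : ∀ y, x₀ ≤ y → y + √ε ≤ x₀ + (L + 1) * √ε →
      (∀ x ∈ Icc y (y + √ε), H / 4 / ε ≤ |D - Qη lam kap u₀ ρ₀ x η / Q lam kap u₀ ρ₀ x η|) →
      √ε * ((1 / (2 * lam) * (H / 4) * (mass lam kap u₀ ρ₀ η ^ (-(2 * lam)) / ε)) ^ p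
      * (B ^ (-(1 / (2 * lam))) * ε ^ (-(1 / (2 * lam))) / mass lam kap u₀ ρ₀ η)) ≤
      powNormU lam kap u₀ ρ₀ p η := by
    intro y hy1 hy2 hbig
    have := mul_le_integral (hr.continuous_integrandU h hlk h1.1 (by linarith : 0 ≤ p))
      (fun x => mul_nonneg (by positivity) (hr.jacOf_pos h hlk h1.1 x).le) (hx0.trans hy1)
      (show y ≤ y + √ε by linarith) (by linarith) (v := (1 / (2 * lam) * (H / 4) *
        (mass lam kap u₀ ρ₀ η ^ (-(2 * lam)) / ε)) ^ p * (B ^ (-(1 / (2 * lam)))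
        * ε ^ (-(1 / (2 * lam))) / mass lam kap u₀ ρ₀ η)) (fun x hx => by
        obtain ⟨-, q2, -, -⟩ := hloc η ⟨by linarith [h1.2], h1.1.2⟩ x
          ⟨by linarith [hx.1], by linarith [hx.2]⟩
        have hQ2 : Q lam kap u₀ ρ₀ x η ≤ B * ε := by
          have : (x - x₀) ^ 2 ≤ (L + 1) ^ 2 * ε := by
            have e : (L + 1) ^ 2 * ε = ((L + 1) * √ε) ^ 2 := by
              rw [mul_pow, Real.sq_sqrt hε.le]
            rw [e]
            exact pow_le_pow_left₀ (by linarith [hx.1]) (by linarith [hx.2]) 2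
          refine q2.trans ?_
          rw [hB, mul_assoc]
          refine mul_le_mul_of_nonneg_left ?_ hK.le
          linarith
        refine mul_le_mul ?_ (hr.jacOf_ge h hlk hlam h1.1 hQ2 hB0) (by positivity) (by positivity)
        refine Real.rpow_le_rpow (by positivity) ?_ (by linarith)
        rw [abs_mul, abs_of_pos (by positivity : 0 < 1 / (2 * lam) *
          mass lam kap u₀ ρ₀ η ^ (-(2 * lam)))]
        calc 1 / (2 * lam) * (H / 4) * (mass lam kap u₀ ρ₀ η ^ (-(2 * lam)) / ε)
            = 1 / (2 * lam) * mass lam kap u₀ ρ₀ η ^ (-(2 * lam)) * (H / 4 / ε) := by ring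
          _ ≤ _ := mul_le_mul_of_nonneg_left (hbig x hx) (by positivity))
    rw [add_sub_cancel_left] at this
    exact this
  rcases le_total 0 (D + 3 * (H / 4 / ε)) with hD0 | hD0
  · refine concl x₀ le_rfl (by nlinarith) fun x hx => ?_
    obtain ⟨-, q2, -, hqd⟩ := hloc η ⟨by linarith [h1.2], h1.1.2⟩ x
      ⟨hx.1, by nlinarith [hx.2]⟩
    have hQ := hr.Q_pos h h1.1 x
    have hQ2 : Q lam kap u₀ ρ₀ x η ≤ 2 * K * ε := by
      have : (x - x₀) ^ 2 ≤ ε := by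
        rw [← Real.sq_sqrt hε.le]
        exact pow_le_pow_left₀ (by linarith [hx.1]) (by linarith [hx.2]) 2
      nlinarith
    have hge : H / ε ≤ -Qη lam kap u₀ ρ₀ x η / Q lam kap u₀ ρ₀ x η := by
      calc H / ε = d / (2 * K * ε) := by rw [hH]; field_simp
        _ ≤ _ := div_le_div₀ (by linarith) hqd hQ hQ2
    refine le_trans ?_ (le_abs_self _)
    have e : H / ε = 4 * (H / 4 / ε) := by ring
    rw [neg_div] at hge
    linarith
  · refine concl (x₀ + L * √ε) (by nlinarith) (by linarith) fun x hx => ?_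
    obtain ⟨q1, -, -, hqd⟩ := hloc η ⟨by linarith [h1.2], h1.1.2⟩ x
      ⟨by nlinarith [hx.1], by nlinarith [hx.2]⟩
    have hQ := hr.Q_pos h h1.1 x
    have hQ2 : k * L ^ 2 * ε ≤ Q lam kap u₀ ρ₀ x η := by
      have e : L ^ 2 * ε = (L * √ε) ^ 2 := by rw [mul_pow, Real.sq_sqrt hε.le]
      have : (L * √ε) ^ 2 ≤ (x - x₀) ^ 2 := pow_le_pow_left₀ (by positivity) (by linarith [hx.1]) 2
      nlinarith
    have hle : -Qη lam kap u₀ ρ₀ x η / Q lam kap u₀ ρ₀ x η ≤ H / 2 / ε := by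
      calc -Qη lam kap u₀ ρ₀ x η / Q lam kap u₀ ρ₀ x η ≤ M / (k * L ^ 2 * ε) := by
            have := (abs_le.1 (hMb η ⟨h1.1.1, h1.1.2.le⟩ x)).1
            refine div_le_div₀ hM.le (by linarith) (by positivity) hQ2
        _ = M / (k * L ^ 2) / ε := by rw [div_div]
        _ ≤ _ := by gcongr
    refine le_trans ?_ (neg_le_abs _)
    have e : H / 2 / ε = 2 * (H / 4 / ε) := by ring
    rw [neg_div] at hle
    linarith

end IsEarliestSimpleRoot

end


/-! ### The case `λ < 0` -/

theorem tendsto_sub_nhdsGT (b : ℝ) : Tendsto (fun η => b - η) (𝓝[<] b) (𝓝[>] 0) := by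
  refine tendsto_nhdsWithin_iff.2 ⟨?_, ?_⟩
  · have : Tendsto (fun η => b - η) (𝓝 b) (𝓝 (b - b)) :=
      (continuous_const.sub continuous_id).tendsto _
    rw [sub_self] at this
    exact this.mono_left nhdsWithin_le_nhds
  · filter_upwards [self_mem_nhdsWithin] with η hη using sub_pos.2 (mem_Iio.1 hη)

section

variable {lam kap : ℝ} {u₀ ρ₀ : ℝ → ℝ} {ηs : ℝ}

namespace IsEarliestSimpleRoot

variable (hr : IsEarliestSimpleRoot lam kap u₀ ρ₀ ηs) (h : IsSmoothPeriodicData u₀ ρ₀)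
  (hlk : 0 < lam * kap)
include hr h

theorem continuous_Q_rpow {η : ℝ} (hη : η ∈ Ico 0 ηs) (e : ℝ) :
    Continuous fun x => Q lam kap u₀ ρ₀ x η ^ e :=
  (h.continuous_Q η).rpow_const fun x => Or.inl (hr.Q_pos h hη x).ne'

/-- The integral of `𝒬 ^ (-a)`, `1 / 2 ≤ a`, near a zero diverges. -/
theorem tendsto_integral_Q_rpow_atTop {x₀ r K a : ℝ} (ha : 1 / 2 ≤ a) (hr0 : 0 < r) (hr1 : r ≤ 1)
    (hK : 0 < K) (hQ : ∀ η ∈ Ioo (ηs - r) ηs, ∀ x ∈ Icc x₀ (x₀ + r),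
      Q lam kap u₀ ρ₀ x η ≤ K * ((ηs - η) + (x - x₀) ^ 2)) :
    Tendsto (fun η => ∫ x in x₀..(x₀ + r), Q lam kap u₀ ρ₀ x η ^ (-a)) (𝓝[<] ηs) atTop := by
  have hlim : Tendsto (fun η => (4 * K) ^ (-a) * Real.log (r * (√(ηs - η))⁻¹)) (𝓝[<] ηs)
      atTop := by
    refine Tendsto.const_mul_atTop (by positivity) (Real.tendsto_log_atTop.comp ?_)
    refine Tendsto.const_mul_atTop hr0 (tendsto_inv_nhdsGT_zero.comp ?_)
    refine tendsto_nhdsWithin_iff.2 ⟨?_, ?_⟩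
    · have := (Real.continuous_sqrt.tendsto 0).comp
        ((tendsto_sub_nhdsGT ηs).mono_right nhdsWithin_le_nhds)
      rwa [Real.sqrt_zero] at this
    · filter_upwards [self_mem_nhdsWithin] with η hη
      exact Real.sqrt_pos.2 (sub_pos.2 (mem_Iio.1 hη))
  refine tendsto_atTop_mono' _ ?_ hlim
  filter_upwards [hr.eventually_mem hr0] with η hη
  have hε : 0 < ηs - η := sub_pos.2 hη.1.2
  set s := √(ηs - η) with hs
  have hs0 : 0 < s := Real.sqrt_pos.2 hε
  have hss : s ^ 2 = ηs - η := Real.sq_sqrt hε.le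
  have hs1 : s ≤ 1 := by
    rw [hs, Real.sqrt_le_left zero_le_one]; linarith [hη.2]
  have hpos : ∀ x ∈ uIcc x₀ (x₀ + r), 0 < s - x₀ + x := fun x hx => by
    rw [uIcc_of_le (by linarith)] at hx; linarith [hx.1]
  have hlog : ∫ x in x₀..(x₀ + r), (s - x₀ + x)⁻¹ = Real.log ((s + r) / s) := by
    rw [intervalIntegral.integral_comp_add_left (fun x => x⁻¹), integral_inv_of_pos (by linarith)
      (by linarith)]
    congr 2 <;> ring
  have hci : IntervalIntegrable (fun x => (4 * K) ^ (-a) * (s - x₀ + x)⁻¹) volume x₀ (x₀ + r) := by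
    refine (ContinuousOn.intervalIntegrable ?_).const_mul _
    exact (Continuous.continuousOn (by fun_prop)).inv₀ fun x hx => (hpos x hx).ne'
  calc (4 * K) ^ (-a) * Real.log (r * s⁻¹)
      ≤ (4 * K) ^ (-a) * Real.log ((s + r) / s) := by
        refine mul_le_mul_of_nonneg_left (Real.log_le_log (by positivity) ?_) (by positivity)
        rw [div_eq_mul_inv]
        gcongr
        linarith
    _ = ∫ x in x₀..(x₀ + r), (4 * K) ^ (-a) * (s - x₀ + x)⁻¹ := by
        rw [intervalIntegral.integral_const_mul, hlog]
    _ ≤ _ := by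
        refine intervalIntegral.integral_mono_on (by linarith) hci
          ((hr.continuous_Q_rpow h hη.1 _).intervalIntegrable _ _) fun x hx => ?_
        have hQp := hr.Q_pos h hη.1 x
        have hw : 0 < s - x₀ + x := by linarith [hx.1]
        set w := s - x₀ + x with hwdef
        have hw2 : w / 2 ≤ 1 := by linarith [hx.2]
        -- With `s² = ηs - η`, `𝒬` is at most `K w²`, and `w ≤ 2`. Writing it with `w / 2 ≤ 1` lets
        -- the exponent `-2a ≤ -1` be replaced by `-1`, whose integral is a logarithm; `a = 1/2` is
        -- thus included.
        have h1 : Q lam kap u₀ ρ₀ x η ≤ 4 * K * (w / 2) ^ 2 := by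
          refine (hQ η ⟨by linarith [hη.2], hη.1.2⟩ x hx).trans ?_
          have : (ηs - η) + (x - x₀) ^ 2 ≤ w ^ 2 := by
            rw [← hss, hwdef]; nlinarith [hx.1]
          nlinarith
        refine le_trans ?_ (Real.rpow_le_rpow_of_nonpos hQp h1 (by linarith))
        rw [Real.mul_rpow (x := 4 * K) (y := (w / 2) ^ 2) (by positivity) (by positivity)]
        refine mul_le_mul_of_nonneg_left ?_ (by positivity)
        rw [← Real.rpow_natCast, ← Real.rpow_mul (by positivity : 0 ≤ w / 2)]
        calc w⁻¹ ≤ (w / 2)⁻¹ := inv_anti₀ (by positivity) (by linarith)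
          _ = (w / 2) ^ (-1 : ℝ) := (Real.rpow_neg_one _).symm
          _ ≤ _ := Real.rpow_le_rpow_of_exponent_ge (by positivity) hw2 (by push_cast; linarith)

include hlk

theorem jacOf_eq {η : ℝ} (hη : η ∈ Ico 0 ηs) (x : ℝ) : jacOf lam kap u₀ ρ₀ x η =
    Q lam kap u₀ ρ₀ x η ^ (-(1 / (2 * lam))) / mass lam kap u₀ ρ₀ η := by
  rw [jacOf, one_div (_ ^ _), Real.rpow_neg (hr.Q_pos h hη x).le]

theorem integral_sub_le {g : ℝ → ℝ} (hg : Continuous g) (h0 : ∀ x, 0 ≤ g x) {y z a v η : ℝ}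
    (hη : η ∈ Ico 0 ηs) (hy : 0 ≤ y) (hyz : y ≤ z) (hz : z ≤ 1)
    (hv : ∀ x ∈ Icc y z, v * Q lam kap u₀ ρ₀ x η ^ a ≤ g x) :
    v * (∫ x in y..z, Q lam kap u₀ ρ₀ x η ^ a) ≤ ∫ x in (0 : ℝ)..1, g x := by
  rw [← intervalIntegral.integral_const_mul]
  refine (intervalIntegral.integral_mono_on hyz
    ((continuous_const.mul (hr.continuous_Q_rpow h hη a)).intervalIntegrable _ _)
    (hg.intervalIntegrable _ _) hv).trans ?_
  exact intervalIntegral.integral_mono_interval hy hyz hz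
    (Eventually.of_forall h0) (hg.intervalIntegrable (μ := volume) 0 1)

/-- Lower bound for integrands of the form `|f| ^ p * jacOf` with `β / 𝒬 ≤ |f|`. -/
theorem rpow_mul_jacOf_ge {p β f C η x : ℝ} (hη : η ∈ Ico 0 ηs) (hp : 0 ≤ p) (hβ : 0 ≤ β)
    (hC : mass lam kap u₀ ρ₀ η ≤ C) (hf : β / Q lam kap u₀ ρ₀ x η ≤ |f|) :
    β ^ p / C * Q lam kap u₀ ρ₀ x η ^ (-(p + 1 / (2 * lam))) ≤
      |f| ^ p * jacOf lam kap u₀ ρ₀ x η := by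
  have hQ := hr.Q_pos h hη x
  have hA := hr.mass_pos h hlk hη
  rw [hr.jacOf_eq h hlk hη, neg_add, Real.rpow_add hQ]
  have h1 : β ^ p * Q lam kap u₀ ρ₀ x η ^ (-p) ≤ |f| ^ p := by
    refine le_trans (le_of_eq ?_) (Real.rpow_le_rpow (by positivity) hf hp)
    rw [Real.div_rpow hβ hQ.le, Real.rpow_neg hQ.le, div_eq_mul_inv]
  calc _ = (β ^ p * Q lam kap u₀ ρ₀ x η ^ (-p)) *
        (Q lam kap u₀ ρ₀ x η ^ (-(1 / (2 * lam))) / C) := by ring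
    _ ≤ _ := by
      have h2 : 0 ≤ Q lam kap u₀ ρ₀ x η ^ (-(1 / (2 * lam))) := Real.rpow_nonneg hQ.le _
      exact mul_le_mul h1 (div_le_div_of_nonneg_left h2 hA hC) (div_nonneg h2 (hA.le.trans hC))
        (Real.rpow_nonneg (abs_nonneg _) _)

theorem rpow_mass_ge (hlam : lam < 0) : ∃ γ > 0, ∀ η ∈ Ico 0 ηs,
    γ ≤ mass lam kap u₀ ρ₀ η ^ (-(2 * lam)) := by
  obtain ⟨c, hc, hm⟩ := hr.exists_mass_lower h hlk hlam
  exact ⟨c ^ (-(2 * lam)), by positivity, fun η hη =>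
    Real.rpow_le_rpow hc.le (hm η hη) (by linarith)⟩

/-- With the mass between positive constants, the integrand near the zero is at least a multiple of
`𝒬^(-(p + 1/(2λ)))`, and the condition on `λ` says precisely that `p + 1/(2λ) ≥ 1/2`. -/
theorem powNormR_tendsto_atTop_of_neg (hlam : lam < 0) {p : ℝ} (hp : 1 ≤ p)
    (hpl : lam ≤ -1 / (2 * p - 1)) : Tendsto (powNormR lam kap u₀ ρ₀ p) (𝓝[<] ηs) atTop := by
  obtain ⟨x₀, r, k, K, d, hx0, hr0, hr1, hxr, hrη, hk, hK, hd, hloc⟩ := hr.exists_local h hlk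
  obtain ⟨γ, hγ, hγm⟩ := hr.rpow_mass_ge h hlk hlam
  obtain ⟨C, hC, hCm⟩ := hr.exists_mass_upper h hlk hlam
  have ha : 1 / 2 ≤ p + 1 / (2 * lam) := by
    rw [le_div_iff₀ (by linarith)] at hpl
    have : 1 / (2 * lam) = -(1 / (2 * -lam)) := by rw [mul_neg, div_neg, neg_neg]
    rw [this]
    have : 1 / (2 * -lam) ≤ p - 1 / 2 := by
      rw [div_le_iff₀ (by linarith)]; nlinarith
    linarith
  have hdiv := hr.tendsto_integral_Q_rpow_atTop h (x₀ := x₀) ha hr0 hr1 hK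
    fun η hη x hx => (hloc η hη x hx).2.1
  refine tendsto_atTop_mono' _ ?_ (hdiv.const_mul_atTop (r := (d * γ) ^ p / C) (by positivity))
  filter_upwards [hr.eventually_mem hr0] with η hη
  refine hr.integral_sub_le h hlk (hr.continuous_integrandR h hlk hη.1 (by linarith : 0 ≤ p))
    (fun x => mul_nonneg (by positivity) (hr.jacOf_pos h hlk hη.1 x).le) hη.1 hx0 (by linarith) hxr
    fun x hx => ?_
  have hQ := hr.Q_pos h hη.1 x
  refine hr.rpow_mul_jacOf_ge h hlk hη.1 (by linarith) (by positivity) (hCm η hη.1) ?_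
  have hγ' := hγm η hη.1
  rw [abs_mul, abs_of_pos (div_pos (hγ.trans_le hγ') hQ), ← mul_div_assoc]
  have := (hloc η ⟨by linarith [hη.2], hη.1.2⟩ x hx).2.2.1
  gcongr

/-- Given a target `B`, either the mean `D` is so large that an interval where `𝒬_η/𝒬` is bounded
contributes more than `B`, or `|D| ≤ L`. In the second case, close enough to the zero, `D` is at
most half of `-𝒬_η/𝒬` in size and cannot compensate the divergence there. -/
theorem powNormU_tendsto_atTop_of_neg (hlam : lam < 0) {p : ℝ} (hp : 1 < p)
    (hpl : lam ≤ -1 / p) : Tendsto (powNormU lam kap u₀ ρ₀ p) (𝓝[<] ηs) atTop := by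
  obtain ⟨x₀, r, k, K, d, hx0, hr0, hr1, hxr, hrη, hk, hK, hd, hloc⟩ := hr.exists_local h hlk
  obtain ⟨γ, hγ, hγm⟩ := hr.rpow_mass_ge h hlk hlam
  obtain ⟨C, hC, hCm⟩ := hr.exists_mass_upper h hlk hlam
  obtain ⟨y, z, q, hy, hyz, hz, hq, hfar⟩ := hr.exists_far h hlk
  obtain ⟨M, hM, hMb⟩ := hr.Qη_le h hlk
  have hl2 : 0 < 1 / (2 * -lam) := by
    have : 0 < -lam := by linarith
    positivity
  have ha : 1 / 2 ≤ p + 1 / (2 * lam) := by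
    rw [le_div_iff₀ (by linarith)] at hpl
    have : 1 / (2 * lam) = -(1 / (2 * -lam)) := by rw [mul_neg, div_neg, neg_neg]
    rw [this]
    have : 1 / (2 * -lam) ≤ p / 2 := by
      rw [div_le_iff₀ (by linarith)]; nlinarith
    linarith
  set δ := 1 / (2 * -lam) * γ with hδ
  have hδ0 : 0 < δ := by positivity
  have hfac : ∀ η ∈ Ico 0 ηs, ∀ w, δ * |w| ≤
      |1 / (2 * lam) * mass lam kap u₀ ρ₀ η ^ (-(2 * lam)) * w| := fun η hη w => by
    have hA : 0 < mass lam kap u₀ ρ₀ η ^ (-(2 * lam)) := hγ.trans_le (hγm η hη)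
    rw [abs_mul, abs_mul, abs_of_pos hA, hδ, show |1 / (2 * lam)| = 1 / (2 * -lam) by
      rw [show 1 / (2 * lam) = -(1 / (2 * -lam)) by rw [mul_neg, div_neg, neg_neg], abs_neg,
        abs_of_pos hl2]]
    have := hγm η hη
    gcongr
  rw [tendsto_atTop]
  intro B
  -- a threshold `L` for the mean rate
  obtain ⟨L, hL1, hLM, hLB⟩ : ∃ L : ℝ, 1 ≤ L ∧ M / q ≤ L ∧
      B ≤ (z - y) * ((δ * (L - M / q)) ^ p * (q ^ (-(1 / (2 * lam))) / C)) := by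
    have : Tendsto (fun L => (z - y) * ((δ * (L - M / q)) ^ p * (q ^ (-(1 / (2 * lam))) / C)))
        atTop atTop := by
      refine Tendsto.const_mul_atTop (by linarith) (Tendsto.atTop_mul_const (by positivity) ?_)
      refine (tendsto_rpow_atTop (by linarith)).comp (Tendsto.const_mul_atTop hδ0 ?_)
      exact tendsto_atTop_add_const_right _ _ tendsto_id
    obtain ⟨L, h1, h2, h3⟩ := ((eventually_ge_atTop 1).and ((eventually_ge_atTop (M / q)).and
      (this.eventually_ge_atTop B))).exists
    exact ⟨L, h1, h2, h3⟩
  -- a neighbourhood of the zero where the rate exceeds `2 * L`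
  obtain ⟨s, hs0, hsr, hsL⟩ : ∃ s > 0, s ≤ r ∧ 2 * K * s ≤ d / (2 * L) :=
    ⟨min r (d / (2 * L) / (2 * K)), by positivity, min_le_left _ _, by
      rw [← le_div_iff₀' (by positivity)]; exact min_le_right _ _⟩
  have hdiv := hr.tendsto_integral_Q_rpow_atTop h (x₀ := x₀) ha hs0 (hsr.trans hr1) hK
    fun η hη x hx => (hloc η ⟨by linarith [hη.1], hη.2⟩ x ⟨hx.1, by linarith [hx.2]⟩).2.1
  filter_upwards [hr.eventually_mem hs0, (hdiv.const_mul_atTop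
    (r := (δ * (d / 2)) ^ p / C) (by positivity)).eventually_ge_atTop B] with η hη hηB
  have hcont := hr.continuous_integrandU h hlk hη.1 (by linarith : 0 ≤ p)
  have hnn : ∀ x, 0 ≤ |1 / (2 * lam) * mass lam kap u₀ ρ₀ η ^ (-(2 * lam)) *
    (meanRate lam kap u₀ ρ₀ η - Qη lam kap u₀ ρ₀ x η / Q lam kap u₀ ρ₀ x η)| ^ p
      * jacOf lam kap u₀ ρ₀ x η :=
    fun x => mul_nonneg (by positivity) (hr.jacOf_pos h hlk hη.1 x).le
  have hA := hr.mass_pos h hlk hη.1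
  set D := meanRate lam kap u₀ ρ₀ η with hD
  rcases le_total L |D| with hDL | hDL
  · refine hLB.trans (mul_le_integral hcont hnn hy hyz.le hz fun x hx => ?_)
    have hQ := hr.Q_pos h hη.1 x
    have hqQ := hfar η hη.1 x hx
    refine mul_le_mul ?_ ?_ (by positivity) (by positivity)
    · refine Real.rpow_le_rpow (mul_nonneg hδ0.le (by linarith)) ?_ (by linarith)
      refine le_trans (mul_le_mul_of_nonneg_left ?_ hδ0.le) (hfac η hη.1 _)
      have h1 : |Qη lam kap u₀ ρ₀ x η / Q lam kap u₀ ρ₀ x η| ≤ M / q := by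
        rw [abs_div, abs_of_pos hQ]
        exact div_le_div₀ hM.le (hMb η ⟨hη.1.1, hη.1.2.le⟩ x) hq hqQ
      have h2 := abs_sub_abs_le_abs_sub D (Qη lam kap u₀ ρ₀ x η / Q lam kap u₀ ρ₀ x η)
      linarith
    · rw [hr.jacOf_eq h hlk hη.1]
      have h1 := hCm η hη.1
      have h2 : q ^ (-(1 / (2 * lam))) ≤ Q lam kap u₀ ρ₀ x η ^ (-(1 / (2 * lam))) := by
        refine Real.rpow_le_rpow hq.le hqQ ?_
        rw [neg_nonneg]
        exact div_nonpos_of_nonneg_of_nonpos zero_le_one (by linarith)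
      gcongr
  · refine hηB.trans (hr.integral_sub_le h hlk hcont hnn hη.1 hx0 (by linarith) (by linarith)
      fun x hx => ?_)
    have hQ := hr.Q_pos h hη.1 x
    obtain ⟨-, q2, -, hqd⟩ := hloc η ⟨by linarith [hη.2], hη.1.2⟩ x ⟨hx.1, by linarith [hx.2]⟩
    refine hr.rpow_mul_jacOf_ge h hlk hη.1 (by linarith) (by positivity) (hCm η hη.1) ?_
    refine le_trans ?_ (hfac η hη.1 _)
    rw [mul_div_assoc]
    refine mul_le_mul_of_nonneg_left ?_ hδ0.le
    have hQL : Q lam kap u₀ ρ₀ x η ≤ d / (2 * L) := by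
      refine q2.trans (le_trans ?_ hsL)
      have : (x - x₀) ^ 2 ≤ s := by nlinarith [hx.1, hx.2]
      rw [show 2 * K * s = K * (s + s) by ring]
      exact mul_le_mul_of_nonneg_left (by linarith [hη.2]) hK.le
    have h1 : L ≤ d / 2 / Q lam kap u₀ ρ₀ x η := by
      rw [le_div_iff₀ (by positivity)] at hQL ⊢
      linarith
    have h2 : 2 * (d / 2 / Q lam kap u₀ ρ₀ x η) ≤
        -(Qη lam kap u₀ ρ₀ x η / Q lam kap u₀ ρ₀ x η) := by
      rw [← neg_div, ← mul_div_assoc, mul_div_cancel₀ _ (two_ne_zero)]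
      exact div_le_div_of_nonneg_right hqd hQ.le
    have h3 := (abs_le.1 hDL).1
    refine le_trans ?_ (le_abs_self _)
    linarith

/-! ### Convergence for `λ < 0` -/

/-- Dominated convergence, with a bound by an arbitrary power of `𝒬` with exponent above
`-1 / 2`. -/
theorem tendsto_integral_of_lt {G : ℝ → ℝ → ℝ} {g : ℝ → ℝ} {a C : ℝ} (ha : a < 1 / 2)
    (hC : 0 ≤ C) (hc : ∀ η ∈ Ico 0 ηs, Continuous fun x => G x η)
    (hb : ∀ᶠ η in 𝓝[<] ηs, ∀ x, |G x η| ≤ C * Q lam kap u₀ ρ₀ x η ^ (-a))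
    (hl : ∀ x, 0 < profile lam kap u₀ ρ₀ ηs x → Tendsto (G x) (𝓝[<] ηs) (𝓝 (g x))) :
    Tendsto (fun η => ∫ x in (0 : ℝ)..1, G x η) (𝓝[<] ηs) (𝓝 (∫ x in (0 : ℝ)..1, g x)) := by
  obtain ⟨K, hK, hQ⟩ := hr.Q_le h hlk
  refine hr.tendsto_integral h hlk (a := max a 0) (C := C * K ^ (max a 0 - a)) (le_max_right _ _)
    (max_lt ha (by norm_num)) (by positivity) hc ?_ hl
  filter_upwards [hb, hr.eventually_mem one_pos] with η h1 h2 x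
  have hQp := hr.Q_pos h h2.1 x
  refine (h1 x).trans ?_
  rw [mul_assoc]
  refine mul_le_mul_of_nonneg_left ?_ hC
  -- For negative `a` the surplus positive power of `𝒬` is absorbed by its upper bound `K`.
  rw [show -a = (max a 0 - a) + -max a 0 by ring, Real.rpow_add hQp]
  refine mul_le_mul_of_nonneg_right (Real.rpow_le_rpow hQp.le (hQ η h2.1 x) ?_) (by positivity)
  linarith [le_max_left a 0]

theorem tendsto_Q {x : ℝ} (hx : 0 < profile lam kap u₀ ρ₀ ηs x) :
    Tendsto (Q lam kap u₀ ρ₀ x) (𝓝[<] ηs) (𝓝 (Q lam kap u₀ ρ₀ x ηs)) ∧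
      0 < Q lam kap u₀ ρ₀ x ηs := by
  refine ⟨(hasDerivAt_Q x ηs).continuousAt.tendsto.mono_left nhdsWithin_le_nhds, ?_⟩
  rw [Q_eq_mul hlk]
  exact mul_pos hx (hr.coprofile_pos h hlk x)

omit hr h hlk in
theorem tendsto_Qη (x : ℝ) :
    Tendsto (Qη lam kap u₀ ρ₀ x) (𝓝[<] ηs) (𝓝 (Qη lam kap u₀ ρ₀ x ηs)) := by
  have : Continuous (Qη lam kap u₀ ρ₀ x) := by unfold Qη; fun_prop
  exact (this.tendsto ηs).mono_left nhdsWithin_le_nhds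

theorem tendsto_mass (hlam : lam < 0) :
    Tendsto (mass lam kap u₀ ρ₀) (𝓝[<] ηs) (𝓝 (mass lam kap u₀ ρ₀ ηs)) ∧
      0 < mass lam kap u₀ ρ₀ ηs := by
  have hlim : Tendsto (mass lam kap u₀ ρ₀) (𝓝[<] ηs) (𝓝 (mass lam kap u₀ ρ₀ ηs)) := by
    have hn : 1 / (2 * lam) < 0 := div_neg_of_pos_of_neg one_pos (by linarith)
    refine hr.tendsto_integral_of_lt h hlk (a := 1 / (2 * lam)) (C := 1) (by linarith) zero_le_one
      (fun η hη => hr.continuous_weight h hlk hη) ?_ fun x hx => ?_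
    · filter_upwards [hr.eventually_mem one_pos] with η hη x
      have hQ := hr.Q_pos h hη.1 x
      rw [abs_of_pos (by positivity), one_mul, Real.rpow_neg hQ.le, one_div (_ ^ _)]
    · obtain ⟨h1, h2⟩ := hr.tendsto_Q h hlk hx
      exact tendsto_const_nhds.div (h1.rpow_const (Or.inl h2.ne')) (by positivity)
  obtain ⟨c, hc, hm⟩ := hr.exists_mass_lower h hlk hlam
  refine ⟨hlim, hc.trans_le (ge_of_tendsto hlim ?_)⟩
  filter_upwards [hr.eventually_mem one_pos] with η hη using hm η hη.1

theorem tendsto_jacOf (hlam : lam < 0) {x : ℝ} (hx : 0 < profile lam kap u₀ ρ₀ ηs x) :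
    Tendsto (jacOf lam kap u₀ ρ₀ x) (𝓝[<] ηs) (𝓝 (jacOf lam kap u₀ ρ₀ x ηs)) := by
  obtain ⟨h1, h2⟩ := hr.tendsto_Q h hlk hx
  obtain ⟨h3, h4⟩ := hr.tendsto_mass h hlk hlam
  exact (tendsto_const_nhds.div (h1.rpow_const (Or.inl h2.ne')) (by positivity)).div h3 h4.ne'

/-- Upper bound for integrands of the form `|f| ^ p * jacOf` with `|f| ≤ β / 𝒬`. -/
theorem rpow_mul_jacOf_le {p β f c η x : ℝ} (hη : η ∈ Ico 0 ηs) (hp : 0 ≤ p) (hβ : 0 ≤ β)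
    (hc : 0 < c) (hcm : c ≤ mass lam kap u₀ ρ₀ η) (hf : |f| ≤ β / Q lam kap u₀ ρ₀ x η) :
    |f| ^ p * jacOf lam kap u₀ ρ₀ x η ≤
      β ^ p / c * Q lam kap u₀ ρ₀ x η ^ (-(p + 1 / (2 * lam))) := by
  have hQ := hr.Q_pos h hη x
  rw [hr.jacOf_eq h hlk hη, neg_add, Real.rpow_add hQ]
  have h1 : |f| ^ p ≤ β ^ p * Q lam kap u₀ ρ₀ x η ^ (-p) := by
    refine (Real.rpow_le_rpow (abs_nonneg _) hf hp).trans (le_of_eq ?_)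
    rw [Real.div_rpow hβ hQ.le, Real.rpow_neg hQ.le, div_eq_mul_inv]
  calc _ ≤ (β ^ p * Q lam kap u₀ ρ₀ x η ^ (-p)) *
        (Q lam kap u₀ ρ₀ x η ^ (-(1 / (2 * lam))) / c) := by
        have h2 : 0 ≤ Q lam kap u₀ ρ₀ x η ^ (-(1 / (2 * lam))) := Real.rpow_nonneg hQ.le _
        have hA := hc.trans_le hcm
        exact mul_le_mul h1 (div_le_div_of_nonneg_left h2 hc hcm) (div_nonneg h2 hA.le)
          (by positivity)
    _ = _ := by ring

omit hr h hlk in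
-- The origin of the threshold `-1/(2p-1)`: `𝒬^(-a)` has an integrable majorant near a quadratic
-- zero when `a < 1/2`.
theorem exponent_lt {p : ℝ} (hp : 1 ≤ p) (hpl : -1 / (2 * p - 1) < lam) (hlam : lam < 0) :
    p + 1 / (2 * lam) < 1 / 2 := by
  rw [div_lt_iff₀ (by linarith)] at hpl
  have : 1 / (2 * lam) = -(1 / (2 * -lam)) := by rw [mul_neg, div_neg, neg_neg]
  rw [this]
  have : p - 1 / 2 < 1 / (2 * -lam) := by
    rw [lt_div_iff₀ (by linarith)]; nlinarith
  linarith

theorem tendsto_meanRate (hlam : lam < 0) (he : 1 + 1 / (2 * lam) < 1 / 2) :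
    Tendsto (meanRate lam kap u₀ ρ₀) (𝓝[<] ηs) (𝓝 (meanRate lam kap u₀ ρ₀ ηs)) := by
  obtain ⟨c, hc, hm⟩ := hr.exists_mass_lower h hlk hlam
  obtain ⟨M, hM, hMb⟩ := hr.Qη_le h hlk
  refine hr.tendsto_integral_of_lt h hlk (C := M ^ (1 : ℝ) / c) he (by positivity)
    (fun η hη => ?_) ?_ fun x hx => ?_
  · exact ((h.continuous_Qη_left η).div (h.continuous_Q η) fun x => (hr.Q_pos h hη x).ne').mul
      (hr.continuous_jacOf h hlk hη)
  · filter_upwards [hr.eventually_mem one_pos] with η hη x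
    have hQ := hr.Q_pos h hη.1 x
    rw [abs_mul, abs_of_pos (hr.jacOf_pos h hlk hη.1 x)]
    have := hr.rpow_mul_jacOf_le h hlk (p := 1) (β := M) (c := c) (x := x)
      (f := Qη lam kap u₀ ρ₀ x η / Q lam kap u₀ ρ₀ x η) hη.1 zero_le_one hM.le hc (hm η hη.1) (by
        rw [abs_div, abs_of_pos hQ]
        exact div_le_div_of_nonneg_right (hMb η ⟨hη.1.1, hη.1.2.le⟩ x) hQ.le)
    rwa [Real.rpow_one |_|] at this
  · obtain ⟨h1, h2⟩ := hr.tendsto_Q h hlk hx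
    exact ((tendsto_Qη x).div h1 h2.ne').mul (hr.tendsto_jacOf h hlk hlam hx)

theorem rpow_mass_le (hlam : lam < 0) : ∃ Γ > 0, ∀ η ∈ Ico 0 ηs,
    mass lam kap u₀ ρ₀ η ^ (-(2 * lam)) ≤ Γ := by
  obtain ⟨C, hC, hm⟩ := hr.exists_mass_upper h hlk hlam
  exact ⟨C ^ (-(2 * lam)), by positivity, fun η hη =>
    Real.rpow_le_rpow (hr.mass_pos h hlk hη).le (hm η hη) (by linarith)⟩

theorem tendsto_powNormR (hlam : lam < 0) {p : ℝ} (hp : 1 ≤ p)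
    (hpl : -1 / (2 * p - 1) < lam) :
    Tendsto (powNormR lam kap u₀ ρ₀ p) (𝓝[<] ηs) (𝓝 (powNormR lam kap u₀ ρ₀ p ηs)) := by
  obtain ⟨c, hc, hm⟩ := hr.exists_mass_lower h hlk hlam
  obtain ⟨Γ, hΓ, hΓm⟩ := hr.rpow_mass_le h hlk hlam
  obtain ⟨R, hR, hRb⟩ := periodic_exists_bound h.periodic_ρ h.smooth_ρ.continuous
  refine hr.tendsto_integral_of_lt h hlk (C := (R * Γ) ^ p / c) (exponent_lt hp hpl hlam)
    (by positivity) (fun η hη => hr.continuous_integrandR h hlk hη (by linarith)) ?_ fun x hx => ?_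
  · filter_upwards [hr.eventually_mem one_pos] with η hη x
    have hQ := hr.Q_pos h hη.1 x
    rw [abs_of_nonneg (mul_nonneg (by positivity) (hr.jacOf_pos h hlk hη.1 x).le)]
    refine hr.rpow_mul_jacOf_le h hlk hη.1 (by linarith) (by positivity) hc (hm η hη.1) ?_
    have hA : 0 < mass lam kap u₀ ρ₀ η ^ (-(2 * lam)) :=
      Real.rpow_pos_of_pos (hr.mass_pos h hlk hη.1) _
    rw [abs_mul, abs_of_pos (div_pos hA hQ), ← mul_div_assoc]
    have h1 := hRb x
    have h2 := hΓm η hη.1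
    gcongr
  · obtain ⟨h1, h2⟩ := hr.tendsto_Q h hlk hx
    obtain ⟨h3, h4⟩ := hr.tendsto_mass h hlk hlam
    exact (((tendsto_const_nhds.mul ((h3.rpow_const (Or.inl h4.ne')).div h1 h2.ne')).abs).rpow_const
      (Or.inr (by linarith))).mul (hr.tendsto_jacOf h hlk hlam hx)

/-- The exponent condition for `p ≥ 1` contains the one for `p = 1`, so the mean `D` converges and
is eventually bounded by `D₀`. Then `|D - 𝒬_η/𝒬| ≤ (D₀ K + M) / 𝒬`, and the majorant has the same
form as for `ρ`. -/
theorem tendsto_powNormU (hlam : lam < 0) {p : ℝ} (hp : 1 ≤ p)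
    (hpl : -1 / (2 * p - 1) < lam) :
    Tendsto (powNormU lam kap u₀ ρ₀ p) (𝓝[<] ηs) (𝓝 (powNormU lam kap u₀ ρ₀ p ηs)) := by
  obtain ⟨c, hc, hm⟩ := hr.exists_mass_lower h hlk hlam
  obtain ⟨Γ, hΓ, hΓm⟩ := hr.rpow_mass_le h hlk hlam
  obtain ⟨M, hM, hMb⟩ := hr.Qη_le h hlk
  obtain ⟨K, hK, hQK⟩ := hr.Q_le h hlk
  have he := exponent_lt hp hpl hlam
  have hD := hr.tendsto_meanRate h hlk hlam (by linarith)
  set D₀ := |meanRate lam kap u₀ ρ₀ ηs| + 1 with hD0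
  have hDb : ∀ᶠ η in 𝓝[<] ηs, |meanRate lam kap u₀ ρ₀ η| < D₀ :=
    hD.abs.eventually_lt_const (by linarith)
  have hD0p : 0 < D₀ := by positivity
  refine hr.tendsto_integral_of_lt h hlk (C := (|1 / (2 * lam)| * Γ * (D₀ * K + M)) ^ p / c) he
    (by positivity) (fun η hη => hr.continuous_integrandU h hlk hη (by linarith)) ?_ fun x hx => ?_
  · filter_upwards [hr.eventually_mem one_pos, hDb] with η hη hηD x
    have hQ := hr.Q_pos h hη.1 x
    rw [abs_of_nonneg (mul_nonneg (by positivity) (hr.jacOf_pos h hlk hη.1 x).le)]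
    refine hr.rpow_mul_jacOf_le h hlk hη.1 (by linarith) (by positivity) hc (hm η hη.1) ?_
    have hA : 0 < mass lam kap u₀ ρ₀ η ^ (-(2 * lam)) :=
      Real.rpow_pos_of_pos (hr.mass_pos h hlk hη.1) _
    rw [abs_mul, abs_mul, abs_of_pos hA, mul_div_assoc]
    refine mul_le_mul (mul_le_mul_of_nonneg_left (hΓm η hη.1) (abs_nonneg _)) ?_ (abs_nonneg _)
      (by positivity)
    refine (abs_sub _ _).trans ?_
    rw [add_div, abs_div, abs_of_pos hQ]
    refine add_le_add ?_ (div_le_div_of_nonneg_right (hMb η ⟨hη.1.1, hη.1.2.le⟩ x) hQ.le)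
    rw [le_div_iff₀ hQ]
    exact mul_le_mul hηD.le (hQK η hη.1 x) hQ.le hD0p.le
  · obtain ⟨h1, h2⟩ := hr.tendsto_Q h hlk hx
    obtain ⟨h3, h4⟩ := hr.tendsto_mass h hlk hlam
    exact (((tendsto_const_nhds.mul (h3.rpow_const (Or.inl h4.ne'))).mul
      (hD.sub ((tendsto_Qη x).div h1 h2.ne'))).abs.rpow_const
      (Or.inr (by linarith))).mul (hr.tendsto_jacOf h hlk hlam hx)

end IsEarliestSimpleRoot

end


/-! ### Admissible data -/

theorem hasDerivAt_two_add_cos (a x : ℝ) :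
    HasDerivAt (fun x => a * (2 + Real.cos (2 * Real.pi * x)))
      (-(a * (2 * Real.pi)) * Real.sin (2 * Real.pi * x)) x := by
  have h1 : HasDerivAt (fun x => 2 * Real.pi * x) (2 * Real.pi) x := by
    simpa using (hasDerivAt_id x).const_mul (2 * Real.pi)
  exact ((h1.cos.const_add 2).const_mul a).congr_deriv (by ring)

theorem nondegenerate_two_add_cos {a x : ℝ} (ha : a ≠ 0) (hx : Real.cos (2 * Real.pi * x) = 1) :
    deriv (fun x => a * (2 + Real.cos (2 * Real.pi * x))) x = 0 ∧
      deriv (deriv fun x => a * (2 + Real.cos (2 * Real.pi * x))) x ≠ 0 := by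
  have hs : Real.sin (2 * Real.pi * x) = 0 := by
    have := Real.sin_sq_add_cos_sq (2 * Real.pi * x)
    rw [hx] at this
    nlinarith
  have hd : deriv (fun x => a * (2 + Real.cos (2 * Real.pi * x))) =
      fun x => -(a * (2 * Real.pi)) * Real.sin (2 * Real.pi * x) :=
    funext fun x => (hasDerivAt_two_add_cos a x).deriv
  have h1 : HasDerivAt (fun x => 2 * Real.pi * x) (2 * Real.pi) x := by
    simpa using (hasDerivAt_id x).const_mul (2 * Real.pi)
  rw [hd, (h1.sin.const_mul (-(a * (2 * Real.pi)))).deriv, hx]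
  refine ⟨by simp only [hs, mul_zero], ?_⟩
  have := Real.pi_ne_zero
  simp [ha, this]

theorem isSmoothPeriodicData_two_add_cos :
    IsSmoothPeriodicData (fun _ => 0) fun x => 2 + Real.cos (2 * Real.pi * x) where
  smooth_u := contDiff_const
  smooth_ρ := contDiff_const.add (Real.contDiff_cos.comp (contDiff_const.mul contDiff_id))
  periodic_u := fun _ => rfl
  periodic_ρ := fun x => by
    simp only [mul_add, mul_one, Real.cos_add_two_pi]

/-- With `u₀ = 0` one has `𝒬 = 1 - λκ ρ₀² η²`, so the earliest root comes from the maximum `3` of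
`ρ₀ = 2 + cos 2πx`. It is simple because `ρ₀ > 0`, and `gPlus`, `gMinus` are nonzero multiples of
`ρ₀`, nondegenerate where the cosine is `1`. -/
theorem isEarliestSimpleRoot_two_add_cos {lam kap : ℝ} (hlk : 0 < lam * kap) :
    IsEarliestSimpleRoot lam kap (fun _ => 0) (fun x => 2 + Real.cos (2 * Real.pi * x))
      (1 / (3 * √(lam * kap))) := by
  set s := √(lam * kap) with hs
  have hs0 : 0 < s := Real.sqrt_pos.2 hlk
  have hss : s ^ 2 = lam * kap := Real.sq_sqrt hlk.le
  have hρ1 : ∀ x : ℝ, 1 ≤ 2 + Real.cos (2 * Real.pi * x) := fun x => by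
    linarith [Real.neg_one_le_cos (2 * Real.pi * x)]
  have hρ3 : ∀ x : ℝ, 2 + Real.cos (2 * Real.pi * x) ≤ 3 := fun x => by
    linarith [Real.cos_le_one (2 * Real.pi * x)]
  have hc : ∀ x, c lam kap (fun _ => 0) (fun x => 2 + Real.cos (2 * Real.pi * x)) x =
      -(s * (2 + Real.cos (2 * Real.pi * x))) ^ 2 := fun x => by
    rw [mul_pow, hss, c, deriv_const]; ring
  have hQ : ∀ x η, Q lam kap (fun _ => 0) (fun x => 2 + Real.cos (2 * Real.pi * x)) x η =
      1 - (s * (2 + Real.cos (2 * Real.pi * x)) * η) ^ 2 := fun x η => by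
    rw [Q, hc, deriv_const]; ring
  have hroot : ∀ x η, 0 < η →
      Q lam kap (fun _ => 0) (fun x => 2 + Real.cos (2 * Real.pi * x)) x η = 0 →
      s * (2 + Real.cos (2 * Real.pi * x)) * η = 1 := fun x η hη hx => by
    rw [hQ, sub_eq_zero, eq_comm] at hx
    have : 0 ≤ s * (2 + Real.cos (2 * Real.pi * x)) * η :=
      mul_nonneg (mul_nonneg hs0.le (by linarith [hρ1 x])) hη.le
    exact (pow_eq_one_iff_of_nonneg this two_ne_zero).1 hx
  have hzero : ∀ x, Q lam kap (fun _ => 0) (fun x => 2 + Real.cos (2 * Real.pi * x)) x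
      (1 / (3 * s)) = 0 → Real.cos (2 * Real.pi * x) = 1 := fun x hx => by
    have := hroot x _ (by positivity) hx
    field_simp at this
    linarith
  have hratio : 0 < √(kap / lam) := Real.sqrt_pos.2 (by
    rcases pos_and_pos_or_neg_and_neg_of_mul_pos hlk with ⟨h1, h2⟩ | ⟨h1, h2⟩
    · positivity
    · exact div_pos_of_neg_of_neg h2 h1)
  have habs : ∀ x : ℝ, |2 + Real.cos (2 * Real.pi * x)| = 2 + Real.cos (2 * Real.pi * x) :=
    fun x => abs_of_pos (by linarith [hρ1 x])
  refine ⟨⟨⟨by positivity, 0, ⟨le_rfl, zero_le_one⟩, ?_⟩, ?_⟩, fun x _ hx => ?_, fun _ x _ hx => ?_,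
    fun _ x _ hx => ?_⟩
  · rw [hQ, mul_zero, Real.cos_zero]
    field_simp
    norm_num
  · rintro η ⟨hη, x, -, hx⟩
    have h1 := hroot x η hη hx
    rw [div_le_iff₀ (by positivity), ← h1]
    have := hρ3 x
    calc s * (2 + Real.cos (2 * Real.pi * x)) * η ≤ s * 3 * η := by gcongr
      _ = _ := by ring
  · rw [(hasDerivAt_Q x _).deriv, Qη, hc, hzero x hx, deriv_const]
    have : 0 < 1 / (3 * s) := by positivity
    nlinarith [mul_pos (pow_pos (mul_pos hs0 (show (0 : ℝ) < 2 + 1 by norm_num)) 2) this]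
  · have e : gMinus lam kap (fun _ => 0) (fun x => 2 + Real.cos (2 * Real.pi * x)) =
        fun x => -√(kap / lam) * (2 + Real.cos (2 * Real.pi * x)) := funext fun x => by
      simp only [gMinus, deriv_const, habs]; ring
    rw [e]
    exact nondegenerate_two_add_cos (neg_ne_zero.2 hratio.ne') (hzero x hx)
  · have e : gPlus lam kap (fun _ => 0) (fun x => 2 + Real.cos (2 * Real.pi * x)) =
        fun x => √(kap / lam) * (2 + Real.cos (2 * Real.pi * x)) := funext fun x => by
      simp only [gPlus, deriv_const, habs]; ring
    rw [e]
    exact nondegenerate_two_add_cos hratio.ne' (hzero x hx)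

end GHS

/-! ### The theorem -/

theorem mainTheorem2 :
    (∀ lam kap : ℝ, 0 < lam * kap →
      ∀ u₀ ρ₀ : ℝ → ℝ, GHS.IsSmoothPeriodicData u₀ ρ₀ →
      ∀ ηs : ℝ, GHS.IsEarliestSimpleRoot lam kap u₀ ρ₀ ηs →
      ∃ ts : ℝ, 0 < ts ∧
        Tendsto (GHS.timeOf lam kap u₀ ρ₀) (𝓝[<] ηs) (𝓝 ts) ∧
        (∃ u ρ : ℝ → ℝ → ℝ, GHS.IsSmoothSolution lam kap u₀ ρ₀ ts u ρ) ∧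
        ∀ u ρ : ℝ → ℝ → ℝ, GHS.IsSmoothSolution lam kap u₀ ρ₀ ts u ρ →
          (∀ p : ℝ, 1 < p → (lam ≤ -1 / p ∨ 0 < lam) →
            Tendsto (fun t => GHS.normLp p (fun x => GHS.dx u x t)) (𝓝[<] ts) (𝓝 ⊤)) ∧
          (∀ p : ℝ, 1 ≤ p → -1 / (2 * p - 1) < lam → lam < 0 →
            ∃ L : ℝ≥0,
              Tendsto (fun t => GHS.normLp p (fun x => GHS.dx u x t)) (𝓝[<] ts) (𝓝 (L : ℝ≥0∞))) ∧
          (∀ p : ℝ, 1 ≤ p → (lam ≤ -1 / (2 * p - 1) ∨ 0 < lam) →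
            Tendsto (fun t => GHS.normLp p (fun x => ρ x t)) (𝓝[<] ts) (𝓝 ⊤)) ∧
          (∀ p : ℝ, 1 ≤ p → -1 / (2 * p - 1) < lam → lam < 0 →
            ∃ L : ℝ≥0,
              Tendsto (fun t => GHS.normLp p (fun x => ρ x t)) (𝓝[<] ts) (𝓝 (L : ℝ≥0∞)))) ∧
    (∃ u₀ ρ₀ : ℝ → ℝ, GHS.IsSmoothPeriodicData u₀ ρ₀ ∧
      ∀ lam kap : ℝ, 0 < lam * kap → ∃ ηs : ℝ, GHS.IsEarliestSimpleRoot lam kap u₀ ρ₀ ηs) := by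
  refine ⟨fun lam kap hlk u₀ ρ₀ h ηs hr => ?_, _, _, GHS.isSmoothPeriodicData_two_add_cos,
    fun lam kap hlk => ⟨_, GHS.isEarliestSimpleRoot_two_add_cos hlk⟩⟩
  have hlam : lam ≠ 0 := left_ne_zero_of_mul hlk.ne'
  obtain ⟨ts, hts⟩ := hr.exists_tendsto_timeOf h hlk
  obtain ⟨δ, hδ, hQ⟩ := hr.exists_Q_pos h hlk
  obtain ⟨hts0, W, η, E, hc, hTW, h0W, hη0, hE0, hint, -, hE, hη⟩ :=
    GHS.exists_clock h hlam hδ hr.pos hQ hts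
  refine ⟨ts, hts0, hts, ⟨_, _, (hc.isSmoothSolution h hlam hTW h0W hη0 hE0 hint).2⟩,
    fun u ρ hs => ?_⟩
  have key : ∀ p : ℝ, 1 ≤ p →
      (∀ᶠ t in 𝓝[<] ts, ENNReal.ofReal (GHS.powNormU lam kap u₀ ρ₀ p (η t) ^ (1 / p)) =
        GHS.normLp p (fun x => GHS.dx u x t)) ∧
      ∀ᶠ t in 𝓝[<] ts, ENNReal.ofReal (GHS.powNormR lam kap u₀ ρ₀ p (η t) ^ (1 / p)) =
        GHS.normLp p (fun x => ρ x t) := fun p hp => by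
    constructor <;> filter_upwards [Ioo_mem_nhdsLT hts0] with t ht
    · exact (GHS.norm_solution h hlam hc hTW h0W hη0 hE0 hint hE hs hp ⟨ht.1.le, ht.2⟩).1.symm
    · exact (GHS.norm_solution h hlam hc hTW h0W hη0 hE0 hint hE hs hp ⟨ht.1.le, ht.2⟩).2.symm
  refine ⟨fun p hp hl => ?_, fun p hp h1 h2 => ?_, fun p hp hl => ?_, fun p hp h1 h2 => ?_⟩
  · refine (GHS.tendsto_ofReal_rpow_top hp.le hη ?_).congr' (key p hp.le).1
    rcases lt_or_gt_of_ne hlam with hneg | hpos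
    · exact hr.powNormU_tendsto_atTop_of_neg h hlk hneg hp (hl.resolve_right hneg.not_gt)
    · exact hr.powNormU_tendsto_atTop_of_pos h hlk hpos hp.le
  · obtain ⟨L, hL⟩ := GHS.tendsto_ofReal_rpow hp hη (hr.tendsto_powNormU h hlk h2 hp h1)
    exact ⟨L, hL.congr' (key p hp).1⟩
  · refine (GHS.tendsto_ofReal_rpow_top hp hη ?_).congr' (key p hp).2
    rcases lt_or_gt_of_ne hlam with hneg | hpos
    · exact hr.powNormR_tendsto_atTop_of_neg h hlk hneg hp (hl.resolve_right hneg.not_gt)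
    · exact hr.powNormR_tendsto_atTop_of_pos h hlk hpos hp
  · obtain ⟨L, hL⟩ := GHS.tendsto_ofReal_rpow hp hη (hr.tendsto_powNormR h hlk h2 hp h1)
    exact ⟨L, hL.congr' (key p hp).2⟩
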